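/- Let $H$ be a complex Hilbert space with inner product $(\cdot,\cdot)$ (linear in the first argument) and norm $\|\cdot\|$. Let $a$ be a closed, Hermitian, positive-definite sesquilinear form on a dense subspace $V\subset H$; put $\|u\|_V:=a(u,u)^{1/2}$ for $u\in V$. Let $b$ be a sesquilinear form on $V$ that is bounded, $|b(u,v)|\le C\|u\|_V\|v\|_V$ for some constant $C$. Let $A$ and $T$ be the operators in $H$ associated with $a$ and with $a+b$; e.g. $u\in D(T)$ and $Tu=f$ if and only if $u\in V$ and $a(u,v)+b(u,v)=(f,v)$ for all $v\in V$. Let $(\mu_k,\psi_k)_{k\ge1}$ be eigenpairs of $A$ such that $(\psi_k)_{k\ge 1}$ is an orthonormal basis of $H$. Assume: * (eigenvalue separation) there are $\gamma>0$, $\kappa>0$, $N_0$ with $\mu_{k+1}-\mu_k\ge\kappa k^{\gamma-1}$ for all $k\ge N_0$; * (local form-subordination) there are $\alpha\in\mathbb R$ with $2\alpha+\gamma>1$ and $M_b>0$ with $|b(\psi_m,\psi_n)|\le M_b\,m^{-\alpha}n^{-\alpha}$ for all $m,n\ge1$. For $n\ge1$ let $$\Pi_n:=\Big\{z\in\mathbb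 C:\ \mu_n-\tfrac{\kappa}{2}(n-1)^{\gamma-1}<\operatorname{Re}z<\mu_n+\tfrac{\kappa}{2}n^{\gamma-1},\ |\operatorname{Im}z|<\tfrac{\kappa}{2}n^{\gamma-1}\Big\}$$ and let $\Gamma_n=\partial\Pi_n$, counterclockwise. Then for all sufficiently large $n$ the set $\overline{\Pi_n}$ contains exactly one point $\lambda_n$ of the spectrum of $T$; it lies in $\Pi_n$, it is an eigenvalue of algebraic multiplicity one, and $$\phi_n:=\frac1{2\pi i}\int_{\Gamma_n}(z-T)^{-1}\psi_n\,dz$$ is an eigenvector, $T\phi_n=\lambda_n\phi_n$, $\phi_n\neq0$. For these pairs (with arbitrary $\lambda_n\in\mathbb C$, $\phi_n\in V$ for the finitely many remaining $n$) $$\lim_{j\to\infty}\frac{|\lambda_j|^{1/2}}{\mu_j^{1/2}}=1,\qquad \lim_{j\to\infty}\frac{|\lambda_j|^{1/2}}{\|\phi_j\|_V}=1 .$$ If, in addition, $2\alpha+\gamma>\tfrac32$ in the case $\alpha\le1$ (and $2\alpha+\gamma>1$ in the case $\alpha>1$), then $\{\phi_j/\|\phi_j\|_V\}$ is quadratically close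 to $\{\psi_j/\mu_j^{1/2}\}$ in $V$: $$\sum_{j}\Big\|\frac{\phi_j}{\|\phi_j\|_V}-\frac{\psi_j}{\mu_j^{1/2}}\Big\|_V^2<\infty$$ (where $\phi_j/\|\phi_j\|_V$ is read as $0$ if $\phi_j=0$, and $\psi_j/\mu_j^{1/2}$ makes sense as all $\mu_j>0$). -/

import Mathlib

open Filter Topology

noncomputable section

namespace FormPerturbation

variable {H : Type*} [NormedAddCommGroup H] [InnerProductSpace ℂ H]

/-! ### Unbounded operators: eigenvalues, root vectors, resolvent -/

/-- `(z, x)` is an eigenpair of the unbounded operator `T`: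
`0 ≠ x ∈ D(T)` and `T x = z x`. -/
def IsEigenpair (T : H →ₗ.[ℂ] H) (z : ℂ) (x : H) : Prop :=
  x ≠ 0 ∧ ∃ hx : x ∈ T.domain, T ⟨x, hx⟩ = z • x

/-- The kernel of `(T - z)^k`, with the natural domain of the iterated operator. -/
def iterKer (T : H →ₗ.[ℂ] H) (z : ℂ) : ℕ → Set H
  | 0 => {0}
  | k + 1 => {x | ∃ hx : x ∈ T.domain, T ⟨x, hx⟩ - z • x ∈ iterKer T z k}

/-- `z` is an eigenvalue of algebraic multiplicity one: the space of all root vectors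
of `T` at `z` is the line spanned by an eigenvector. -/
def IsSimpleEigenvalue (T : H →ₗ.[ℂ] H) (z : ℂ) : Prop :=
  ∃ x, IsEigenpair T z x ∧ ∀ k, ∀ y ∈ iterKer T z k, y ∈ Submodule.span ℂ {x}

/-- The bounded operator `R` is a two-sided inverse of `z - T : D(T) → H`. -/
def IsResolventAt (T : H →ₗ.[ℂ] H) (z : ℂ) (R : H →L[ℂ] H) : Prop :=
  (∀ f, ∃ hf : R f ∈ T.domain, z • R f - T ⟨R f, hf⟩ = f) ∧
    ∀ u : T.domain, R (z • (u : H) - T u) = u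

/-- The resolvent set `ρ(T)`. -/
def resolventSet (T : H →ₗ.[ℂ] H) : Set ℂ := {z | ∃ R, IsResolventAt T z R}

open Classical in
/-- The resolvent `(z - T)⁻¹` for `z ∈ ρ(T)` (and `0` for other `z`). -/
def resolvent (T : H →ₗ.[ℂ] H) (z : ℂ) : H →L[ℂ] H :=
  if hz : z ∈ resolventSet T then Classical.choose hz else 0

/-! ### Sesquilinear forms and their operators

Forms on a subspace `V` of `H` are linear in the first and conjugate-linear in the second
argument. As `inner ℂ` is conjugate-linear in its first argument, the product `(f, v)` that is
linear in `f` is written `inner ℂ v f`. -/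

variable {V : Submodule ℂ H}

/-- The graph of the operator of the form `t`: all `(u, f)` with `u ∈ V` and
`t(u, v) = (f, v)` for all `v ∈ V`. -/
def formGraph (t : V →ₗ[ℂ] V →ₗ⋆[ℂ] ℂ) : Submodule ℂ (H × H) where
  carrier := {p | ∃ u : V, (u : H) = p.1 ∧ ∀ v : V, t u v = inner ℂ (v : H) p.2}
  add_mem' := by
    rintro p q ⟨u, hu, hu'⟩ ⟨w, hw, hw'⟩
    exact ⟨u + w, by simp [hu, hw], fun v => by simp [hu', hw']⟩
  zero_mem' := ⟨0, by simp, fun v => by simp⟩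
  smul_mem' := by
    rintro c p ⟨u, hu, hu'⟩
    exact ⟨c • u, by simp [hu], fun v => by simp [hu']⟩

/-- The operator associated with the (densely defined) form `t`. -/
def formOperator (t : V →ₗ[ℂ] V →ₗ⋆[ℂ] ℂ) : H →ₗ.[ℂ] H := (formGraph t).toLinearPMap

theorem formGraph_single_valued (hV : Dense (V : Set H)) (t : V →ₗ[ℂ] V →ₗ⋆[ℂ] ℂ)
    (p : H × H) (hp : p ∈ formGraph t) (h0 : p.1 = 0) : p.2 = 0 := by
  obtain ⟨u, hu, h⟩ := hp
  have hu0 : u = 0 := by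
    apply Subtype.ext
    simp [hu, h0]
  refine hV.eq_zero_of_inner_left (𝕜 := ℂ) fun v hv => ?_
  have h2 : inner ℂ v p.2 = 0 := by
    rw [← h ⟨v, hv⟩, hu0]
    simp
  rw [← inner_conj_symm, h2, map_zero]

/-- For a densely defined form, `formGraph t` is the graph of `formOperator t`. -/
theorem formOperator_graph (hV : Dense (V : Set H)) (t : V →ₗ[ℂ] V →ₗ⋆[ℂ] ℂ) :
    (formOperator t).graph = formGraph t :=
  Submodule.toLinearPMap_graph_eq _ (formGraph_single_valued hV t)

/-- The energy norm `‖u‖_V = a(u, u)^{1/2}`. -/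
def energyNorm (a : V →ₗ[ℂ] V →ₗ⋆[ℂ] ℂ) (u : V) : ℝ := √((a u u).re)

/-- A nonnegative Hermitian form is closed: if `u_n ∈ V` converges in `H` to `x` and is Cauchy
with respect to `a`, then `x ∈ V` and `a(u_n - x, u_n - x) → 0`. -/
def IsClosedForm (a : V →ₗ[ℂ] V →ₗ⋆[ℂ] ℂ) : Prop :=
  ∀ (u : ℕ → V) (x : H), Tendsto (fun n => (u n : H)) atTop (𝓝 x) →
    (∀ ε > 0, ∃ N, ∀ m ≥ N, ∀ n ≥ N, energyNorm a (u m - u n) < ε) →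
    ∃ hx : x ∈ V, Tendsto (fun n => energyNorm a (u n - ⟨x, hx⟩)) atTop (𝓝 0)

/-! ### Riesz projections onto the perturbed eigenvectors

Sequences are indexed by `n = 0, 1, 2, …`; index `n` here is the `(n+1)`-st item. -/

/-- The integral of `f` along the boundary of the rectangle with lower left corner `z` and upper
right corner `w`, counterclockwise. -/
def rectIntegral (f : ℂ → H) (z w : ℂ) : H :=
  (∫ x : ℝ in z.re..w.re, f (x + z.im * Complex.I)) -
    (∫ x : ℝ in z.re..w.re, f (x + w.im * Complex.I)) +
    Complex.I • (∫ y : ℝ in z.im..w.im, f (w.re + y * Complex.I)) -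
    Complex.I • (∫ y : ℝ in z.im..w.im, f (z.re + y * Complex.I))

/-- Lower left corner of the rectangle around the `(n+1)`-st eigenvalue. -/
def lowerCorner (μ : ℕ → ℝ) (κ γ : ℝ) (n : ℕ) : ℂ :=
  ⟨μ n - κ / 2 * (n : ℝ) ^ (γ - 1), -(κ / 2 * ((n : ℝ) + 1) ^ (γ - 1))⟩

/-- Upper right corner of the rectangle around the `(n+1)`-st eigenvalue. -/
def upperCorner (μ : ℕ → ℝ) (κ γ : ℝ) (n : ℕ) : ℂ :=
  ⟨μ n + κ / 2 * ((n : ℝ) + 1) ^ (γ - 1), κ / 2 * ((n : ℝ) + 1) ^ (γ - 1)⟩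

/-- The open rectangle around the `(n+1)`-st eigenvalue. -/
def rectangle (μ : ℕ → ℝ) (κ γ : ℝ) (n : ℕ) : Set ℂ :=
  {z | (lowerCorner μ κ γ n).re < z.re ∧ z.re < (upperCorner μ κ γ n).re ∧
    (lowerCorner μ κ γ n).im < z.im ∧ z.im < (upperCorner μ κ γ n).im}

/-- The vector `(2πi)⁻¹ ∮ (z - T)⁻¹ x dz` over the boundary of the `n`-th rectangle. -/
def rieszVector (T : H →ₗ.[ℂ] H) (μ : ℕ → ℝ) (κ γ : ℝ) (n : ℕ) (x : H) : H :=
  (2 * (Real.pi : ℂ) * Complex.I)⁻¹ •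
    rectIntegral (fun z => resolvent T z x) (lowerCorner μ κ γ n) (upperCorner μ κ γ n)

/-- `(lam, phi)` is the `n`-th eigenpair of `T`, seen as a perturbation of the pair `(μ n, ψn)`:
`lam` is the only spectral point of `T` in the closed `n`-th rectangle, it lies in the open
rectangle and is algebraically simple, and `phi` is the eigenvector obtained from `ψn` by the
Riesz projection. -/
structure IsPerturbedEigenpair (T : H →ₗ.[ℂ] H) (μ : ℕ → ℝ) (κ γ : ℝ) (n : ℕ) (ψn : H)
    (lam : ℂ) (phi : H) : Prop where
  mem_rectangle : lam ∈ rectangle μ κ γ n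
  isolated : ∀ z ∈ closure (rectangle μ κ γ n), z ≠ lam → z ∈ resolventSet T
  simple : IsSimpleEigenvalue T lam
  eigenpair : IsEigenpair T lam phi
  eq_riesz : phi = rieszVector T μ κ γ n ψn

end FormPerturbation

end

noncomputable section

namespace FormPerturbation

/-! ### Cauchy's integral formula on rectangles -/

section Rectangle

variable {F : Type*} [NormedAddCommGroup F] [InnerProductSpace ℂ F]

/-! The eigenvalue problem is transported to `ℓ²` and solved near each `μ n` by a Lyapunov–Schmidt
reduction to one complex variable. Closedness makes `V` with the energy norm a Hilbert space with
orthonormal basis `ψ k / √(μ k)`. In these coordinates `a` is the identity, the inner product of `H`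
is `diag (1 / μ)`, and `b` is a bounded operator `B`.

Smallness of the perturbation appears only after rescaling for a fixed `n`. With `w m = |μ n - μ m|`
for `m ≠ n`, `w n = κ (n+1)^(γ-1)` and coordinates scaled by `√(μ m / w m)`, the form `z - a - b`
becomes the full operator `L(z) = diag ((z - μ m) / w m) - K`. The entries of `K` are bounded by `p
m * p k`, where `p m ^ 2 = M (m+1)^(-2α) / w m`. The separation of the eigenvalues gives `∑ p m ^ 2
≤ C (n+1)^(-δ)`, which tends to `0` with `n`.

On the closed rectangle every diagonal entry except the `n`-th has modulus at least `1/2`. Replacing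
the `n`-th entry by `1` gives an invertible reduced operator `N(z)`; put `x(z) = N(z)⁻¹ e_n`. Since
`L` and `N` differ by rank one, `L(z) x(z)` is a multiple of `e_n` whose factor vanishes exactly
when `z` is a fixed point of `fixFun`. That function is a contraction near `μ n`, so there is
exactly one such `z`, namely `λ_n`. The resolvent applied to `ψ n` is a scalar with a simple pole
times `J x(z)`, where `J` maps the rescaled coordinates to `H`; Cauchy's formula then evaluates the
Riesz projection explicitly as a multiple of `J x(λ_n)`.

The coordinatewise bound `|x m - δ_{mn}| ≤ 3 p m p n` makes the squared energy distance of `φ_n /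
√(μ n)` from `ψ n / √(μ n)` at most a constant times `errorSum`. This tends to `0` if `2α + γ > 1`
and is summable if `2α + γ > 3/2`. The main steps are `exists_coordinates`,
`IsSmall.fullOp_reducedVec`, `exists_perturbedEigenpair`, `IsSeparated.sum_le_first` and
`IsSeparated.sum_le_second`. -/

theorem integral_inv_segment (ω p u : ℂ) (hω : ω ≠ 0) (a b : ℝ)
    (h : ∀ t ∈ Set.uIcc a b, ω * (p + t * u) ∈ Complex.slitPlane) :
    u * ∫ t : ℝ in a..b, (p + t * u)⁻¹ =
      Complex.log (ω * (p + b * u)) - Complex.log (ω * (p + a * u)) := by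
  have hne : ∀ t ∈ Set.uIcc a b, p + t * u ≠ 0 := fun t ht h0 => by
    have := Complex.slitPlane_ne_zero (h t ht)
    simp [h0] at this
  rw [← intervalIntegral.integral_const_mul]
  -- The rotation by `ω` moves the segment off the branch cut, so that the principal logarithm is a
  -- primitive there.
  refine intervalIntegral.integral_eq_sub_of_hasDerivAt
    (f := fun t : ℝ => Complex.log (ω * (p + t * u))) (fun t ht => ?_) ?_
  · have h1 : HasDerivAt (fun t : ℝ => ω * (p + t * u)) (ω * u) t := by
      have := (((Complex.ofRealCLM.hasDerivAt (x := t)).mul_const u).const_add p).const_mul ω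
      simpa using this
    refine (h1.clog_real (h t ht)).congr_deriv ?_
    rw [mul_div_mul_left _ _ hω, div_eq_mul_inv]
  · apply ContinuousOn.intervalIntegrable
    refine ContinuousOn.mul continuousOn_const (ContinuousOn.inv₀ (by fun_prop) hne)

theorem log_neg_I_mul {c : ℂ} (hre : 0 < c.re) (him : 0 < c.im) :
    Complex.log (-Complex.I * c) = Complex.log c - Real.pi / 2 * Complex.I := by
  have hc : c ≠ 0 := fun h => by simp [h] at hre
  have h1 : 0 ≤ c.arg := Complex.arg_nonneg_iff.2 him.le
  have h2 : c.arg ≤ Real.pi := Complex.arg_le_pi c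
  have h3 := Real.pi_pos
  rw [(Complex.log_mul_eq_add_log_iff (by simp) hc).2, Complex.log_neg_I]
  · ring
  · rw [Complex.arg_neg_I]
    constructor <;> linarith

/-- Each side is rotated into the right half plane by one of `i, -i, 1, -1`. The primitives
telescope around the rectangle except for the change of branch at the four corners, and each corner
contributes `πi/2`. -/
theorem rectIntegral_inv_sub (z w l : ℂ) (h1 : z.re < l.re) (h2 : l.re < w.re)
    (h3 : z.im < l.im) (h4 : l.im < w.im) :
    ((∫ x : ℝ in z.re..w.re, ((x : ℂ) + z.im * Complex.I - l)⁻¹) -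
      (∫ x : ℝ in z.re..w.re, ((x : ℂ) + w.im * Complex.I - l)⁻¹) +
      Complex.I * (∫ y : ℝ in z.im..w.im, ((w.re : ℂ) + y * Complex.I - l)⁻¹) -
      Complex.I * (∫ y : ℝ in z.im..w.im, ((z.re : ℂ) + y * Complex.I - l)⁻¹)) =
      2 * Real.pi * Complex.I := by
  have e1 := integral_inv_segment Complex.I (z.im * Complex.I - l) 1 (by simp) z.re w.re (by
    intro t _
    left
    simp
    linarith)
  have e2 := integral_inv_segment (-Complex.I) (w.im * Complex.I - l) 1 (by simp) z.re w.re (by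
    intro t _
    left
    simp
    linarith)
  have e3 := integral_inv_segment 1 (w.re - l) Complex.I (by simp) z.im w.im (by
    intro t _
    left
    simp
    linarith)
  have e4 := integral_inv_segment (-1) (z.re - l) Complex.I (by simp) z.im w.im (by
    intro t _
    left
    simp
    linarith)
  have c1 := log_neg_I_mul (c := Complex.I * (w.re + z.im * Complex.I - l))
    (by simp; linarith) (by simp; linarith)
  have c2 := log_neg_I_mul (c := (w.re + w.im * Complex.I - l))
    (by simp; linarith) (by simp; linarith)
  have c3 := log_neg_I_mul (c := -Complex.I * (z.re + w.im * Complex.I - l))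
    (by simp; linarith) (by simp; linarith)
  have c4 := log_neg_I_mul (c := -1 * (z.re + z.im * Complex.I - l))
    (by simp; linarith) (by simp; linarith)
  have r1 : -Complex.I * (Complex.I * (w.re + z.im * Complex.I - l)) =
      1 * (w.re - l + z.im * Complex.I) := by
    linear_combination (-(w.re + z.im * Complex.I - l) : ℂ) * Complex.I_sq
  have r3 : -Complex.I * (-Complex.I * (z.re + w.im * Complex.I - l)) =
      -1 * (z.re - l + w.im * Complex.I) := by
    linear_combination ((z.re + w.im * Complex.I - l) : ℂ) * Complex.I_sq
  have r4 : -Complex.I * (-1 * (z.re + z.im * Complex.I - l)) =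
      Complex.I * (z.im * Complex.I - l + z.re * 1) := by ring
  rw [r1] at c1
  rw [r3] at c3
  rw [r4] at c4
  simp only [mul_one, one_mul] at e1 e2 e3 e4 c1 c2 c3 c4
  have t1 : ∀ x : ℝ, (x : ℂ) + z.im * Complex.I - l = z.im * Complex.I - l + x := fun x => by ring
  have t2 : ∀ x : ℝ, (x : ℂ) + w.im * Complex.I - l = w.im * Complex.I - l + x := fun x => by ring
  have t3 : ∀ x : ℝ, (w.re : ℂ) + x * Complex.I - l = w.re - l + x * Complex.I := fun x => by ring
  have t4 : ∀ x : ℝ, (z.re : ℂ) + x * Complex.I - l = z.re - l + x * Complex.I := fun x => by ring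
  simp only [t1, t2, t3, t4] at e1 e2 e3 e4 c1 c2 c3 c4 ⊢
  rw [show (w.re : ℂ) - l + w.im * Complex.I = w.im * Complex.I - l + w.re by ring] at e3
  rw [show (z.re : ℂ) - l + z.im * Complex.I = z.im * Complex.I - l + z.re by ring] at e4
  rw [e1, e2, e3, e4]
  linear_combination -c1 - c2 - c3 - c4

/-- Cauchy's integral formula on a rectangle. -/
theorem rectIntegral_inv_smul [CompleteSpace F] (z w l : ℂ) (h1 : z.re < l.re) (h2 : l.re < w.re)
    (h3 : z.im < l.im) (h4 : l.im < w.im) (G : ℂ → F)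
    (hG : DifferentiableOn ℂ G (Set.Icc z.re w.re ×ℂ Set.Icc z.im w.im)) :
    rectIntegral (fun t => (t - l)⁻¹ • G t) z w = (2 * Real.pi * Complex.I : ℂ) • G l := by
  have hs : (Set.Icc z.re w.re ×ℂ Set.Icc z.im w.im) ∈ 𝓝 l := by
    rw [Complex.reProdIm]
    exact Filter.inter_mem
      (Complex.continuous_re.continuousAt.preimage_mem_nhds (Icc_mem_nhds h1 h2))
      (Complex.continuous_im.continuousAt.preimage_mem_nhds (Icc_mem_nhds h3 h4))
  -- Splitting `(t - l)⁻¹ G(t) = dslope G l t + (t - l)⁻¹ G(l)` leaves a holomorphic part with zero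
  -- integral and a scalar integral that equals `2πi`.
  have hd := (Complex.differentiableOn_dslope hs).2 hG
  have hre : z.re ≤ w.re := (h1.trans h2).le
  have him : z.im ≤ w.im := (h3.trans h4).le
  have h0 := Complex.integral_boundary_rect_eq_zero_of_differentiableOn (dslope G l) z w
    (by rwa [Set.uIcc_of_le hre, Set.uIcc_of_le him])
  have hc := hd.continuousOn
  have hside : ∀ (f : ℝ → ℂ) (a b : ℝ), Continuous f →
      (∀ t ∈ Set.uIcc a b, f t ∈ Set.Icc z.re w.re ×ℂ Set.Icc z.im w.im) →
      (∀ t, f t ≠ l) →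
      ∫ t : ℝ in a..b, (f t - l)⁻¹ • G (f t) = (∫ t : ℝ in a..b, dslope G l (f t)) +
        (∫ t : ℝ in a..b, (f t - l)⁻¹) • G l := by
    intro f a b hf hfm hfl
    rw [← intervalIntegral.integral_smul_const, ← intervalIntegral.integral_add]
    · refine intervalIntegral.integral_congr fun t _ => ?_
      rw [dslope_of_ne _ (hfl t), slope_def_module, ← smul_add, sub_add_cancel]
    · exact (hc.comp hf.continuousOn hfm).intervalIntegrable
    · apply ContinuousOn.intervalIntegrable
      refine ContinuousOn.smul (ContinuousOn.inv₀ (by fun_prop) fun t _ => ?_) continuousOn_const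
      exact sub_ne_zero.2 (hfl t)
  have hI := rectIntegral_inv_sub z w l h1 h2 h3 h4
  unfold rectIntegral
  rw [hside (fun x : ℝ => (x : ℂ) + z.im * Complex.I) _ _ (by fun_prop)
      (fun t ht => by
        rw [Set.uIcc_of_le hre] at ht
        simp [Complex.mem_reProdIm, ht.1, ht.2, him])
      (fun t h => by have := congrArg Complex.im h; simp at this; linarith),
    hside (fun x : ℝ => (x : ℂ) + w.im * Complex.I) _ _ (by fun_prop)
      (fun t ht => by
        rw [Set.uIcc_of_le hre] at ht
        simp [Complex.mem_reProdIm, ht.1, ht.2, him])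
      (fun t h => by have := congrArg Complex.im h; simp at this; linarith),
    hside (fun x : ℝ => (w.re : ℂ) + x * Complex.I) _ _ (by fun_prop)
      (fun t ht => by
        rw [Set.uIcc_of_le him] at ht
        simp [Complex.mem_reProdIm, ht.1, ht.2, hre])
      (fun t h => by have := congrArg Complex.re h; simp at this; linarith),
    hside (fun x : ℝ => (z.re : ℂ) + x * Complex.I) _ _ (by fun_prop)
      (fun t ht => by
        rw [Set.uIcc_of_le him] at ht
        simp [Complex.mem_reProdIm, ht.1, ht.2, hre])
      (fun t h => by have := congrArg Complex.re h; simp at this; linarith),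
    ← hI]
  have key : ∀ (A B C D : F) (p q r s : ℂ), A - B + Complex.I • C - Complex.I • D = 0 →
      A + p • G l - (B + q • G l) + Complex.I • (C + r • G l) - Complex.I • (D + s • G l) =
        (p - q + Complex.I * r - Complex.I * s) • G l := by
    intro A B C D p q r s h
    have : A = B - Complex.I • C + Complex.I • D := by
      rw [← sub_eq_zero, ← h]; abel
    rw [this]
    module
  exact key _ _ _ _ _ _ _ _ h0

theorem rectIntegral_congr {f g : ℂ → F} {z w : ℂ} (hre : z.re ≤ w.re) (him : z.im ≤ w.im)
    (h : ∀ t ∈ (Set.Icc z.re w.re ×ℂ Set.Icc z.im w.im),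
      (t.re = z.re ∨ t.re = w.re ∨ t.im = z.im ∨ t.im = w.im) → f t = g t) :
    rectIntegral f z w = rectIntegral g z w := by
  unfold rectIntegral
  congr 1
  · congr 1
    · congr 1 <;>
      · refine intervalIntegral.integral_congr fun t ht => ?_
        rw [Set.uIcc_of_le hre] at ht
        exact h _ (by simp [Complex.mem_reProdIm, ht.1, ht.2, him]) (by simp)
    · congr 1
      refine intervalIntegral.integral_congr fun t ht => ?_
      rw [Set.uIcc_of_le him] at ht
      exact h _ (by simp [Complex.mem_reProdIm, ht.1, ht.2, hre]) (by simp)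
  · congr 1
    refine intervalIntegral.integral_congr fun t ht => ?_
    rw [Set.uIcc_of_le him] at ht
    exact h _ (by simp [Complex.mem_reProdIm, ht.1, ht.2, hre]) (by simp)

end Rectangle

/-! ### Diagonal operators on `ℓ²` -/

/-- The Hilbert space `ℓ²(ℕ)`. -/
abbrev SeqSpace : Type := lp (fun _ : ℕ => ℂ) 2

/-- The standard unit vectors. -/
def stdVec (n : ℕ) : SeqSpace := lp.single 2 n 1

theorem stdVec_apply (n m : ℕ) : (stdVec n : SeqSpace) m = if m = n then 1 else 0 := by
  rw [stdVec, lp.single_apply]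
  split_ifs with h <;> simp [h]

@[simp] theorem stdVec_self (n : ℕ) : (stdVec n : SeqSpace) n = 1 := by
  rw [stdVec_apply, if_pos rfl]

theorem inner_stdVec (n : ℕ) (ξ : SeqSpace) : inner ℂ (stdVec n) ξ = ξ n := by
  rw [stdVec, lp.inner_single_left]
  simp

theorem norm_stdVec (n : ℕ) : ‖stdVec n‖ = 1 := by
  rw [stdVec, lp.norm_single (by norm_num), norm_one]

theorem hasSum_norm_sq (ξ : SeqSpace) : HasSum (fun m => ‖ξ m‖ ^ 2) (‖ξ‖ ^ 2) := by
  have := lp.hasSum_norm (p := 2) (by norm_num) ξ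
  simpa using this

/-- A vector whose coordinates are dominated by those of a square summable sequence. -/
theorem norm_le_of_apply_le {ξ : SeqSpace} {q : ℕ → ℝ} {c s : ℝ} (hs : 0 ≤ s) (hc : 0 ≤ c)
    (hq : HasSum (fun m => q m ^ 2) (s ^ 2)) (h : ∀ m, ‖ξ m‖ ≤ c * q m) : ‖ξ‖ ≤ c * s := by
  have h1 : ‖ξ‖ ^ 2 ≤ (c * s) ^ 2 := by
    rw [mul_pow]
    refine hasSum_le (fun m => ?_) (hasSum_norm_sq ξ) (hq.mul_left (c ^ 2))
    rw [← mul_pow]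
    exact pow_le_pow_left₀ (norm_nonneg _) (h m) 2
  exact le_of_sq_le_sq h1 (by positivity)

theorem memℓp_diag {d : ℕ → ℂ} {C : ℝ} (hC : ∀ m, ‖d m‖ ≤ C) (ξ : SeqSpace) :
    Memℓp (fun m => d m * ξ m) 2 := by
  refine ((lp.memℓp ξ).const_mul (C : ℂ)).mono' fun m => ?_
  rw [norm_mul, norm_mul]
  gcongr
  exact (hC m).trans (by simpa using le_abs_self C)

open Classical in
/-- The diagonal operator with bounded entries `d`. -/
def diag (d : ℕ → ℂ) : SeqSpace →L[ℂ] SeqSpace :=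
  if h : ∃ C : ℝ, ∀ m, ‖d m‖ ≤ C then
    LinearMap.mkContinuous
      { toFun := fun ξ => ⟨fun m => d m * ξ m, memℓp_diag (Classical.choose_spec h) ξ⟩
        map_add' := fun ξ η => by ext m; exact mul_add _ _ _
        map_smul' := fun c ξ => by ext m; exact mul_left_comm _ _ _ }
      (Classical.choose h) (fun ξ => by
        have hC := Classical.choose_spec h
        have h0 : 0 ≤ Classical.choose h := (norm_nonneg _).trans (hC 0)
        rw [mul_comm]
        exact (norm_le_of_apply_le (norm_nonneg ξ) h0 (hasSum_norm_sq ξ) fun m => by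
          simp only [LinearMap.coe_mk, AddHom.coe_mk, norm_mul]
          gcongr
          exact hC m).trans_eq (mul_comm _ _))
  else 0

theorem diag_apply {d : ℕ → ℂ} {C : ℝ} (hC : ∀ m, ‖d m‖ ≤ C) (ξ : SeqSpace) (m : ℕ) :
    diag d ξ m = d m * ξ m := by
  rw [diag, dif_pos ⟨C, hC⟩]
  rfl

theorem norm_diag_apply_le {d : ℕ → ℂ} {C : ℝ} (hC : ∀ m, ‖d m‖ ≤ C) (ξ : SeqSpace) :
    ‖diag d ξ‖ ≤ C * ‖ξ‖ := by
  refine norm_le_of_apply_le (norm_nonneg ξ) ((norm_nonneg _).trans (hC 0)) (hasSum_norm_sq ξ)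
    fun m => ?_
  rw [diag_apply hC, norm_mul]
  gcongr
  exact hC m

/-- An operator whose matrix is dominated by `p m * p k` maps `ξ` to a vector with coordinates
at most `p m * ‖p‖ * ‖ξ‖`. -/
theorem norm_apply_le_of_entries {K : SeqSpace →L[ℂ] SeqSpace} {p : ℕ → ℝ} {s : ℝ}
    (hp0 : ∀ m, 0 ≤ p m) (hs : 0 ≤ s) (hp : HasSum (fun m => p m ^ 2) (s ^ 2))
    (hK : ∀ m k, ‖K (stdVec k) m‖ ≤ p m * p k) (ξ : SeqSpace) (m : ℕ) :
    ‖K ξ m‖ ≤ p m * (s * ‖ξ‖) := by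
  have h1 : HasSum (fun k => ξ k * K (stdVec k) m) (K ξ m) := by
    have h2 := lp.hasSum_single (p := 2) (by norm_num) ξ
    have h3 := h2.mapL ((innerSL ℂ (stdVec m)).comp K)
    have h4 : ∀ k, ((innerSL ℂ (stdVec m)).comp K) (lp.single 2 k (ξ k)) =
        ξ k * K (stdVec k) m := fun k => by
      have : lp.single 2 k (ξ k) = ξ k • stdVec k := by
        rw [stdVec, ← lp.single_smul, smul_eq_mul, mul_one]
      rw [this, map_smul, smul_eq_mul, ContinuousLinearMap.comp_apply, innerSL_apply_apply,
        inner_stdVec]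
    have h5 : ((innerSL ℂ (stdVec m)).comp K) ξ = K ξ m := by
      rw [ContinuousLinearMap.comp_apply, innerSL_apply_apply, inner_stdVec]
    rw [← h5]
    simpa only [h4] using h3
  have hsum : Summable fun k => p k * ‖ξ k‖ := by
    refine Summable.of_nonneg_of_le (fun k => by have := hp0 k; positivity) (fun k => ?_)
      (hp.summable.add (hasSum_norm_sq ξ).summable)
    nlinarith [sq_nonneg (p k - ‖ξ k‖), sq_nonneg (p k), sq_nonneg ‖ξ k‖]
  have hle : ∀ k, ‖ξ k * K (stdVec k) m‖ ≤ p m * (p k * ‖ξ k‖) := fun k => by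
    rw [norm_mul]
    nlinarith [mul_le_mul_of_nonneg_left (hK m k) (norm_nonneg (ξ k))]
  have hns := Summable.of_nonneg_of_le (fun k => norm_nonneg _) hle (hsum.mul_left (p m))
  rw [← h1.tsum_eq]
  refine (norm_tsum_le_tsum_norm hns).trans ((hns.tsum_le_tsum hle (hsum.mul_left _)).trans ?_)
  rw [tsum_mul_left]
  -- What remains is the Cauchy–Schwarz inequality for `p` and the moduli of the coordinates of `ξ`.
  refine mul_le_mul_of_nonneg_left ?_ (hp0 m)
  have hcs := Real.inner_le_Lp_mul_Lq_tsum_of_nonneg (p := 2) (q := 2)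
    (f := p) (g := fun k => ‖ξ k‖) (by constructor <;> norm_num) hp0 (fun k => norm_nonneg _)
    (by simpa using hp.summable) (by simpa using (hasSum_norm_sq ξ).summable)
  refine hcs.trans (le_of_eq ?_)
  simp only [Real.rpow_ofNat, hp.tsum_eq, (hasSum_norm_sq ξ).tsum_eq]
  rw [← Real.sqrt_eq_rpow, ← Real.sqrt_eq_rpow, Real.sqrt_sq hs, Real.sqrt_sq (norm_nonneg _)]

variable {H : Type*} [NormedAddCommGroup H] [InnerProductSpace ℂ H] {V : Submodule ℂ H}

/-! ### Graphs of form operators -/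

theorem formOperator_apply_iff (hV : Dense (V : Set H)) (t : V →ₗ[ℂ] V →ₗ⋆[ℂ] ℂ) (x f : H) :
    (∃ hx : x ∈ (formOperator t).domain, formOperator t ⟨x, hx⟩ = f) ↔
      ∃ u : V, (u : H) = x ∧ ∀ v : V, t u v = inner ℂ (v : H) f := by
  have h1 : (x, f) ∈ (formOperator t).graph ↔ (x, f) ∈ formGraph t := by
    rw [formOperator_graph hV]
  rw [LinearPMap.mem_graph_iff] at h1
  refine Iff.trans ⟨?_, ?_⟩ h1
  · rintro ⟨hx, h⟩
    exact ⟨⟨x, hx⟩, rfl, h⟩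
  · rintro ⟨⟨y, hy⟩, rfl, h⟩
    exact ⟨hy, h⟩

theorem form_eigenvector_apply (hV : Dense (V : Set H)) {a : V →ₗ[ℂ] V →ₗ⋆[ℂ] ℂ} {z : ℂ} {x : V}
    (h : IsEigenpair (formOperator a) z (x : H)) (v : V) :
    a x v = z * inner ℂ (v : H) (x : H) := by
  obtain ⟨u, hu, hv⟩ := (formOperator_apply_iff hV a _ _).1 h.2
  rw [← Subtype.ext hu, hv, inner_smul_right, hu]

/-! ### The form domain as a sequence space -/

/-- The form domain, to be equipped with the inner product given by the form. -/
def EnergySpace (V : Submodule ℂ H) : Type _ := V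

instance : AddCommGroup (EnergySpace V) := inferInstanceAs (AddCommGroup V)
instance : Module ℂ (EnergySpace V) := inferInstanceAs (Module ℂ V)

/-- The identity map from the form domain to the energy space. -/
def toEnergy (V : Submodule ℂ H) : V ≃ₗ[ℂ] EnergySpace V := LinearEquiv.refl ℂ V

/-- The inner product of a Hermitian positive definite form. -/
@[reducible] def energyCore (a : V →ₗ[ℂ] V →ₗ⋆[ℂ] ℂ) (ha_herm : ∀ u v, a u v = starRingEnd ℂ (a v u))
    (ha_pos : ∀ u, u ≠ 0 → 0 < (a u u).re) : InnerProductSpace.Core ℂ (EnergySpace V) where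
  -- The arguments are exchanged because `a` is linear in its first argument while `inner` is
  -- conjugate-linear there.
  inner u v := a ((toEnergy V).symm v) ((toEnergy V).symm u)
  conj_inner_symm u v := (ha_herm _ _).symm
  re_inner_nonneg u := by
    by_cases h : (toEnergy V).symm u = 0
    · simp [h]
    · exact (ha_pos _ h).le
  add_left u v w := by simp
  smul_left u v c := by simp
  definite u h := by
    by_contra h0
    have := ha_pos ((toEnergy V).symm u) (by simpa using h0)
    rw [h] at this
    simp at this

/-- The vectors `ψ k / √(μ k)` are orthonormal for `a`, because `a(ψ k, v) = μ k (ψ k, v)`.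
Closedness of `a` gives completeness of `V`, so they form a Hilbert basis whose coordinate map is
the inverse of `U`. -/
theorem exists_coordinates [CompleteSpace H] (hV : Dense (V : Set H))
    (a : V →ₗ[ℂ] V →ₗ⋆[ℂ] ℂ) (ha_herm : ∀ u v, a u v = starRingEnd ℂ (a v u))
    (ha_pos : ∀ u, u ≠ 0 → 0 < (a u u).re) (ha_closed : IsClosedForm a)
    (μ : ℕ → ℝ) (ψ : ℕ → V) (hψ_orth : Orthonormal ℂ (fun k => (ψ k : H)))
    (hψ_total : (Submodule.span ℂ (Set.range fun k => (ψ k : H))).topologicalClosure = ⊤)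
    (hψ_eig : ∀ k, IsEigenpair (formOperator a) (μ k : ℂ) (ψ k : H))
    {c : ℝ} (hc : 0 < c) (hμ : ∀ k, c ≤ μ k) :
    ∃ U : SeqSpace ≃ₗ[ℂ] V, (∀ ξ η, a (U ξ) (U η) = inner ℂ η ξ) ∧
      (∀ ξ η, inner ℂ (U η : H) (U ξ : H) = inner ℂ η (diag (fun k => (μ k : ℂ)⁻¹) ξ)) ∧
      ∀ k, U (stdVec k) = ((√(μ k))⁻¹ : ℂ) • ψ k := by
  have hμ0 : ∀ k, 0 < μ k := fun k => hc.trans_le (hμ k)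
  have hs : ∀ k, (0 : ℝ) < √(μ k) := fun k => Real.sqrt_pos.2 (hμ0 k)
  have hsC : ∀ k, ((√(μ k) : ℝ) : ℂ) ≠ 0 := fun k => by exact_mod_cast (hs k).ne'
  have hss : ∀ k, ((√(μ k) : ℝ) : ℂ) * (√(μ k) : ℝ) = μ k := fun k => by
    exact_mod_cast Real.mul_self_sqrt (hμ0 k).le
  have heig : ∀ k v, a (ψ k) v = μ k * inner ℂ (v : H) (ψ k : H) := fun k v =>
    form_eigenvector_apply hV (hψ_eig k) v
  let bH : HilbertBasis ℕ ℂ H := HilbertBasis.mk hψ_orth hψ_total.ge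
  have hbH : ∀ k, bH k = ψ k := fun k => by simp [bH]
  let core := energyCore a ha_herm ha_pos
  let : NormedAddCommGroup (EnergySpace V) := core.toNormedAddCommGroup
  let : InnerProductSpace ℂ (EnergySpace V) := InnerProductSpace.ofCore core.toCore
  let e : ℕ → EnergySpace V := fun k => toEnergy V (((√(μ k))⁻¹ : ℂ) • ψ k)
  have hinner : ∀ u v : V, inner ℂ (toEnergy V u) (toEnergy V v) = a v u := fun u v => rfl
  have he : ∀ k (u : V), inner ℂ (e k) (toEnergy V u) =
      (√(μ k) : ℝ) * inner ℂ (ψ k : H) (u : H) := fun k u => by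
    rw [hinner, map_smulₛₗ, smul_eq_mul, ha_herm, heig]
    simp only [map_inv₀, Complex.conj_ofReal, map_mul, inner_conj_symm]
    rw [← hss k]
    field_simp [hsC k]
  have horth : Orthonormal ℂ e := by
    rw [orthonormal_iff_ite]
    intro i j
    rw [he, Submodule.coe_smul, inner_smul_right, orthonormal_iff_ite.1 hψ_orth]
    split_ifs with h
    · subst h; field_simp [hsC i]
    · simp
  have hnorm : ∀ u : V, ‖toEnergy V u‖ = energyNorm a u := fun u => by
    rw [energyNorm, norm_eq_sqrt_re_inner (𝕜 := ℂ), hinner]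
    rfl
  -- Parseval in `H` combined with Bessel in the energy space: the energy norm dominates the norm of
  -- `H`, so energy-Cauchy sequences converge in `H` and closedness applies.
  have hbound : ∀ u : V, c * ‖(u : H)‖ ^ 2 ≤ ‖toEnergy V u‖ ^ 2 := fun u => by
    have h1 : HasSum (fun k => ‖inner ℂ (ψ k : H) (u : H)‖ ^ 2) (‖(u : H)‖ ^ 2) := by
      have := hasSum_norm_sq (bH.repr u)
      simpa only [bH.repr_apply_apply, hbH, LinearIsometryEquiv.norm_map] using this
    refine hasSum_le_of_sum_le (h1.mul_left c) fun s => ?_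
    refine le_trans (Finset.sum_le_sum fun k _ => ?_) (horth.sum_inner_products_le (s := s) (toEnergy V u))
    rw [he, norm_mul, mul_pow, Complex.norm_real, Real.norm_eq_abs, sq_abs,
      Real.sq_sqrt (hμ0 k).le]
    gcongr
    exact hμ k
  have : CompleteSpace (EnergySpace V) := by
    refine Metric.complete_of_cauchySeq_tendsto fun u hu => ?_
    let u' : ℕ → V := fun n => (toEnergy V).symm (u n)
    have hu' : ∀ n, toEnergy V (u' n) = u n := fun n => rfl
    have hsub : ∀ m n, ‖u m - u n‖ = energyNorm a (u' m - u' n) := fun m n => by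
      rw [← hnorm, map_sub, hu', hu']
    have hcH : CauchySeq fun n => (u' n : H) := by
      rw [Metric.cauchySeq_iff] at hu ⊢
      intro ε hε
      obtain ⟨N, hN⟩ := hu (√c * ε) (by positivity)
      refine ⟨N, fun m hm n hn => ?_⟩
      have h1 := hN m hm n hn
      have h2 := hbound (u' m - u' n)
      rw [dist_eq_norm] at h1 ⊢
      rw [map_sub, hu', hu', Submodule.coe_sub] at h2
      have h3 : c * ‖(u' m : H) - u' n‖ ^ 2 < c * ε ^ 2 := by
        calc _ ≤ _ := h2
          _ < (√c * ε) ^ 2 := by gcongr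
          _ = c * ε ^ 2 := by rw [mul_pow, Real.sq_sqrt hc.le]
      exact lt_of_pow_lt_pow_left₀ 2 hε.le (lt_of_mul_lt_mul_left h3 hc.le)
    obtain ⟨x, hx⟩ := cauchySeq_tendsto_of_complete hcH
    obtain ⟨hxV, hlim⟩ := ha_closed u' x hx fun ε hε => by
      obtain ⟨N, hN⟩ := Metric.cauchySeq_iff.1 hu ε hε
      refine ⟨N, fun m hm n hn => ?_⟩
      rw [← hsub, ← dist_eq_norm]
      exact hN m hm n hn
    refine ⟨toEnergy V ⟨x, hxV⟩, tendsto_iff_norm_sub_tendsto_zero.2 ?_⟩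
    refine hlim.congr fun n => ?_
    rw [← hnorm, map_sub, hu']
  -- Energy-orthogonality to `e k` is orthogonality to `ψ k` in `H`, so totality of the `ψ k` in `H`
  -- carries over.
  have hbot : (Submodule.span ℂ (Set.range e))ᗮ = ⊥ := by
    rw [Submodule.eq_bot_iff]
    intro u hu
    have h1 : ∀ k, inner ℂ (ψ k : H) ((toEnergy V).symm u : H) = 0 := fun k => by
      have h2 := (Submodule.mem_orthogonal _ _).1 hu (e k)
        (Submodule.subset_span ⟨k, rfl⟩)
      rw [← (toEnergy V).apply_symm_apply u, he] at h2
      exact (mul_eq_zero.1 h2).resolve_left (hsC k)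
    have h3 : bH.repr ((toEnergy V).symm u : H) = 0 := by
      ext k
      rw [bH.repr_apply_apply, hbH, h1]
      rfl
    have h4 : ((toEnergy V).symm u : H) = 0 := by simpa using h3
    simpa using h4
  let bE : HilbertBasis ℕ ℂ (EnergySpace V) := HilbertBasis.mkOfOrthogonalEqBot horth hbot
  have hbE : ∀ k, bE k = e k := fun k => by simp [bE]
  let U : SeqSpace ≃ₗ[ℂ] V := bE.repr.symm.toLinearEquiv.trans (toEnergy V).symm
  have hU : ∀ ξ, toEnergy V (U ξ) = bE.repr.symm ξ := fun ξ => rfl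
  have hUc : ∀ ξ k, inner ℂ (ψ k : H) (U ξ : H) = ((√(μ k) : ℝ) : ℂ)⁻¹ * ξ k := fun ξ k => by
    have h1 := he k (U ξ)
    rw [hU, ← hbE, ← bE.repr_apply_apply, LinearIsometryEquiv.apply_symm_apply] at h1
    rw [h1]
    field_simp [hsC k]
  refine ⟨U, fun ξ η => ?_, fun ξ η => ?_, fun k => ?_⟩
  · rw [← hinner, hU, hU, LinearIsometryEquiv.inner_map_map]
  · have h1 := (bH.hasSum_inner_mul_inner (U η : H) (U ξ : H)).tsum_eq
    rw [← h1, lp.inner_eq_tsum]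
    refine tsum_congr fun k => ?_
    have hd : ∀ k, ‖(μ k : ℂ)⁻¹‖ ≤ c⁻¹ := fun k => by
      rw [norm_inv, Complex.norm_real, Real.norm_of_nonneg (hμ0 k).le]
      exact inv_anti₀ hc (hμ k)
    rw [diag_apply hd, hbH, hUc, ← inner_conj_symm, hUc, RCLike.inner_apply, ← hss k]
    simp only [map_mul, map_inv₀, Complex.conj_ofReal]
    field_simp [hsC k]
  · apply (toEnergy V).injective
    rw [hU, stdVec, bE.repr_symm_single, hbE]

/-- A form that is bounded in the energy norm is given by a bounded operator. -/
theorem exists_form_operator (a b : V →ₗ[ℂ] V →ₗ⋆[ℂ] ℂ) (U : SeqSpace ≃ₗ[ℂ] V)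
    (hU : ∀ ξ η, a (U ξ) (U η) = inner ℂ η ξ)
    (hb : ∃ C : ℝ, ∀ u v, ‖b u v‖ ≤ C * energyNorm a u * energyNorm a v) :
    ∃ B : SeqSpace →L[ℂ] SeqSpace, ∀ ξ η, b (U ξ) (U η) = inner ℂ η (B ξ) := by
  obtain ⟨C, hC⟩ := hb
  have hn : ∀ ξ, energyNorm a (U ξ) = ‖ξ‖ := fun ξ => by
    rw [energyNorm, hU, norm_eq_sqrt_re_inner (𝕜 := ℂ)]
    rfl
  let b' : SeqSpace →ₗ⋆[ℂ] SeqSpace →ₗ[ℂ] ℂ :=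
    LinearMap.mk₂'ₛₗ (starRingEnd ℂ) (RingHom.id ℂ) (fun η ξ => b (U ξ) (U η))
      (fun _ _ _ => by simp) (fun _ _ _ => by simp) (fun _ _ _ => by simp) (fun _ _ _ => by simp)
  let b'' : SeqSpace →L⋆[ℂ] SeqSpace →L[ℂ] ℂ := b'.mkContinuous₂ C fun η ξ => by
    have := hC (U ξ) (U η)
    rw [hn, hn] at this
    calc _ ≤ _ := this
      _ = _ := by ring
  -- The operator obtained from the bilinear form stands in the first slot of the inner product; its
  -- adjoint moves it to the second.
  refine ⟨ContinuousLinearMap.adjoint (InnerProductSpace.continuousLinearMapOfBilin b''),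
    fun ξ η => ?_⟩
  rw [ContinuousLinearMap.adjoint_inner_right,
    InnerProductSpace.continuousLinearMapOfBilin_apply]
  rfl

/-! ### Resolvents of form operators from bounded operators -/

section Representation

variable {H : Type*} [NormedAddCommGroup H] [InnerProductSpace ℂ H] {V : Submodule ℂ H}
  {E : Type*} [NormedAddCommGroup E] [InnerProductSpace ℂ E]

/-- The form `z (u, v) - t(u, v)` is represented by the bounded operator `L` in the
parametrization `J` of the form domain. -/
structure Represents (t : V →ₗ[ℂ] V →ₗ⋆[ℂ] ℂ) (z : ℂ) (J : E →L[ℂ] H) (L : E →L[ℂ] E) :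
    Prop where
  mem : ∀ ξ, J ξ ∈ V
  surj : ∀ v : V, ∃ ξ, J ξ = v
  form_eq : ∀ ξ η, z * inner ℂ (J η) (J ξ) - t ⟨J ξ, mem ξ⟩ ⟨J η, mem η⟩ = inner ℂ η (L ξ)

theorem IsResolventAt.unique {z : ℂ} {T : H →ₗ.[ℂ] H} {R R' : H →L[ℂ] H} (h : IsResolventAt T z R)
    (h' : IsResolventAt T z R') : R = R' := by
  ext f
  obtain ⟨hf, hT⟩ := h'.1 f
  have := h.2 ⟨R' f, hf⟩
  rw [hT] at this
  exact this

theorem IsEigenpair.not_mem_resolventSet {z : ℂ} {T : H →ₗ.[ℂ] H} {x : H} (h : IsEigenpair T z x) :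
    z ∉ resolventSet T := by
  rintro ⟨R, -, hR⟩
  obtain ⟨h0, hx, hT⟩ := h
  have := hR ⟨x, hx⟩
  rw [hT, sub_self, map_zero] at this
  exact h0 this.symm

variable [CompleteSpace H] [CompleteSpace E] {t : V →ₗ[ℂ] V →ₗ⋆[ℂ] ℂ} {z : ℂ} {J : E →L[ℂ] H}
  {L : E →L[ℂ] E}

/-- Since `J` maps onto `V`, testing the form identity against all `v ∈ V` is testing against all `J
η`, and the adjoint of `J` carries the right-hand side to the coordinate space. -/
theorem Represents.apply_iff (h : Represents t z J L) (hV : Dense (V : Set H)) (x f : H) :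
    (∃ hx : x ∈ (formOperator t).domain, formOperator t ⟨x, hx⟩ = f) ↔
      ∃ ξ, J ξ = x ∧ L ξ = J.adjoint (z • x - f) := by
  rw [formOperator_apply_iff hV]
  constructor
  · rintro ⟨u, rfl, hu⟩
    obtain ⟨ξ, hξ⟩ := h.surj u
    refine ⟨ξ, hξ, ext_inner_left ℂ fun η => ?_⟩
    have hu' : u = ⟨J ξ, h.mem ξ⟩ := Subtype.ext hξ.symm
    rw [← h.form_eq, ContinuousLinearMap.adjoint_inner_right, inner_sub_right, inner_smul_right,
      ← hu', hu ⟨J η, h.mem η⟩, hξ]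
  · rintro ⟨ξ, rfl, hL⟩
    refine ⟨⟨J ξ, h.mem ξ⟩, rfl, fun v => ?_⟩
    obtain ⟨η, hη⟩ := h.surj v
    have hv : v = ⟨J η, h.mem η⟩ := Subtype.ext hη.symm
    have h1 := h.form_eq ξ η
    rw [hL, ContinuousLinearMap.adjoint_inner_right, inner_sub_right, inner_smul_right] at h1
    rw [hv]
    linear_combination -h1

/-- By `Represents.apply_iff`, solving `(z - T) u = f` with `u = J ξ` means solving `L ξ = J* f`;
hence the resolvent is `J L⁻¹ J*`. -/
theorem Represents.isResolventAt (h : Represents t z J L) (hV : Dense (V : Set H))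
    (hL : IsUnit L) :
    IsResolventAt (formOperator t) z (J ∘L Ring.inverse L ∘L J.adjoint) := by
  have h1 : ∀ x, L (Ring.inverse L x) = x := fun x => by
    rw [← mul_apply_eq_comp, Ring.mul_inverse_cancel _ hL,
      one_apply_eq_self]
  have h2 : ∀ x, Ring.inverse L (L x) = x := fun x => by
    rw [← mul_apply_eq_comp, Ring.inverse_mul_cancel _ hL,
      one_apply_eq_self]
  refine ⟨fun f => ?_, fun u => ?_⟩
  · obtain ⟨hx, hT⟩ := (h.apply_iff hV ((J ∘L Ring.inverse L ∘L J.adjoint) f)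
      (z • (J ∘L Ring.inverse L ∘L J.adjoint) f - f)).2
      ⟨Ring.inverse L (J.adjoint f), rfl, by rw [h1, sub_sub_cancel]⟩
    exact ⟨hx, by rw [hT, sub_sub_cancel]⟩
  · obtain ⟨ξ, hξ, hLξ⟩ := (h.apply_iff hV (u : H) (formOperator t u)).1 ⟨u.2, rfl⟩
    simp only [ContinuousLinearMap.comp_apply]
    rw [← hLξ, h2, hξ]

theorem Represents.mem_resolventSet (h : Represents t z J L) (hV : Dense (V : Set H))
    (hL : IsUnit L) : z ∈ resolventSet (formOperator t) :=
  ⟨_, h.isResolventAt hV hL⟩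

theorem Represents.resolvent_eq (h : Represents t z J L) (hV : Dense (V : Set H))
    (hL : IsUnit L) : resolvent (formOperator t) z = J ∘L Ring.inverse L ∘L J.adjoint := by
  have hz := h.mem_resolventSet hV hL
  rw [resolvent, dif_pos hz]
  exact (Classical.choose_spec hz).unique (h.isResolventAt hV hL)

theorem Represents.isEigenpair (h : Represents t z J L) (hV : Dense (V : Set H)) {x : E}
    (hx : J x ≠ 0) (hL : L x = 0) : IsEigenpair (formOperator t) z (J x) :=
  ⟨hx, (h.apply_iff hV _ _).2 ⟨x, rfl, by rw [hL, sub_self, map_zero]⟩⟩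

/-- Induction on the order of a root vector. If `(T - z) y` lies on the eigenline, the coordinates
of `y` solve `L ξ = c J* J x`, and `hker` returns `y` to that line, so no Jordan chain can start. -/
theorem Represents.isSimpleEigenvalue (h : Represents t z J L) (hV : Dense (V : Set H)) {x : E}
    (hx : J x ≠ 0) (hL : L x = 0)
    (hker : ∀ ξ, ∀ c : ℂ, L ξ = c • J.adjoint (J x) → ξ ∈ Submodule.span ℂ {x}) :
    IsSimpleEigenvalue (formOperator t) z := by
  refine ⟨J x, h.isEigenpair hV hx hL, fun k => ?_⟩
  induction k with
  | zero =>
    rintro y rfl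
    exact Submodule.zero_mem _
  | succ k ih =>
    rintro y ⟨hy, hyk⟩
    obtain ⟨c, hc⟩ := Submodule.mem_span_singleton.1 (ih _ hyk)
    obtain ⟨ξ, hξ, hLξ⟩ := (h.apply_iff hV y _).1 ⟨hy, rfl⟩
    have h1 : L ξ = (-c) • J.adjoint (J x) := by
      rw [hLξ, ← map_smul, neg_smul, hc, neg_sub]
    obtain ⟨d, hd⟩ := Submodule.mem_span_singleton.1 (hker ξ _ h1)
    rw [← hξ, ← hd, map_smul]
    exact Submodule.smul_mem _ _ (Submodule.mem_span_singleton_self _)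

end Representation

/-! ### Perturbation of one simple diagonal entry -/

theorem diag_mul_diag {d d' : ℕ → ℂ} {C C' : ℝ} (hd : ∀ m, ‖d m‖ ≤ C) (hd' : ∀ m, ‖d' m‖ ≤ C')
    (h : ∀ m, d m * d' m = 1) : diag d * diag d' = 1 := by
  ext ξ m
  rw [mul_apply_eq_comp, diag_apply hd, diag_apply hd', ← mul_assoc, h, one_mul,
    one_apply_eq_self]

/-- The operator with entries `(z - μ m) / w m` on the diagonal, minus `K`. -/
def fullOp (μ w : ℕ → ℝ) (K : SeqSpace →L[ℂ] SeqSpace) (z : ℂ) : SeqSpace →L[ℂ] SeqSpace :=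
  z • diag (fun m => (w m : ℂ)⁻¹) - diag (fun m => (μ m : ℂ) / w m) - K

/-- The operator `fullOp` with the `n`-th entry of the diagonal part replaced by `1`. -/
def reducedOp (n : ℕ) (μ w : ℕ → ℝ) (K : SeqSpace →L[ℂ] SeqSpace) (z : ℂ) :
    SeqSpace →L[ℂ] SeqSpace :=
  z • diag (fun m => if m = n then 0 else (w m : ℂ)⁻¹) -
    diag (fun m => if m = n then -1 else (μ m : ℂ) / w m) - K

/-- The solution `x` of `N x = e_n`, where `N` is the reduced operator. -/
def reducedVec (n : ℕ) (μ w : ℕ → ℝ) (K : SeqSpace →L[ℂ] SeqSpace) (z : ℂ) : SeqSpace :=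
  Ring.inverse (reducedOp n μ w K z) (stdVec n)

/-- The function whose fixed points are the perturbed eigenvalues. -/
def fixFun (n : ℕ) (μ w : ℕ → ℝ) (K : SeqSpace →L[ℂ] SeqSpace) (z : ℂ) : ℂ :=
  μ n + w n * (1 - (reducedVec n μ w K z n)⁻¹)

/-- The smallness assumptions for the perturbation `K` of the diagonal operator. -/
structure IsSmall (n : ℕ) (μ w : ℕ → ℝ) (K : SeqSpace →L[ℂ] SeqSpace) (p : ℕ → ℝ) (τ C : ℝ)
    (Z : Set ℂ) : Prop where
  w_pos : ∀ m, 0 < w m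
  w_le : ∀ m, w n ≤ C * w m
  mu_le : ∃ c, ∀ m, |μ m| ≤ c * w m
  p_nonneg : ∀ m, 0 ≤ p m
  tau_nonneg : 0 ≤ τ
  hasSum : HasSum (fun m => p m ^ 2) (τ ^ 2)
  entries : ∀ m k, ‖K (stdVec k) m‖ ≤ p m * p k
  small : 128 * C * τ ^ 2 ≤ 1
  dist : ∀ z ∈ Z, ∀ m ≠ n, w m ≤ 2 * ‖z - μ m‖

/-! ### Lyapunov–Schmidt reduction near one diagonal entry. -/

namespace IsSmall

variable {n : ℕ} {μ w : ℕ → ℝ} {K : SeqSpace →L[ℂ] SeqSpace} {p : ℕ → ℝ} {τ C : ℝ} {Z : Set ℂ}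
  (h : IsSmall n μ w K p τ C Z) {z z' : ℂ}
include h

theorem one_le_C : 1 ≤ C := by
  have := h.w_le n
  have := h.w_pos n
  by_contra! hC
  nlinarith

theorem tau_sq_le : τ ^ 2 ≤ 1 / 128 := by
  nlinarith [h.small, h.one_le_C, sq_nonneg τ]

theorem norm_inv_w_le (m : ℕ) : ‖(w m : ℂ)⁻¹‖ ≤ C / w n := by
  rw [norm_inv, Complex.norm_real, Real.norm_of_nonneg (h.w_pos m).le, inv_eq_one_div,
    div_le_div_iff₀ (h.w_pos m) (h.w_pos n), one_mul]
  exact h.w_le m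

theorem norm_mu_div_w_le : ∃ c, ∀ m, ‖(μ m : ℂ) / w m‖ ≤ c := by
  obtain ⟨c, hc⟩ := h.mu_le
  refine ⟨c, fun m => ?_⟩
  rw [norm_div, Complex.norm_real, Complex.norm_real, Real.norm_of_nonneg (h.w_pos m).le,
    div_le_iff₀ (h.w_pos m)]
  exact hc m

theorem C_div_nonneg : 0 ≤ C / w n := div_nonneg (zero_le_one.trans h.one_le_C) (h.w_pos n).le

theorem norm_reduced_inv_w_le (m : ℕ) : ‖(if m = n then 0 else (w m : ℂ)⁻¹)‖ ≤ C / w n := by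
  split_ifs
  · simpa using h.C_div_nonneg
  · exact h.norm_inv_w_le m

theorem fullOp_apply (z : ℂ) (ξ : SeqSpace) (m : ℕ) :
    fullOp μ w K z ξ m = (z - μ m) / w m * ξ m - K ξ m := by
  obtain ⟨c, hc⟩ := h.norm_mu_div_w_le
  change z * diag _ ξ m - diag _ ξ m - K ξ m = _
  rw [diag_apply h.norm_inv_w_le, diag_apply hc]
  ring

theorem reducedOp_apply (z : ℂ) (ξ : SeqSpace) (m : ℕ) :
    reducedOp n μ w K z ξ m = (if m = n then 1 else (z - μ m) / w m) * ξ m - K ξ m := by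
  obtain ⟨c, hc⟩ := h.norm_mu_div_w_le
  have hc' : ∀ m, ‖(if m = n then -1 else (μ m : ℂ) / w m)‖ ≤ max 1 c := fun m => by
    split_ifs
    · simp
    · exact (hc m).trans (le_max_right _ _)
  change z * diag _ ξ m - diag _ ξ m - K ξ m = _
  rw [diag_apply h.norm_reduced_inv_w_le, diag_apply hc']
  split_ifs <;> ring

theorem fullOp_eq (z : ℂ) (ξ : SeqSpace) :
    fullOp μ w K z ξ = reducedOp n μ w K z ξ + (((z - μ n) / w n - 1) * ξ n) • stdVec n := by
  ext m
  change _ = reducedOp n μ w K z ξ m + (((z - μ n) / w n - 1) * ξ n) * stdVec n m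
  rw [h.fullOp_apply, h.reducedOp_apply, stdVec_apply]
  split_ifs with hm
  · subst hm; ring
  · ring

theorem half_le (hz : z ∈ Z) (m : ℕ) :
    1 / 2 ≤ ‖(if m = n then (1 : ℂ) else (z - μ m) / w m)‖ := by
  split_ifs with hm
  · norm_num
  · have := h.dist z hz m hm
    rw [norm_div, Complex.norm_real, Real.norm_of_nonneg (h.w_pos m).le,
      div_le_div_iff₀ two_pos (h.w_pos m)]
    linarith

theorem norm_K_apply_le (ξ : SeqSpace) (m : ℕ) : ‖K ξ m‖ ≤ p m * (τ * ‖ξ‖) :=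
  norm_apply_le_of_entries h.p_nonneg h.tau_nonneg h.hasSum h.entries ξ m

theorem norm_K_le (ξ : SeqSpace) : ‖K ξ‖ ≤ τ ^ 2 * ‖ξ‖ := by
  refine (norm_le_of_apply_le h.tau_nonneg (by have := h.tau_nonneg; positivity) h.hasSum
    fun m => (h.norm_K_apply_le ξ m).trans_eq (mul_comm _ _)).trans_eq ?_
  ring

/-- `N + K` is diagonal with entries of modulus at least `1/2`, and `‖K‖ ≤ τ² ≤ 1/128` is absorbed
into the left-hand side. -/
theorem le_four_mul (hz : z ∈ Z) (ξ : SeqSpace) : ‖ξ‖ ≤ 4 * ‖reducedOp n μ w K z ξ‖ := by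
  have h1 : ‖ξ‖ ≤ 2 * ‖reducedOp n μ w K z ξ + K ξ‖ := by
    have := norm_le_of_apply_le (ξ := ξ) (norm_nonneg (reducedOp n μ w K z ξ + K ξ))
      zero_le_two (hasSum_norm_sq _) fun m => ?_
    · exact this
    · change ‖ξ m‖ ≤ 2 * ‖reducedOp n μ w K z ξ m + K ξ m‖
      rw [h.reducedOp_apply, sub_add_cancel, norm_mul]
      nlinarith [h.half_le hz m, norm_nonneg (ξ m)]
  have h2 := norm_add_le (reducedOp n μ w K z ξ) (K ξ)
  have h3 := h.norm_K_le ξ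
  nlinarith [h.tau_sq_le, norm_nonneg ξ]

theorem isUnit_reducedOp (hz : z ∈ Z) : IsUnit (reducedOp n μ w K z) := by
  set d : ℕ → ℂ := fun m => if m = n then 1 else (z - μ m) / w m with hd
  obtain ⟨c, hc⟩ := h.norm_mu_div_w_le
  have hdb : ∀ m, ‖d m‖ ≤ max 1 (‖z‖ * (C / w n) + c) := fun m => by
    simp only [hd]
    split_ifs
    · simp
    · refine le_trans ?_ (le_max_right _ _)
      rw [sub_div]
      refine (norm_sub_le _ _).trans (add_le_add ?_ (hc m))
      rw [div_eq_mul_inv, norm_mul]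
      exact mul_le_mul_of_nonneg_left (h.norm_inv_w_le m) (norm_nonneg _)
  have hd0 : ∀ m, d m ≠ 0 := fun m h0 => by
    have := h.half_le hz m
    change 1 / 2 ≤ ‖d m‖ at this
    rw [h0, norm_zero] at this
    norm_num at this
  have hdi : ∀ m, ‖(d m)⁻¹‖ ≤ 2 := fun m => by
    rw [norm_inv, inv_le_comm₀ (norm_pos_iff.2 (hd0 m)) two_pos]
    simpa using h.half_le hz m
  have e1 : diag d * diag (fun m => (d m)⁻¹) = 1 :=
    diag_mul_diag hdb hdi fun m => mul_inv_cancel₀ (hd0 m)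
  have e2 : diag (fun m => (d m)⁻¹) * diag d = 1 :=
    diag_mul_diag hdi hdb fun m => inv_mul_cancel₀ (hd0 m)
  -- Neumann series: `N = D (1 - D⁻¹ K)` with `‖D⁻¹ K‖ ≤ 2 τ² < 1/2`.
  have hN : reducedOp n μ w K z = diag d * (1 - diag (fun m => (d m)⁻¹) * K) := by
    rw [mul_sub, ← mul_assoc, e1, mul_one, one_mul]
    ext ξ m
    rw [h.reducedOp_apply]
    change _ = diag d ξ m - K ξ m
    rw [diag_apply hdb]
  rw [hN]
  refine IsUnit.mul ⟨⟨_, _, e1, e2⟩, rfl⟩ (isUnit_one_sub_of_norm_lt_one ?_)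
  refine lt_of_le_of_lt (ContinuousLinearMap.opNorm_le_bound (M := 1 / 2) _ (by norm_num)
    fun ξ => ?_) one_half_lt_one
  rw [mul_apply_eq_comp]
  refine (norm_diag_apply_le hdi _).trans ?_
  nlinarith [h.norm_K_le ξ, h.tau_sq_le, norm_nonneg ξ]

theorem reducedOp_inverse (hz : z ∈ Z) (ξ : SeqSpace) :
    reducedOp n μ w K z (Ring.inverse (reducedOp n μ w K z) ξ) = ξ := by
  rw [← mul_apply_eq_comp, Ring.mul_inverse_cancel _ (h.isUnit_reducedOp hz),
    one_apply_eq_self]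

theorem inverse_reducedOp (hz : z ∈ Z) (ξ : SeqSpace) :
    Ring.inverse (reducedOp n μ w K z) (reducedOp n μ w K z ξ) = ξ := by
  rw [← mul_apply_eq_comp, Ring.inverse_mul_cancel _ (h.isUnit_reducedOp hz),
    one_apply_eq_self]

theorem reducedOp_reducedVec (hz : z ∈ Z) :
    reducedOp n μ w K z (reducedVec n μ w K z) = stdVec n := h.reducedOp_inverse hz _

theorem p_le_tau (m : ℕ) : p m ≤ τ :=
  le_of_sq_le_sq (le_hasSum h.hasSum m fun _ _ => sq_nonneg _) h.tau_nonneg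

theorem norm_reducedVec_sub_le (hz : z ∈ Z) :
    ‖reducedVec n μ w K z - stdVec n‖ ≤ 4 * (p n * τ) := by
  refine (h.le_four_mul hz _).trans (mul_le_mul_of_nonneg_left ?_ (by norm_num))
  -- The `n`-th diagonal entry of `N` is `1`, hence `N e_n = e_n - K e_n` and the error of `e_n` is
  -- just `K e_n`.
  have h1 : reducedOp n μ w K z (reducedVec n μ w K z - stdVec n) = K (stdVec n) := by
    rw [map_sub, h.reducedOp_reducedVec hz]
    ext m
    change stdVec n m - reducedOp n μ w K z (stdVec n) m = _
    rw [h.reducedOp_apply, stdVec_apply]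
    split_ifs <;> ring
  rw [h1]
  exact norm_le_of_apply_le h.tau_nonneg (h.p_nonneg n) h.hasSum fun m =>
    (h.entries m n).trans_eq (mul_comm _ _)

/-- Reading `D r = K e_n + K r` in coordinate `m` upgrades the norm bound on `r = x - e_n` to a
pointwise one. The pointwise form is needed because the energy norm later weights the coordinates
unequally. -/
theorem norm_reducedVec_sub_apply_le (hz : z ∈ Z) (m : ℕ) :
    ‖(reducedVec n μ w K z - stdVec n) m‖ ≤ 3 * (p m * p n) := by
  set r := reducedVec n μ w K z - stdVec n with hr
  have hx : reducedVec n μ w K z = stdVec n + r := by rw [hr]; abel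
  have h1 : (if m = n then 1 else (z - μ m) / w m) * r m = K (stdVec n) m + K r m := by
    have h2 := congrArg (fun ξ : SeqSpace => ξ m) (h.reducedOp_reducedVec hz)
    simp only at h2
    rw [h.reducedOp_apply, hx, map_add] at h2
    change _ * (stdVec n m + r m) - (K (stdVec n) m + K r m) = _ at h2
    rw [stdVec_apply] at h2
    rw [← sub_eq_zero, ← sub_eq_zero.2 h2]
    split_ifs <;> ring
  have h3 := norm_add_le (K (stdVec n) m) (K r m)
  rw [← h1, norm_mul] at h3
  have h4 := h.norm_K_apply_le r m
  have h5 := mul_le_mul_of_nonneg_left (mul_le_mul_of_nonneg_left (h.norm_reducedVec_sub_le hz)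
    h.tau_nonneg) (h.p_nonneg m)
  have h6 := h.entries m n
  have h7 := h.half_le hz m
  have h8 : p m * (τ * (4 * (p n * τ))) ≤ 1 / 2 * (p m * p n) := by
    nlinarith [h.tau_sq_le, mul_nonneg (h.p_nonneg m) (h.p_nonneg n)]
  nlinarith [norm_nonneg (r m)]

theorem norm_reducedVec_self_sub_le (hz : z ∈ Z) :
    ‖reducedVec n μ w K z n - 1‖ ≤ 3 * p n ^ 2 := by
  have := h.norm_reducedVec_sub_apply_le hz n
  change ‖reducedVec n μ w K z n - stdVec n n‖ ≤ _ at this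
  rw [stdVec_self] at this
  rwa [sq]

theorem p_sq_le (m : ℕ) : p m ^ 2 ≤ 1 / 128 :=
  (pow_le_pow_left₀ (h.p_nonneg m) (h.p_le_tau m) 2).trans h.tau_sq_le

theorem half_le_norm_reducedVec (hz : z ∈ Z) : 1 / 2 ≤ ‖reducedVec n μ w K z n‖ := by
  have h1 := h.norm_reducedVec_self_sub_le hz
  have h2 := norm_sub_norm_le (1 : ℂ) (1 - reducedVec n μ w K z n)
  rw [sub_sub_cancel, norm_one, norm_sub_rev] at h2
  linarith [h.p_sq_le n]

theorem reducedVec_ne_zero (hz : z ∈ Z) : reducedVec n μ w K z n ≠ 0 := fun h0 => by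
  have := h.half_le_norm_reducedVec hz
  rw [h0, norm_zero] at this
  norm_num at this

/-- The `n`-th coordinate of `N⁻¹ W (x - e_n)`, with `W` the derivative of the reduced
operator. -/
theorem norm_inverse_apply_le (hz : z ∈ Z) (hz' : z' ∈ Z) :
    ‖Ring.inverse (reducedOp n μ w K z) (diag (fun m => if m = n then 0 else (w m : ℂ)⁻¹)
      (reducedVec n μ w K z')) n‖ ≤ 16 * (p n ^ 2 * τ ^ 2 * (C / w n)) := by
  set W := diag (fun m => if m = n then 0 else (w m : ℂ)⁻¹) with hW
  set y := Ring.inverse (reducedOp n μ w K z) (W (reducedVec n μ w K z')) with hy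
  -- `W` kills `e_n`, which yields a first factor `p n * τ`. The second comes from the `n`-th row of
  -- `N y = W x'`, where `W` vanishes and only `y n = (K y) n` is left.
  have h1 : W (reducedVec n μ w K z') = W (reducedVec n μ w K z' - stdVec n) := by
    ext m
    rw [hW, diag_apply h.norm_reduced_inv_w_le, diag_apply h.norm_reduced_inv_w_le]
    change _ = _ * (reducedVec n μ w K z' m - stdVec n m)
    rw [stdVec_apply]
    split_ifs <;> ring
  have h2 : ‖W (reducedVec n μ w K z')‖ ≤ C / w n * (4 * (p n * τ)) := by
    rw [h1]
    exact (norm_diag_apply_le h.norm_reduced_inv_w_le _).trans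
      (mul_le_mul_of_nonneg_left (h.norm_reducedVec_sub_le hz') h.C_div_nonneg)
  have h3 : reducedOp n μ w K z y = W (reducedVec n μ w K z') := h.reducedOp_inverse hz _
  have h4 := h.le_four_mul hz y
  rw [h3] at h4
  have h5 := congrArg (fun ξ : SeqSpace => ξ n) h3
  simp only at h5
  rw [h.reducedOp_apply, hW, diag_apply h.norm_reduced_inv_w_le] at h5
  simp only [if_true, one_mul, zero_mul] at h5
  rw [sub_eq_zero.1 h5]
  refine (h.norm_K_apply_le y n).trans ?_
  have h6 : τ * ‖y‖ ≤ τ * (4 * (C / w n * (4 * (p n * τ)))) :=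
    mul_le_mul_of_nonneg_left (by linarith) h.tau_nonneg
  calc _ ≤ p n * (τ * (4 * (C / w n * (4 * (p n * τ))))) :=
        mul_le_mul_of_nonneg_left h6 (h.p_nonneg n)
    _ = _ := by ring

/-- A resolvent identity: `N(z) x(z) = N(z') x(z')` and `N` is affine in `z` with slope `W`. -/
theorem reducedVec_sub (hz : z ∈ Z) (hz' : z' ∈ Z) :
    reducedVec n μ w K z - reducedVec n μ w K z' = (z' - z) •
      Ring.inverse (reducedOp n μ w K z) (diag (fun m => if m = n then 0 else (w m : ℂ)⁻¹)
      (reducedVec n μ w K z')) := by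
  rw [← h.inverse_reducedOp hz (reducedVec n μ w K z - reducedVec n μ w K z'), ← map_smul]
  congr 1
  rw [map_sub, h.reducedOp_reducedVec hz, ← h.reducedOp_reducedVec hz']
  simp only [reducedOp, sub_apply, smul_apply, sub_smul]
  abel

/-- The factor `w n` in `fixFun` cancels the `C / w n` coming from `W`, so the Lipschitz constant is
independent of the size of the gap. -/
theorem norm_fixFun_sub_le (hz : z ∈ Z) (hz' : z' ∈ Z) :
    ‖fixFun n μ w K z - fixFun n μ w K z'‖ ≤ 64 * C * τ ^ 2 * p n ^ 2 * ‖z - z'‖ := by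
  set g := reducedVec n μ w K z n with hg
  set g' := reducedVec n μ w K z' n with hg'
  have hg0 : g ≠ 0 := h.reducedVec_ne_zero hz
  have hg0' : g' ≠ 0 := h.reducedVec_ne_zero hz'
  have h1 : ‖g - g'‖ ≤ ‖z - z'‖ * (16 * (p n ^ 2 * τ ^ 2 * (C / w n))) := by
    have := congrArg (fun ξ : SeqSpace => ξ n) (h.reducedVec_sub hz hz')
    change g - g' = (z' - z) * _ at this
    rw [this, norm_mul, norm_sub_rev z' z]
    exact mul_le_mul_of_nonneg_left (h.norm_inverse_apply_le hz hz') (norm_nonneg _)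
  have h2 : fixFun n μ w K z - fixFun n μ w K z' = w n * ((g - g') * (g⁻¹ * g'⁻¹)) := by
    rw [fixFun, fixFun, ← hg, ← hg']
    field_simp
    ring
  have h3 : ‖g⁻¹ * g'⁻¹‖ ≤ 4 := by
    rw [norm_mul, norm_inv, norm_inv]
    have a1 : ‖g‖⁻¹ ≤ 2 := by
      rw [inv_le_comm₀ (norm_pos_iff.2 hg0) two_pos]
      simpa using h.half_le_norm_reducedVec hz
    have a2 : ‖g'‖⁻¹ ≤ 2 := by
      rw [inv_le_comm₀ (norm_pos_iff.2 hg0') two_pos]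
      simpa using h.half_le_norm_reducedVec hz'
    calc _ ≤ (2 : ℝ) * 2 := mul_le_mul a1 a2 (by positivity) (by norm_num)
      _ = 4 := by norm_num
  have hw := h.w_pos n
  rw [h2, norm_mul, norm_mul, Complex.norm_real, Real.norm_of_nonneg hw.le]
  calc w n * (‖g - g'‖ * ‖g⁻¹ * g'⁻¹‖)
      ≤ w n * (‖z - z'‖ * (16 * (p n ^ 2 * τ ^ 2 * (C / w n))) * 4) := by
        refine mul_le_mul_of_nonneg_left (mul_le_mul h1 h3 (norm_nonneg _) ?_) hw.le
        have := h.C_div_nonneg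
        positivity
    _ = 64 * C * τ ^ 2 * p n ^ 2 * ‖z - z'‖ := by
        field_simp
        ring

theorem lipschitz_const_le : 64 * C * τ ^ 2 * p n ^ 2 ≤ 1 / 256 := by
  have h1 := h.p_sq_le n
  have h2 := h.small
  have h3 : 0 ≤ C * τ ^ 2 := mul_nonneg (zero_le_one.trans h.one_le_C) (sq_nonneg _)
  nlinarith [sq_nonneg (p n)]

theorem norm_fixFun_sub_mu_le (hz : z ∈ Z) :
    ‖fixFun n μ w K z - μ n‖ ≤ 6 * p n ^ 2 * w n := by
  have hw := h.w_pos n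
  have hg0 := h.reducedVec_ne_zero hz
  have h1 := h.norm_reducedVec_self_sub_le hz
  have h2 := h.half_le_norm_reducedVec hz
  have h3 : fixFun n μ w K z - μ n =
      w n * ((reducedVec n μ w K z n - 1) / reducedVec n μ w K z n) := by
    rw [fixFun]
    field_simp
    ring
  rw [h3, norm_mul, norm_div, Complex.norm_real, Real.norm_of_nonneg hw.le, mul_comm]
  refine mul_le_mul_of_nonneg_right ?_ hw.le
  rw [div_le_iff₀ (norm_pos_iff.2 hg0)]
  nlinarith [sq_nonneg (p n)]

theorem fixedPoint_unique (hz : z ∈ Z) (hz' : z' ∈ Z) (hf : fixFun n μ w K z = z)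
    (hf' : fixFun n μ w K z' = z') : z = z' := by
  have h1 := h.norm_fixFun_sub_le hz hz'
  rw [hf, hf'] at h1
  have h2 := h.lipschitz_const_le
  have h3 : ‖z - z'‖ ≤ 0 := by nlinarith [norm_nonneg (z - z')]
  exact sub_eq_zero.1 (norm_le_zero_iff.1 h3)

theorem exists_fixedPoint {q : ℝ} (hq : 0 ≤ q) (hqτ : 6 * p n ^ 2 ≤ q)
    (hZ : Metric.closedBall (μ n : ℂ) (q * w n) ⊆ Z) :
    ∃ l ∈ Metric.closedBall (μ n : ℂ) (q * w n), fixFun n μ w K l = l := by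
  have hw := h.w_pos n
  have hmaps : Set.MapsTo (fixFun n μ w K) (Metric.closedBall (μ n : ℂ) (q * w n))
      (Metric.closedBall (μ n : ℂ) (q * w n)) := fun z hz => by
    rw [mem_closedBall_iff_norm]
    exact (h.norm_fixFun_sub_mu_le (hZ hz)).trans (mul_le_mul_of_nonneg_right hqτ hw.le)
  -- Banach's fixed point theorem; the true Lipschitz constant is at most `1/256`.
  have hcontr : ContractingWith (1 / 2) (hmaps.restrict (fixFun n μ w K) _ _) := by
    refine ⟨by rw [← NNReal.coe_lt_coe]; norm_num, LipschitzWith.of_dist_le_mul fun x y => ?_⟩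
    rw [Subtype.dist_eq, Subtype.dist_eq, dist_eq_norm, dist_eq_norm]
    refine (h.norm_fixFun_sub_le (hZ x.2) (hZ y.2)).trans
      (mul_le_mul_of_nonneg_right (h.lipschitz_const_le.trans ?_) (norm_nonneg _))
    norm_num
  obtain ⟨l, hl, hfix, -⟩ := hcontr.exists_fixedPoint' Metric.isClosed_closedBall.isComplete hmaps
    (Metric.mem_closedBall_self (by positivity)) (edist_ne_top _ _)
  exact ⟨l, hl, hfix⟩

/-- By the rank-one relation `fullOp_eq`, `L x = (1 + d x_n) e_n` with `d = (z - μ n) / w n - 1`.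
The definition of `fixFun` rewrites this scalar as a nonzero multiple of `z - fixFun z`, turning the
spectral problem into a fixed point problem. -/
theorem fullOp_reducedVec (hz : z ∈ Z) : fullOp μ w K z (reducedVec n μ w K z) =
    (reducedVec n μ w K z n * (z - fixFun n μ w K z) / w n) • stdVec n := by
  rw [h.fullOp_eq, h.reducedOp_reducedVec hz]
  have hg0 := h.reducedVec_ne_zero hz
  have hw : (w n : ℂ) ≠ 0 := by exact_mod_cast (h.w_pos n).ne'
  have : reducedVec n μ w K z n * (z - fixFun n μ w K z) / w n =
      1 + ((z - μ n) / w n - 1) * reducedVec n μ w K z n := by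
    rw [fixFun]
    field_simp
    ring
  rw [this, add_smul, one_smul]

/-- A kernel vector of `L` must be a multiple of `x`, while `L x` is a nonzero multiple of `e_n`.
For surjectivity, `N⁻¹ η` is a solution up to a multiple of `e_n`, which a multiple of `x` corrects.
-/
theorem isUnit_fullOp (hz : z ∈ Z) (hne : fixFun n μ w K z ≠ z) : IsUnit (fullOp μ w K z) := by
  set x := reducedVec n μ w K z with hx
  set d : ℂ := (z - μ n) / w n - 1 with hd
  set s : ℂ := x n * (z - fixFun n μ w K z) / w n with hs
  have hw : (w n : ℂ) ≠ 0 := by exact_mod_cast (h.w_pos n).ne'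
  have hs0 : s ≠ 0 :=
    div_ne_zero (mul_ne_zero (h.reducedVec_ne_zero hz) (sub_ne_zero.2 hne.symm)) hw
  have hLx : fullOp μ w K z x = s • stdVec n := h.fullOp_reducedVec hz
  rw [ContinuousLinearMap.isUnit_iff_bijective]
  constructor
  · rw [injective_iff_map_eq_zero]
    intro ξ hξ
    have h1 : reducedOp n μ w K z ξ = -(d * ξ n) • stdVec n := by
      rw [h.fullOp_eq] at hξ
      rw [neg_smul, eq_neg_iff_add_eq_zero]
      exact hξ
    have h2 : ξ = -(d * ξ n) • x := by
      have h2 := h.inverse_reducedOp hz ξ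
      rw [h1, map_smul] at h2
      exact h2.symm
    rw [h2, map_smul, hLx, smul_smul] at hξ
    have h3 : stdVec n ≠ 0 := fun h0 => by
      have := norm_stdVec n
      rw [h0, norm_zero] at this
      norm_num at this
    have h4 := (mul_eq_zero.1 ((smul_eq_zero.1 hξ).resolve_right h3)).resolve_right hs0
    rw [h2, h4, zero_smul]
  · intro η
    set y := Ring.inverse (reducedOp n μ w K z) η with hy
    refine ⟨y - (d * y n / s) • x, ?_⟩
    rw [map_sub, map_smul, hLx, h.fullOp_eq, h.reducedOp_inverse hz, smul_smul,
      div_mul_cancel₀ _ hs0, add_sub_cancel_right]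

theorem inverse_fullOp_stdVec (hz : z ∈ Z) (hne : fixFun n μ w K z ≠ z) :
    Ring.inverse (fullOp μ w K z) (stdVec n) =
      (w n * (reducedVec n μ w K z n)⁻¹ * (z - fixFun n μ w K z)⁻¹) • reducedVec n μ w K z := by
  have hw : (w n : ℂ) ≠ 0 := by exact_mod_cast (h.w_pos n).ne'
  have hg0 := h.reducedVec_ne_zero hz
  have hs0 := sub_ne_zero.2 hne.symm
  have h1 : stdVec n = fullOp μ w K z ((w n * (reducedVec n μ w K z n)⁻¹ *
      (z - fixFun n μ w K z)⁻¹) • reducedVec n μ w K z) := by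
    rw [map_smul, h.fullOp_reducedVec hz, smul_smul]
    rw [show (w n * (reducedVec n μ w K z n)⁻¹ * (z - fixFun n μ w K z)⁻¹ *
      (reducedVec n μ w K z n * (z - fixFun n μ w K z) / w n) : ℂ) = 1 by field_simp, one_smul]
  conv_lhs => rw [h1]
  rw [← mul_apply_eq_comp, Ring.inverse_mul_cancel _ (h.isUnit_fullOp hz hne),
    one_apply_eq_self]

/-- This excludes Jordan chains, since `J* J = diag (1 / w)`. Applying `N⁻¹` and taking the `n`-th
coordinate, with `1 + d x_n = 0` at a fixed point, gives `c (y_n + x_n² / w_n) = 0`. Here `w_n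
|y_n|` is at most `1/1024` while `|x_n|² ≥ 1/4`, so `c = 0`. -/
theorem kernel_fullOp (hz : z ∈ Z) (hfix : fixFun n μ w K z = z) (ξ : SeqSpace) (c : ℂ)
    (hξ : fullOp μ w K z ξ = c • diag (fun m => (w m : ℂ)⁻¹) (reducedVec n μ w K z)) :
    ξ ∈ Submodule.span ℂ {reducedVec n μ w K z} := by
  set x := reducedVec n μ w K z with hx
  set d : ℂ := (z - μ n) / w n - 1 with hd
  set W := diag (fun m => if m = n then 0 else (w m : ℂ)⁻¹) with hW
  set y := Ring.inverse (reducedOp n μ w K z) (W x) with hy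
  have hw : (w n : ℂ) ≠ 0 := by exact_mod_cast (h.w_pos n).ne'
  have hg0 : x n ≠ 0 := h.reducedVec_ne_zero hz
  have hdx : 1 + d * x n = 0 := by
    have h1 := h.fullOp_reducedVec hz
    rw [hfix, sub_self, mul_zero, zero_div, zero_smul, h.fullOp_eq, h.reducedOp_reducedVec hz] at h1
    have h2 := congrArg (fun ξ : SeqSpace => ξ n) h1
    change stdVec n n + d * x n * stdVec n n = 0 at h2
    rwa [stdVec_self, mul_one] at h2
  have h1 : diag (fun m => (w m : ℂ)⁻¹) x = W x + ((w n : ℂ)⁻¹ * x n) • stdVec n := by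
    ext m
    change _ = W x m + ((w n : ℂ)⁻¹ * x n) * stdVec n m
    rw [hW, diag_apply h.norm_inv_w_le, diag_apply h.norm_reduced_inv_w_le, stdVec_apply]
    split_ifs with hm
    · subst hm; ring
    · ring
  have h2 : reducedOp n μ w K z ξ = c • W x + (c * ((w n : ℂ)⁻¹ * x n) - d * ξ n) • stdVec n := by
    rw [h.fullOp_eq, h1] at hξ
    rw [sub_smul, ← smul_smul c]
    rw [smul_add] at hξ
    rw [← add_sub_assoc, ← hξ]
    abel
  have h3 : ξ = c • y + (c * ((w n : ℂ)⁻¹ * x n) - d * ξ n) • x := by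
    conv_lhs => rw [← h.inverse_reducedOp hz ξ, h2]
    rw [map_add, map_smul, map_smul]
    rfl
  have h4 : c * (y n + (w n : ℂ)⁻¹ * x n * x n) = 0 := by
    have h5 := congrArg (fun ξ : SeqSpace => ξ n) h3
    change ξ n = c * y n + (c * ((w n : ℂ)⁻¹ * x n) - d * ξ n) * x n at h5
    linear_combination -h5 + ξ n * hdx
  have h6 : y n + (w n : ℂ)⁻¹ * x n * x n ≠ 0 := fun h0 => by
    have h7 : ‖y n‖ ≤ 16 * (p n ^ 2 * τ ^ 2 * (C / w n)) := h.norm_inverse_apply_le hz hz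
    rw [eq_neg_of_add_eq_zero_left h0, norm_neg, norm_mul, norm_mul, norm_inv, Complex.norm_real,
      Real.norm_of_nonneg (h.w_pos n).le] at h7
    have h8 := h.half_le_norm_reducedVec hz
    have h9 := h.lipschitz_const_le
    have h10 := h.w_pos n
    have h11 : ‖x n‖ * ‖x n‖ ≤ 16 * (p n ^ 2 * τ ^ 2 * C) := by
      calc ‖x n‖ * ‖x n‖ = w n * ((w n)⁻¹ * ‖x n‖ * ‖x n‖) := by field_simp
        _ ≤ w n * (16 * (p n ^ 2 * τ ^ 2 * (C / w n))) := mul_le_mul_of_nonneg_left h7 h10.le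
        _ = _ := by field_simp
    nlinarith
  have hc : c = 0 := (mul_eq_zero.1 h4).resolve_right h6
  rw [h3, hc, zero_smul, zero_add]
  exact Submodule.smul_mem _ _ (Submodule.mem_span_singleton_self _)

/-! ### Holomorphic dependence on the spectral parameter. -/

theorem differentiableAt_reducedVec (hz : z ∈ Z) :
    DifferentiableAt ℂ (reducedVec n μ w K) z := by
  have h1 : DifferentiableAt ℂ (reducedOp n μ w K) z := by
    unfold reducedOp
    fun_prop
  have h2 := (differentiableAt_inverse (𝕜 := ℂ) (h.isUnit_reducedOp hz)).comp z h1
  exact h2.clm_apply (differentiableAt_const _)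

theorem differentiableAt_reducedVec_apply (hz : z ∈ Z) :
    DifferentiableAt ℂ (fun z => reducedVec n μ w K z n) z := by
  have h1 := ((innerSL ℂ (stdVec n)).differentiableAt (x := reducedVec n μ w K z)).comp z
    (h.differentiableAt_reducedVec hz)
  refine h1.congr_of_eventuallyEq (Eventually.of_forall fun z => ?_)
  simp [inner_stdVec]

theorem differentiableAt_fixFun (hz : z ∈ Z) : DifferentiableAt ℂ (fixFun n μ w K) z := by
  unfold fixFun
  exact (((h.differentiableAt_reducedVec_apply hz).inv (h.reducedVec_ne_zero hz)).const_sub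
    _).const_mul _ |>.const_add _

end IsSmall

/-! ### The perturbed eigenpair with a given index -/

section SingleIndex

variable {H : Type*} [NormedAddCommGroup H] [InnerProductSpace ℂ H] {V : Submodule ℂ H}

theorem inner_diag {θ : ℕ → ℝ} {C : ℝ} (hθ : ∀ m, ‖(θ m : ℂ)‖ ≤ C) (η ζ : SeqSpace) :
    inner ℂ (diag (fun m => (θ m : ℂ)) η) ζ = inner ℂ η (diag (fun m => (θ m : ℂ)) ζ) := by
  rw [lp.inner_eq_tsum, lp.inner_eq_tsum]
  refine tsum_congr fun m => ?_
  rw [diag_apply hθ, diag_apply hθ, RCLike.inner_apply, RCLike.inner_apply]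
  simp only [map_mul, Complex.conj_ofReal]
  ring

theorem diag_stdVec {d : ℕ → ℂ} {C : ℝ} (hd : ∀ m, ‖d m‖ ≤ C) (n : ℕ) :
    diag d (stdVec n) = d n • stdVec n := by
  ext m
  change _ = d n * stdVec n m
  rw [diag_apply hd, stdVec_apply]
  split_ifs with h
  · rw [h]
  · simp

/-- Coordinates `U` of the form domain, adapted to the eigenvalues `μ` of the form `a`, with the
operator `B` of the form `b`. -/
structure IsCoordinates (a b : V →ₗ[ℂ] V →ₗ⋆[ℂ] ℂ) (μ : ℕ → ℝ) (ψ : ℕ → V)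
    (U : SeqSpace ≃ₗ[ℂ] V) (B : SeqSpace →L[ℂ] SeqSpace) : Prop where
  mu_bdd : ∃ c > 0, ∀ k, c ≤ μ k
  a_eq : ∀ ξ η, a (U ξ) (U η) = inner ℂ η ξ
  b_eq : ∀ ξ η, b (U ξ) (U η) = inner ℂ η (B ξ)
  inner_eq : ∀ ξ η, inner ℂ (U η : H) (U ξ : H) = inner ℂ η (diag (fun k => (μ k : ℂ)⁻¹) ξ)
  apply_stdVec : ∀ k, U (stdVec k) = ((√(μ k))⁻¹ : ℂ) • ψ k

namespace IsCoordinates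

variable {a b : V →ₗ[ℂ] V →ₗ⋆[ℂ] ℂ} {μ : ℕ → ℝ} {ψ : ℕ → V}
    {U : SeqSpace ≃ₗ[ℂ] V} {B : SeqSpace →L[ℂ] SeqSpace} (h : IsCoordinates a b μ ψ U B)
include h

theorem mu_pos (k : ℕ) : 0 < μ k := by
  obtain ⟨c, hc, hk⟩ := h.mu_bdd
  exact hc.trans_le (hk k)

theorem exists_norm_inv_mu_le : ∃ C, ∀ k, ‖(μ k : ℂ)⁻¹‖ ≤ C := by
  obtain ⟨c, hc, hk⟩ := h.mu_bdd
  refine ⟨c⁻¹, fun k => ?_⟩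
  rw [norm_inv, Complex.norm_real, Real.norm_of_nonneg (h.mu_pos k).le]
  exact inv_anti₀ hc (hk k)

theorem exists_clm : ∃ ι : SeqSpace →L[ℂ] H, ∀ ξ, ι ξ = U ξ := by
  obtain ⟨C, hC⟩ := h.exists_norm_inv_mu_le
  have hC0 : 0 ≤ C := (norm_nonneg _).trans (hC 0)
  refine ⟨(V.subtype ∘ₗ U.toLinearMap).mkContinuous (√C) fun ξ => ?_, fun ξ => rfl⟩
  refine le_of_sq_le_sq ?_ (by positivity)
  have h1 := h.inner_eq ξ ξ
  rw [inner_self_eq_norm_sq_to_K] at h1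
  have h2 : ‖(U ξ : H)‖ ^ 2 = ‖inner ℂ ξ (diag (fun k => (μ k : ℂ)⁻¹) ξ)‖ := by
    rw [← h1, norm_pow]
    simp
  rw [mul_pow, Real.sq_sqrt hC0]
  change ‖(U ξ : H)‖ ^ 2 ≤ _
  rw [h2]
  refine (norm_inner_le_norm _ _).trans ?_
  nlinarith [norm_diag_apply_le hC ξ, norm_nonneg ξ]

theorem energyNorm_eq (ξ : SeqSpace) : energyNorm a (U ξ) = ‖ξ‖ := by
  rw [energyNorm, h.a_eq, norm_eq_sqrt_re_inner (𝕜 := ℂ)]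
  rfl

theorem B_entries (m k : ℕ) :
    ‖B (stdVec k) m‖ = ‖b (ψ k) (ψ m)‖ / (√(μ k) * √(μ m)) := by
  have h1 := h.b_eq (stdVec k) (stdVec m)
  rw [inner_stdVec, h.apply_stdVec, h.apply_stdVec] at h1
  simp only [map_smulₛₗ, LinearMap.smul_apply, smul_eq_mul, RingHom.id_apply, map_inv₀,
    Complex.conj_ofReal] at h1
  rw [← h1, norm_mul, norm_mul, norm_inv, norm_inv, Complex.norm_real, Complex.norm_real,
    Real.norm_of_nonneg (Real.sqrt_nonneg _), Real.norm_of_nonneg (Real.sqrt_nonneg _)]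
  rw [div_eq_mul_inv, mul_inv]
  ring

variable {w : ℕ → ℝ}

theorem theta_sq (hw : ∀ m, 0 < w m) (m : ℕ) :
    (√(μ m / w m) : ℂ) * (√(μ m / w m) : ℂ) = μ m / w m := by
  rw [← Complex.ofReal_mul, Real.mul_self_sqrt (div_nonneg (h.mu_pos m).le (hw m).le),
    Complex.ofReal_div]

/-- The parametrization of the form domain after rescaling the coordinates. -/
theorem exists_represents [CompleteSpace H] (hw : ∀ m, 0 < w m)
    (hμw : ∃ c, ∀ m, μ m ≤ c * w m) (hwμ : ∃ c, ∀ m, w m ≤ c * μ m) {n : ℕ} {p : ℕ → ℝ}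
    {τ C : ℝ} {Z : Set ℂ}
    (hK : IsSmall n μ w (diag (fun m => (√(μ m / w m) : ℂ)) ∘L B ∘L
      diag (fun m => (√(μ m / w m) : ℂ))) p τ C Z) :
    ∃ J : SeqSpace →L[ℂ] H, (∀ ξ, J ξ = U (diag (fun m => (√(μ m / w m) : ℂ)) ξ)) ∧
      (∀ z, Represents (a + b) z J (fullOp μ w (diag (fun m => (√(μ m / w m) : ℂ)) ∘L B ∘L
        diag (fun m => (√(μ m / w m) : ℂ))) z)) ∧
      (∀ ξ, J.adjoint (J ξ) = diag (fun m => (w m : ℂ)⁻¹) ξ) ∧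
      ∀ k, J (stdVec k) = ((√(w k))⁻¹ : ℂ) • (ψ k : H) := by
  obtain ⟨ι, hι⟩ := h.exists_clm
  obtain ⟨c₁, hc₁⟩ := hμw
  obtain ⟨c₂, hc₂⟩ := hwμ
  obtain ⟨c₃, hc₃⟩ := h.exists_norm_inv_mu_le
  set Θ := diag (fun m => (√(μ m / w m) : ℂ)) with hΘ
  -- The two comparisons of `μ` with `w` make the rescaling bounded with bounded inverse, so that
  -- `J` still has range exactly `V`.
  have hθ : ∀ m, ‖(√(μ m / w m) : ℂ)‖ ≤ √c₁ := fun m => by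
    rw [Complex.norm_real, Real.norm_of_nonneg (Real.sqrt_nonneg _)]
    exact Real.sqrt_le_sqrt ((div_le_iff₀ (hw m)).2 (hc₁ m))
  have hθi : ∀ m, ‖(√(μ m / w m) : ℂ)⁻¹‖ ≤ √c₂ := fun m => by
    rw [norm_inv, Complex.norm_real, Real.norm_of_nonneg (Real.sqrt_nonneg _), ← Real.sqrt_inv,
      inv_div]
    exact Real.sqrt_le_sqrt ((div_le_iff₀ (h.mu_pos m)).2 (hc₂ m))
  have hθ0 : ∀ m, (√(μ m / w m) : ℂ) ≠ 0 := fun m => by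
    exact_mod_cast (Real.sqrt_pos.2 (div_pos (h.mu_pos m) (hw m))).ne'
  have hμ0 : ∀ m, (μ m : ℂ) ≠ 0 := fun m => by exact_mod_cast (h.mu_pos m).ne'
  have hw0 : ∀ m, (w m : ℂ) ≠ 0 := fun m => by exact_mod_cast (hw m).ne'
  have hJ : ∀ ξ, (ι ∘L Θ) ξ = U (Θ ξ) := fun ξ => hι _
  have hΘM : ∀ ξ, Θ (diag (fun k => (μ k : ℂ)⁻¹) (Θ ξ)) = diag (fun m => (w m : ℂ)⁻¹) ξ := by
    intro ξ
    ext m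
    rw [hΘ, diag_apply hθ, diag_apply hc₃, diag_apply hθ, diag_apply hK.norm_inv_w_le]
    have := h.theta_sq hw m
    have h2 := hμ0 m
    calc _ = (√(μ m / w m) : ℂ) * (√(μ m / w m) : ℂ) * (μ m : ℂ)⁻¹ * ξ m := by ring
      _ = _ := by rw [this]; field_simp
  have hJJ : ∀ ξ η, inner ℂ ((ι ∘L Θ) η) ((ι ∘L Θ) ξ) =
      inner ℂ η (diag (fun m => (w m : ℂ)⁻¹) ξ) := fun ξ η => by
    rw [hJ, hJ, h.inner_eq, hΘ, inner_diag hθ, ← hΘ, hΘM]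
  refine ⟨ι ∘L Θ, hJ, fun z => ⟨fun ξ => ?_, fun v => ?_, fun ξ η => ?_⟩, fun ξ => ?_, fun k => ?_⟩
  · rw [hJ]
    exact (U _).2
  · refine ⟨diag (fun m => (√(μ m / w m) : ℂ)⁻¹) (U.symm v), ?_⟩
    rw [hJ, hΘ, ← mul_apply_eq_comp, diag_mul_diag hθ hθi fun m => mul_inv_cancel₀ (hθ0 m),
      one_apply_eq_self, LinearEquiv.apply_symm_apply]
  · have e : ∀ ξ (hm : (ι ∘L Θ) ξ ∈ V), (⟨(ι ∘L Θ) ξ, hm⟩ : V) = U (Θ ξ) := fun ξ hm =>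
      Subtype.ext (hJ ξ)
    rw [e, e, hJJ, LinearMap.add_apply, LinearMap.add_apply, h.a_eq, h.b_eq]
    nth_rewrite 1 [hΘ]
    rw [inner_diag hθ, ← hΘ]
    nth_rewrite 2 [hΘ]
    rw [inner_diag hθ, ← hΘ, ← inner_smul_right, ← inner_add_right, ← inner_sub_right]
    congr 1
    ext m
    rw [hK.fullOp_apply]
    change z * diag _ ξ m - (Θ (Θ ξ) m + Θ (B (Θ ξ)) m) = _ - Θ (B (Θ ξ)) m
    have h3 : Θ (Θ ξ) m = μ m / w m * ξ m := by
      rw [hΘ, diag_apply hθ, diag_apply hθ, ← mul_assoc, h.theta_sq hw]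
    rw [h3, diag_apply hK.norm_inv_w_le]
    ring
  · refine ext_inner_left ℂ fun η => ?_
    rw [ContinuousLinearMap.adjoint_inner_right, hJJ]
  · rw [hJ, hΘ, diag_stdVec hθ, map_smul, h.apply_stdVec, Submodule.coe_smul, Submodule.coe_smul,
      smul_smul, Real.sqrt_div (h.mu_pos k).le]
    congr 1
    have h1 : (√(μ k) : ℂ) ≠ 0 := by exact_mod_cast (Real.sqrt_pos.2 (h.mu_pos k)).ne'
    rw [Complex.ofReal_div]
    field_simp

/-- The factors `√μ` of the energy normalization cancel against the rescaling, leaving only the gap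
sizes `w`. -/
theorem norm_K_entries (hw : ∀ m, 0 < w m) (hμw : ∃ c, ∀ m, μ m ≤ c * w m) (m k : ℕ) :
    ‖(diag (fun m => (√(μ m / w m) : ℂ)) ∘L B ∘L diag (fun m => (√(μ m / w m) : ℂ)))
      (stdVec k) m‖ = ‖b (ψ k) (ψ m)‖ / (√(w m) * √(w k)) := by
  obtain ⟨c₁, hc₁⟩ := hμw
  have hθ : ∀ m, ‖(√(μ m / w m) : ℂ)‖ ≤ √c₁ := fun m => by
    rw [Complex.norm_real, Real.norm_of_nonneg (Real.sqrt_nonneg _)]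
    exact Real.sqrt_le_sqrt ((div_le_iff₀ (hw m)).2 (hc₁ m))
  rw [ContinuousLinearMap.comp_apply, ContinuousLinearMap.comp_apply, diag_apply hθ,
    diag_stdVec hθ, map_smul]
  change ‖_ * (_ * B (stdVec k) m)‖ = _
  have hs : ∀ m, √(μ m) ≠ 0 := fun m => (Real.sqrt_pos.2 (h.mu_pos m)).ne'
  have hs' : ∀ m, √(w m) ≠ 0 := fun m => (Real.sqrt_pos.2 (hw m)).ne'
  rw [norm_mul, norm_mul, h.B_entries, Complex.norm_real, Complex.norm_real,
    Real.norm_of_nonneg (Real.sqrt_nonneg _), Real.norm_of_nonneg (Real.sqrt_nonneg _),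
    Real.sqrt_div (h.mu_pos _).le, Real.sqrt_div (h.mu_pos _).le]
  field_simp [hs m, hs k, hs' m, hs' k]

end IsCoordinates

theorem closure_rectangle_subset (μ : ℕ → ℝ) (κ γ : ℝ) (n : ℕ) :
    closure (rectangle μ κ γ n) ⊆
      Set.Icc (lowerCorner μ κ γ n).re (upperCorner μ κ γ n).re ×ℂ
        Set.Icc (lowerCorner μ κ γ n).im (upperCorner μ κ γ n).im :=
  closure_minimal (fun _ hz => ⟨⟨hz.1.le, hz.2.1.le⟩, ⟨hz.2.2.1.le, hz.2.2.2.le⟩⟩)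
    (isClosed_Icc.reProdIm isClosed_Icc)

variable [CompleteSpace H]

/-- The perturbed eigenpair for a single index, with an estimate in energy coordinates. -/
theorem exists_perturbedEigenpair {a b : V →ₗ[ℂ] V →ₗ⋆[ℂ] ℂ} {μ : ℕ → ℝ} {ψ : ℕ → V}
    {U : SeqSpace ≃ₗ[ℂ] V} {B : SeqSpace →L[ℂ] SeqSpace} (h : IsCoordinates a b μ ψ U B)
    (hV : Dense (V : Set H)) {κ γ : ℝ} {n : ℕ} {w p : ℕ → ℝ} {τ C q S : ℝ}
    (hμw : ∃ c, ∀ m, μ m ≤ c * w m) (hwμ : ∃ c, ∀ m, w m ≤ c * μ m)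
    (hK : IsSmall n μ w (diag (fun m => (√(μ m / w m) : ℂ)) ∘L B ∘L
      diag (fun m => (√(μ m / w m) : ℂ))) p τ C
      (Set.Icc (lowerCorner μ κ γ n).re (upperCorner μ κ γ n).re ×ℂ
        Set.Icc (lowerCorner μ κ γ n).im (upperCorner μ κ γ n).im))
    (hq : 0 ≤ q) (hqτ : 6 * p n ^ 2 ≤ q)
    (hball : Metric.closedBall (μ n : ℂ) (q * w n) ⊆ rectangle μ κ γ n)
    (hS : HasSum (fun m => μ m * p m ^ 2 / w m) S) :
    ∃ (l : ℂ) (ζ : SeqSpace),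
      IsPerturbedEigenpair (formOperator (a + b)) μ κ γ n (ψ n) l (U ζ : H) ∧
      ‖((√(μ n))⁻¹ : ℂ) • ζ - stdVec n‖ ≤ 40 * √(p n ^ 2 * w n / μ n * S) := by
  set Z := (Set.Icc (lowerCorner μ κ γ n).re (upperCorner μ κ γ n).re ×ℂ
        Set.Icc (lowerCorner μ κ γ n).im (upperCorner μ κ γ n).im) with hZ
  obtain ⟨J, hJ, hrep, hJJ, hJψ⟩ := h.exists_represents hK.w_pos hμw hwμ hK
  set K := diag (fun m => (√(μ m / w m) : ℂ)) ∘L B ∘L diag (fun m => (√(μ m / w m) : ℂ)) with hKd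
  have hrZ : rectangle μ κ γ n ⊆ Z := subset_closure.trans (closure_rectangle_subset μ κ γ n)
  obtain ⟨l, hlb, hl⟩ := hK.exists_fixedPoint hq hqτ (hball.trans hrZ)
  have hlr := hball hlb
  have hlZ := hrZ hlr
  have hne : ∀ z ∈ Z, z ≠ l → fixFun n μ w K z ≠ z := fun z hz hzl h0 =>
    hzl (hK.fixedPoint_unique hz hlZ h0 hl)
  have hwn := hK.w_pos n
  have hμn := h.mu_pos n
  have hsw : (√(w n) : ℂ) ≠ 0 := by exact_mod_cast (Real.sqrt_pos.2 hwn).ne'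
  have hsw2 : (√(w n) : ℂ) * √(w n) = w n := by exact_mod_cast Real.mul_self_sqrt hwn.le
  have hw0 : (w n : ℂ) ≠ 0 := by exact_mod_cast hwn.ne'
  have hψJ : (ψ n : H) = (√(w n) : ℂ) • J (stdVec n) := by
    rw [hJψ, smul_smul, mul_inv_cancel₀ hsw, one_smul]
  have hJinj : ∀ ξ, J ξ = 0 → ξ = 0 := fun ξ hξ => by
    have h1 := hJJ ξ
    rw [hξ, map_zero] at h1
    ext m
    have h2 := congrArg (fun ξ : SeqSpace => ξ m) h1
    simp only at h2
    rw [diag_apply hK.norm_inv_w_le] at h2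
    exact (mul_eq_zero.1 h2.symm).resolve_left
      (inv_ne_zero (by exact_mod_cast (hK.w_pos m).ne'))
  set x := reducedVec n μ w K with hx
  have hx0 : x l ≠ 0 := fun h0 => hK.reducedVec_ne_zero hlZ (by
    change x l n = 0
    rw [h0]; rfl)
  have hJx0 : J (x l) ≠ 0 := fun h0 => hx0 (hJinj _ h0)
  have hLx : fullOp μ w K l (x l) = 0 := by
    rw [hx, hK.fullOp_reducedVec hlZ, hl, sub_self, mul_zero, zero_div, zero_smul]
  -- Since `l` is a fixed point, `z - fixFun z = (z - l) k(z)` with `k` holomorphic; uniqueness of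
  -- the fixed point and `k l ≈ 1` keep `k` away from zero on `Z`.
  set k : ℂ → ℂ := dslope (fun z => z - fixFun n μ w K z) l with hk
  have hZl : Z ∈ 𝓝 l := by
    rw [hZ, Complex.reProdIm]
    exact Filter.inter_mem
      (Complex.continuous_re.continuousAt.preimage_mem_nhds (Icc_mem_nhds hlr.1 hlr.2.1))
      (Complex.continuous_im.continuousAt.preimage_mem_nhds (Icc_mem_nhds hlr.2.2.1 hlr.2.2.2))
  have hkd : DifferentiableOn ℂ k Z := (Complex.differentiableOn_dslope hZl).2 fun z hz =>
    (differentiableAt_id.sub (hK.differentiableAt_fixFun hz)).differentiableWithinAt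
  -- `1 - k l` is the derivative of `fixFun` at `l`, bounded by its Lipschitz constant `64 C τ² p_n²
  -- ≤ p_n² / 2`.
  have hk1 : ‖k l - 1‖ ≤ p n ^ 2 := by
    have h1 : k l = 1 - deriv (fixFun n μ w K) l := by
      rw [hk, dslope_same]
      exact ((hasDerivAt_id l).sub (hK.differentiableAt_fixFun hlZ).hasDerivAt).deriv
    have hc0 : 0 ≤ 64 * C * τ ^ 2 * p n ^ 2 := by
      have := zero_le_one.trans hK.one_le_C
      positivity
    have h2 := norm_deriv_le_of_lip' (f := fixFun n μ w K) (x₀ := l) hc0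
      (Filter.mem_of_superset hZl fun z hz => hK.norm_fixFun_sub_le hz hlZ)
    rw [h1, sub_sub_cancel_left, norm_neg]
    refine h2.trans ?_
    nlinarith [hK.small, sq_nonneg (p n)]
  have hp2 := hK.p_sq_le n
  have hkl : 1 / 2 ≤ ‖k l‖ := by
    have h2 := norm_sub_norm_le (1 : ℂ) (1 - k l)
    rw [sub_sub_cancel, norm_one, norm_sub_rev] at h2
    linarith
  have hkz : ∀ z ∈ Z, z ≠ l → z - fixFun n μ w K z = (z - l) * k z := fun z hz hzl => by
    rw [hk, dslope_of_ne _ hzl, slope_def_field, hl, sub_self, sub_zero]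
    field_simp [sub_ne_zero.2 hzl]
  have hk0 : ∀ z ∈ Z, k z ≠ 0 := fun z hz => by
    rcases eq_or_ne z l with rfl | hzl
    · intro h0
      rw [h0, norm_zero] at hkl
      norm_num at hkl
    · intro h0
      have := hkz z hz hzl
      rw [h0, mul_zero, sub_eq_zero] at this
      exact hne z hz hzl this.symm
  have hres : ∀ z ∈ Z, z ≠ l → resolvent (formOperator (a + b)) z (ψ n) =
      (z - l)⁻¹ • (((√(w n) : ℂ) * (x z n)⁻¹ * (k z)⁻¹) • J (x z)) := fun z hz hzl => by
    rw [(hrep z).resolvent_eq hV (hK.isUnit_fullOp hz (hne z hz hzl)), hψJ]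
    simp only [ContinuousLinearMap.comp_apply, map_smul]
    rw [hJJ, diag_stdVec hK.norm_inv_w_le, map_smul,
      hK.inverse_fullOp_stdVec hz (hne z hz hzl), hkz z hz hzl]
    simp only [map_smul, smul_smul, mul_inv]
    congr 1
    change (√(w n) : ℂ) * ((w n : ℂ)⁻¹ * (w n * (x z n)⁻¹ * ((z - l)⁻¹ * (k z)⁻¹))) = _
    field_simp
  -- The value at `l` of the holomorphic factor in `hres`, up to `√(w n)`: by Cauchy's formula the
  -- Riesz vector is `√(w n) β J(x l)`.
  set β : ℂ := (x l n)⁻¹ * (k l)⁻¹ with hβ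
  set ζ : SeqSpace := diag (fun m => (√(μ m / w m) : ℂ)) (((√(w n) : ℂ) * β) • x l) with hζ
  have hUζ : (U ζ : H) = ((√(w n) : ℂ) * β) • J (x l) := by
    rw [hζ, ← hJ, map_smul]
  have hxl0 : x l n ≠ 0 := hK.reducedVec_ne_zero hlZ
  have hβ0 : (√(w n) : ℂ) * β ≠ 0 :=
    mul_ne_zero hsw (mul_ne_zero (inv_ne_zero hxl0) (inv_ne_zero (hk0 l hlZ)))
  refine ⟨l, ζ, ⟨hlr, fun z hz hzl => ?_, ?_, ?_, ?_⟩, ?_⟩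
  · have hzZ := closure_rectangle_subset μ κ γ n hz
    exact (hrep z).mem_resolventSet hV (hK.isUnit_fullOp hzZ (hne z hzZ hzl))
  · refine (hrep l).isSimpleEigenvalue hV hJx0 hLx fun ξ c hξ => ?_
    rw [hJJ] at hξ
    exact hK.kernel_fullOp hlZ hl ξ c hξ
  · rw [hUζ, ← map_smul]
    refine (hrep l).isEigenpair hV ?_ ?_
    · rw [map_smul]
      exact smul_ne_zero hβ0 hJx0
    · rw [map_smul, hLx, smul_zero]
  · have h1 : rectIntegral (fun z => resolvent (formOperator (a + b)) z (ψ n))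
        (lowerCorner μ κ γ n) (upperCorner μ κ γ n) =
        rectIntegral (fun z => (z - l)⁻¹ • (((√(w n) : ℂ) * (x z n)⁻¹ * (k z)⁻¹) • J (x z)))
          (lowerCorner μ κ γ n) (upperCorner μ κ γ n) := by
      refine rectIntegral_congr (hlr.1.trans hlr.2.1).le (hlr.2.2.1.trans hlr.2.2.2).le
        fun z hz hbd => hres z hz ?_
      rintro rfl
      have h1 := hlr.1
      have h2 := hlr.2.1
      have h3 := hlr.2.2.1
      have h4 := hlr.2.2.2
      rcases hbd with h | h | h | h <;> linarith
    rw [rieszVector, h1, rectIntegral_inv_smul _ _ _ hlr.1 hlr.2.1 hlr.2.2.1 hlr.2.2.2, smul_smul,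
      inv_mul_cancel₀ Complex.two_pi_I_ne_zero, one_smul, hUζ, hβ, mul_assoc]
    intro z hz
    refine DifferentiableWithinAt.smul (DifferentiableWithinAt.mul (DifferentiableWithinAt.mul
      (differentiableWithinAt_const _) (DifferentiableWithinAt.inv
        (hK.differentiableAt_reducedVec_apply hz).differentiableWithinAt
        (hK.reducedVec_ne_zero hz))) ((hkd z hz).inv (hk0 z hz))) ?_
    exact (J.differentiableAt.comp z
      (hK.differentiableAt_reducedVec hz)).differentiableWithinAt
  · obtain ⟨c₁, hc₁⟩ := hμw
    have hθ : ∀ m, ‖(√(μ m / w m) : ℂ)‖ ≤ √c₁ := fun m => by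
      rw [Complex.norm_real, Real.norm_of_nonneg (Real.sqrt_nonneg _)]
      exact Real.sqrt_le_sqrt ((div_le_iff₀ (hK.w_pos m)).2 (hc₁ m))
    have hgk : ‖x l n * k l - 1‖ ≤ 7 * p n ^ 2 := by
      have e : x l n * k l - 1 = (x l n - 1) * k l + (k l - 1) := by ring
      have h1 := hK.norm_reducedVec_self_sub_le hlZ
      change ‖x l n - 1‖ ≤ _ at h1
      have h2 : ‖k l‖ ≤ 2 := by
        have := norm_add_le (k l - 1) 1
        rw [sub_add_cancel, norm_one] at this
        linarith
      rw [e]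
      refine (norm_add_le _ _).trans ?_
      rw [norm_mul]
      nlinarith [norm_nonneg (x l n - 1), norm_nonneg (k l)]
    have hgk4 : 1 / 4 ≤ ‖x l n * k l‖ := by
      rw [norm_mul]
      have h1 := hK.half_le_norm_reducedVec hlZ
      change 1 / 2 ≤ ‖x l n‖ at h1
      nlinarith
    have hgk0 : 0 < ‖x l n * k l‖ := by linarith
    have hβe : β = (x l n * k l)⁻¹ := by rw [hβ, mul_inv]
    have hβ4 : ‖β‖ ≤ 4 := by
      rw [hβe, norm_inv, inv_le_comm₀ hgk0 (by norm_num)]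
      linarith
    have hβ1 : ‖β - 1‖ ≤ 28 * p n ^ 2 := by
      have e : β - 1 = -(β * (x l n * k l - 1)) := by
        rw [hβe, mul_sub, inv_mul_cancel₀ (norm_pos_iff.1 hgk0)]
        ring
      rw [e, norm_neg, norm_mul]
      nlinarith [norm_nonneg β, norm_nonneg (x l n * k l - 1)]
    have hS0 : 0 ≤ S := hS.nonneg fun m =>
      div_nonneg (mul_nonneg (h.mu_pos m).le (sq_nonneg _)) (hK.w_pos m).le
    set Q := p n ^ 2 * w n / μ n * S with hQ
    have hQ0 : 0 ≤ Q := by positivity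
    -- The term `m = n` alone of the sum in `Q` equals `p_n⁴`, so the scalar error is controlled by
    -- the same quantity as the vector error.
    have hsQ : p n ^ 2 ≤ √Q := by
      refine Real.le_sqrt_of_sq_le ?_
      have h1 := le_hasSum hS n fun m _ =>
        div_nonneg (mul_nonneg (h.mu_pos m).le (sq_nonneg _)) (hK.w_pos m).le
      calc (p n ^ 2) ^ 2 = p n ^ 2 * w n / μ n * (μ n * p n ^ 2 / w n) := by
            field_simp
        _ ≤ Q := mul_le_mul_of_nonneg_left h1 (by positivity)
    have hsμ : (√(μ n) : ℂ) ≠ 0 := by exact_mod_cast (Real.sqrt_pos.2 hμn).ne'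
    set ρ : SeqSpace := ((√(μ n) : ℂ)⁻¹ * √(w n)) •
      diag (fun m => (√(μ m / w m) : ℂ)) (x l - stdVec n) with hρ
    have hdec : ((√(μ n))⁻¹ : ℂ) • ζ - stdVec n = (β - 1) • stdVec n + β • ρ := by
      have h1 : ((√(μ n) : ℂ)⁻¹ * √(w n)) • diag (fun m => (√(μ m / w m) : ℂ)) (stdVec n) =
          stdVec n := by
        rw [diag_stdVec hθ, smul_smul, Real.sqrt_div hμn.le, Complex.ofReal_div]
        rw [show (√(μ n) : ℂ)⁻¹ * √(w n) * (√(μ n) / √(w n)) = 1 by field_simp, one_smul]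
      rw [hρ, map_sub, smul_sub, h1, hζ, map_smul]
      module
    -- The pointwise bound `3 p_m p_n` is summed against the energy weights `μ m / w m`.
    have hρn : ‖ρ‖ ≤ 3 * √Q := by
      refine norm_le_of_apply_le (q := fun m => p n * √(w n / μ n) * (√(μ m / w m) * p m))
        (Real.sqrt_nonneg _) (by norm_num) ?_ fun m => ?_
      · rw [Real.sq_sqrt hQ0]
        have h1 := hS.mul_left (p n ^ 2 * w n / μ n)
        refine h1.congr_fun fun m => ?_
        rw [mul_pow, mul_pow, mul_pow, Real.sq_sqrt (div_nonneg hwn.le hμn.le),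
          Real.sq_sqrt (div_nonneg (h.mu_pos m).le (hK.w_pos m).le)]
        ring
      · change ‖((√(μ n) : ℂ)⁻¹ * √(w n)) * diag _ (x l - stdVec n) m‖ ≤ _
        rw [diag_apply hθ, norm_mul, norm_mul, norm_mul, norm_inv]
        simp only [Complex.norm_real, Real.norm_of_nonneg (Real.sqrt_nonneg _)]
        have h1 := hK.norm_reducedVec_sub_apply_le hlZ m
        rw [Real.sqrt_div hwn.le]
        calc (√(μ n))⁻¹ * √(w n) * (√(μ m / w m) * ‖(x l - stdVec n) m‖) ≤
            (√(μ n))⁻¹ * √(w n) * (√(μ m / w m) * (3 * (p m * p n))) := by gcongr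
          _ = _ := by ring
    -- The constant is `28 + 4 * 3 = 40`, from `‖β - 1‖ ≤ 28 p_n²`, `‖β‖ ≤ 4` and `‖ρ‖ ≤ 3 √Q`.
    rw [hdec]
    refine (norm_add_le _ _).trans ?_
    rw [norm_smul, norm_smul, norm_stdVec]
    nlinarith [norm_nonneg β, norm_nonneg ρ]

end SingleIndex

/-! ### Real inequalities -/

theorem rpow_le_two_rpow_abs_mul {a X : ℝ} (t : ℝ) (ha : 0 < a) (h1 : a ≤ X) (h2 : X ≤ 2 * a) :
    a ^ t ≤ 2 ^ |t| * X ^ t := by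
  have hX : 0 < X := ha.trans_le h1
  rcases le_total 0 t with ht | ht
  · rw [abs_of_nonneg ht]
    calc a ^ t ≤ X ^ t := Real.rpow_le_rpow ha.le h1 ht
      _ ≤ 2 ^ t * X ^ t := le_mul_of_one_le_left (by positivity)
          (Real.one_le_rpow one_le_two ht)
  · rw [abs_of_nonpos ht]
    calc a ^ t = 2 ^ (-t) * (2 * a) ^ t := by
          rw [Real.mul_rpow zero_le_two ha.le, ← mul_assoc, ← Real.rpow_add two_pos]
          simp
      _ ≤ 2 ^ (-t) * X ^ t := by
          exact mul_le_mul_of_nonneg_left (Real.rpow_le_rpow_of_nonpos hX h2 ht) (by positivity)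

/-- Bernoulli's inequality, based at `k` if `γ ≤ 1` and at `k + 1` if `γ ≥ 1`. It bounds each
assumed gap below by a difference of `γ`-th powers, which telescopes. -/
theorem rpow_sub_rpow_le {γ : ℝ} (hγ : 0 < γ) {k : ℝ} (hk : 1 ≤ k) :
    (k + 1) ^ γ - k ^ γ ≤ γ * 2 ^ |γ - 1| * k ^ (γ - 1) := by
  have hk0 : 0 < k := by linarith
  have hk1 : 0 < k + 1 := by linarith
  rcases le_total γ 1 with h1 | h1
  · have hb := rpow_one_add_le_one_add_mul_self (s := 1 / k) (p := γ)
      (by have : (0 : ℝ) ≤ 1 / k := by positivity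
          linarith) hγ.le h1
    have e1 : (k + 1) ^ γ = k ^ γ * (1 + 1 / k) ^ γ := by
      rw [← Real.mul_rpow hk0.le (by positivity)]
      congr 1
      field_simp
    have e2 : k ^ γ = k ^ (γ - 1) * k := by
      rw [← Real.rpow_add_one hk0.ne']
      simp
    have h3 : (1 : ℝ) ≤ 2 ^ |γ - 1| := Real.one_le_rpow one_le_two (abs_nonneg _)
    have h4 : 0 < k ^ (γ - 1) := by positivity
    calc (k + 1) ^ γ - k ^ γ ≤ k ^ γ * (1 + γ * (1 / k)) - k ^ γ := by
          rw [e1]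
          gcongr
      _ = γ * 1 * k ^ (γ - 1) := by
          rw [e2]
          field_simp
          ring
      _ ≤ _ := by gcongr
  · have hb := one_add_mul_self_le_rpow_one_add (s := -(1 / (k + 1))) (p := γ)
      (by rw [neg_le_neg_iff, div_le_one hk1]; linarith) h1
    have e1 : k ^ γ = (k + 1) ^ γ * (1 + -(1 / (k + 1))) ^ γ := by
      have : (0 : ℝ) ≤ 1 + -(1 / (k + 1)) := by
        have : 1 / (k + 1) ≤ 1 := by rw [div_le_one hk1]; linarith
        linarith
      rw [← Real.mul_rpow hk1.le this]
      congr 1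
      field_simp
      ring
    have e2 : (k + 1) ^ γ = (k + 1) ^ (γ - 1) * (k + 1) := by
      rw [← Real.rpow_add_one hk1.ne']
      simp
    have h2 : (k + 1) ^ (γ - 1) ≤ 2 ^ |γ - 1| * k ^ (γ - 1) := by
      rw [abs_of_nonneg (by linarith), ← Real.mul_rpow zero_le_two hk0.le]
      exact Real.rpow_le_rpow hk1.le (by linarith) (by linarith)
    calc (k + 1) ^ γ - k ^ γ ≤ (k + 1) ^ γ - (k + 1) ^ γ * (1 + γ * -(1 / (k + 1))) := by
          rw [e1]
          gcongr
      _ = γ * (k + 1) ^ (γ - 1) := by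
          rw [e2]
          field_simp
          ring
      _ ≤ _ := by
          rw [mul_assoc]
          gcongr

theorem mul_rpow_le_rpow_sub_rpow {γ : ℝ} (hγ : 0 < γ) {a b : ℝ} (ha : 0 < a) (hab : a ≤ b) :
    min 1 γ * ((b - a) * b ^ (γ - 1)) ≤ b ^ γ - a ^ γ := by
  have hb : 0 < b := ha.trans_le hab
  have e2 : ∀ c : ℝ, 0 < c → c ^ γ = c ^ (γ - 1) * c := fun c hc => by
    rw [← Real.rpow_add_one hc.ne']
    simp
  rcases le_total γ 1 with h1 | h1
  · rw [min_eq_right h1]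
    have hs : -1 ≤ -((b - a) / b) := by
      rw [neg_le_neg_iff, div_le_one hb]
      linarith
    have hB := rpow_one_add_le_one_add_mul_self (s := -((b - a) / b)) (p := γ) hs hγ.le h1
    have e1 : a ^ γ = b ^ γ * (1 + -((b - a) / b)) ^ γ := by
      rw [← Real.mul_rpow hb.le (by linarith)]
      congr 1
      field_simp
      ring
    have h2 : a ^ γ ≤ b ^ γ * (1 + γ * -((b - a) / b)) := by
      rw [e1]
      gcongr
    have h3 : b ^ γ * (1 + γ * -((b - a) / b)) = b ^ γ - γ * ((b - a) * b ^ (γ - 1)) := by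
      rw [e2 b hb]
      field_simp
      ring
    linarith
  · rw [min_eq_left h1, e2 b hb, e2 a ha]
    have := Real.rpow_le_rpow ha.le hab (show 0 ≤ γ - 1 by linarith)
    nlinarith

/-- For `|a - b| ≤ a`, `a` is comparable with the maximum, and the surplus `2δ` is shared between
`b` and `|a - b|`. Otherwise `a < b ≤ 2 |a - b|`, and `a ^ (γ - δ)` is raised to `b ^ (γ - δ)`; this
uses `γ - δ ≥ 0`, which follows from `s ≤ 1`. -/
theorem rpow_neg_le_first {s γ δ : ℝ} (hs : s ≤ 1) (hδ : 0 < δ) (hsγ : s + γ = 1 + 2 * δ) {a b : ℝ}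
    (ha : 1 ≤ a) (hb : 1 ≤ b) (hab : 1 ≤ |a - b|) :
    a ^ (-s) ≤ (2 ^ |s| + 2) * (b ^ (-δ) * (|a - b| ^ (-(1 + δ)) + a ^ (-(1 + δ)))) *
      (|a - b| * max b a ^ (γ - 1)) := by
  have ha0 : 0 < a := by linarith
  have hb0 : 0 < b := by linarith
  set D := |a - b| with hD
  have hD0 : 0 < D := by linarith
  set X := max b a with hX
  have haX : a ≤ X := le_max_right _ _
  have hbX : b ≤ X := le_max_left _ _
  have hX0 : 0 < X := by linarith
  have h2s : (0 : ℝ) < 2 ^ |s| := by positivity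
  rcases le_or_gt D a with h | h
  · have hX2 : X ≤ 2 * a := max_le (by have := neg_abs_le (a - b); linarith) (by linarith)
    have h1 := rpow_le_two_rpow_abs_mul (-s) ha0 haX hX2
    rw [abs_neg] at h1
    have hDX : D ≤ X := h.trans haX
    have e1 : X ^ (-s) = X ^ (-δ) * X ^ (-δ) * X ^ (γ - 1) := by
      rw [← Real.rpow_add hX0, ← Real.rpow_add hX0]
      congr 1
      linarith
    have e2 : D ^ (-δ) = D ^ (-(1 + δ)) * D := by
      rw [← Real.rpow_add_one hD0.ne']
      congr 1
      ring
    have h3 : X ^ (-δ) ≤ b ^ (-δ) := Real.rpow_le_rpow_of_nonpos hb0 hbX (by linarith)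
    have h4 : X ^ (-δ) ≤ D ^ (-δ) := Real.rpow_le_rpow_of_nonpos hD0 hDX (by linarith)
    calc a ^ (-s) ≤ 2 ^ |s| * X ^ (-s) := h1
      _ ≤ 2 ^ |s| * (b ^ (-δ) * D ^ (-δ) * X ^ (γ - 1)) := by
          rw [e1]
          gcongr
      _ = 2 ^ |s| * (b ^ (-δ) * (D ^ (-(1 + δ)) + 0)) * (D * X ^ (γ - 1)) := by
          rw [e2]
          ring
      _ ≤ _ := by
          gcongr
          · linarith
          · positivity
  · have hab' : a < b := by
      by_contra! hba
      rw [hD, abs_of_nonneg (by linarith)] at h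
      linarith
    have hDe : D = b - a := by rw [hD, abs_of_neg (by linarith)]; ring
    have hXb : X = b := max_eq_left hab'.le
    have h1 : a ^ (γ - δ) ≤ b ^ (γ - δ) := Real.rpow_le_rpow ha0.le hab'.le (by linarith)
    have e1 : a ^ (-s) = a ^ (-(1 + δ)) * a ^ (γ - δ) := by
      rw [← Real.rpow_add ha0]
      congr 1
      linarith
    have e2 : b ^ (γ - δ) = b ^ (-δ) * (b * b ^ (γ - 1)) := by
      rw [← Real.rpow_one_add' hb0.le (by linarith), ← Real.rpow_add hb0]
      congr 1
      ring
    have h3 : b ≤ 2 * D := by rw [hDe]; linarith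
    calc a ^ (-s) ≤ a ^ (-(1 + δ)) * b ^ (γ - δ) := by
          rw [e1]
          gcongr
      _ ≤ a ^ (-(1 + δ)) * (b ^ (-δ) * (2 * D * b ^ (γ - 1))) := by
          rw [e2]
          gcongr
      _ = (0 + 2) * (b ^ (-δ) * (0 + a ^ (-(1 + δ)))) * (D * b ^ (γ - 1)) := by ring
      _ ≤ _ := by
          rw [hXb]
          gcongr
          positivity

/-- If `b ≤ 2a`, all powers of `a` become powers of `b`, with total exponent `-(1 + 2δ)`. If `b >
2a`, then `b - a ≥ b / 2`, and the excess power of `b` has exponent `-1/2 - γ < 0` and may be moved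
to `a`. -/
theorem rpow_neg_mul_le_of_lt {s γ δ : ℝ} (hγ : 0 < γ) (hδ : 0 < δ)
    (hsγ : s + γ = 3 / 2 + δ) {a b : ℝ} (ha : 1 ≤ a) (hab : 1 ≤ b - a) :
    a ^ (-s) * b ^ (-s) * ((b - a) * b ^ (γ - 1)) ^ (-2 : ℝ) ≤
      (2 ^ |s| + 4) * (b ^ (-(1 + δ)) * ((b - a) ^ (-2 : ℝ) + a ^ (-(1 + δ)))) := by
  have ha0 : 0 < a := by linarith
  have hb0 : 0 < b := by linarith
  have hD0 : 0 < b - a := by linarith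
  set D := b - a with hD
  have h2s : (0 : ℝ) < 2 ^ |s| := by positivity
  rw [Real.mul_rpow hD0.le (by positivity), ← Real.rpow_mul hb0.le]
  rcases le_or_gt b (2 * a) with h | h
  · have h1 := rpow_le_two_rpow_abs_mul (-s) ha0 (by linarith) h
    rw [abs_neg] at h1
    have h2 : b ^ (-s) * b ^ (-s) * b ^ ((γ - 1) * -2) ≤ b ^ (-(1 + δ)) := by
      rw [← Real.rpow_add hb0, ← Real.rpow_add hb0]
      exact Real.rpow_le_rpow_of_exponent_le (by linarith) (by linarith)
    calc a ^ (-s) * b ^ (-s) * (D ^ (-2 : ℝ) * b ^ ((γ - 1) * -2)) ≤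
        2 ^ |s| * b ^ (-s) * b ^ (-s) * (D ^ (-2 : ℝ) * b ^ ((γ - 1) * -2)) := by gcongr
      _ = 2 ^ |s| * D ^ (-2 : ℝ) * (b ^ (-s) * b ^ (-s) * b ^ ((γ - 1) * -2)) := by ring
      _ ≤ 2 ^ |s| * D ^ (-2 : ℝ) * b ^ (-(1 + δ)) := by gcongr
      _ = (2 ^ |s| + 0) * (b ^ (-(1 + δ)) * (D ^ (-2 : ℝ) + 0)) := by ring
      _ ≤ _ := by
          gcongr
          · norm_num
          · positivity
  · have h1 : D ^ (-2 : ℝ) ≤ 4 * b ^ (-2 : ℝ) := by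
      have : D ^ (-2 : ℝ) ≤ (b / 2) ^ (-2 : ℝ) :=
        Real.rpow_le_rpow_of_nonpos (by linarith) (by linarith) (by norm_num)
      refine this.trans_eq ?_
      rw [Real.rpow_neg (by positivity), Real.rpow_neg hb0.le, Real.rpow_two, Real.rpow_two]
      field_simp
      norm_num
    have h2 : b ^ (-s) * b ^ (-2 : ℝ) * b ^ ((γ - 1) * -2) =
        b ^ (-(1 + δ)) * b ^ (1 + δ - s - 2 * γ) := by
      rw [← Real.rpow_add hb0, ← Real.rpow_add hb0, ← Real.rpow_add hb0]
      congr 1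
      ring
    have h3 : b ^ (1 + δ - s - 2 * γ) ≤ a ^ (1 + δ - s - 2 * γ) :=
      Real.rpow_le_rpow_of_nonpos ha0 (by linarith) (by linarith)
    have h4 : a ^ (-s) * a ^ (1 + δ - s - 2 * γ) ≤ a ^ (-(1 + δ)) := by
      rw [← Real.rpow_add ha0]
      exact Real.rpow_le_rpow_of_exponent_le ha (by linarith)
    calc a ^ (-s) * b ^ (-s) * (D ^ (-2 : ℝ) * b ^ ((γ - 1) * -2)) ≤
        a ^ (-s) * b ^ (-s) * (4 * b ^ (-2 : ℝ) * b ^ ((γ - 1) * -2)) := by gcongr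
      _ = 4 * a ^ (-s) * (b ^ (-s) * b ^ (-2 : ℝ) * b ^ ((γ - 1) * -2)) := by ring
      _ ≤ 4 * a ^ (-s) * (b ^ (-(1 + δ)) * a ^ (1 + δ - s - 2 * γ)) := by
          rw [h2]
          gcongr
      _ = 4 * b ^ (-(1 + δ)) * (a ^ (-s) * a ^ (1 + δ - s - 2 * γ)) := by ring
      _ ≤ 4 * b ^ (-(1 + δ)) * a ^ (-(1 + δ)) := by gcongr
      _ = (0 + 4) * (b ^ (-(1 + δ)) * (0 + a ^ (-(1 + δ)))) := by ring
      _ ≤ _ := by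
          gcongr
          positivity

theorem rpow_neg_mul_le {s γ δ : ℝ} (hγ : 0 < γ) (hδ : 0 < δ)
    (hsγ : s + γ = 3 / 2 + δ) {a b : ℝ} (ha : 1 ≤ a) (hb : 1 ≤ b) (hab : 1 ≤ |a - b|) :
    a ^ (-s) * b ^ (-s) * (|a - b| * max b a ^ (γ - 1)) ^ (-2 : ℝ) ≤
      (2 ^ |s| + 4) * (b ^ (-(1 + δ)) * (|a - b| ^ (-2 : ℝ) + a ^ (-(1 + δ)))) := by
  have ha0 : 0 < a := by linarith
  have hb0 : 0 < b := by linarith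
  rcases le_total a b with h | h
  · have e : |a - b| = b - a := by rw [abs_of_nonpos (by linarith)]; ring
    rw [e, max_eq_left h]
    exact rpow_neg_mul_le_of_lt hγ hδ hsγ ha (e ▸ hab)
  · have e : |a - b| = a - b := abs_of_nonneg (by linarith)
    rw [e, max_eq_right h]
    have h1 := rpow_neg_mul_le_of_lt hγ hδ hsγ hb (e ▸ hab)
    have h2 : a ^ (-(1 + δ)) ≤ b ^ (-(1 + δ)) := Real.rpow_le_rpow_of_nonpos hb0 h (by linarith)
    have hD0 : 0 ≤ a - b := by linarith
    calc _ = b ^ (-s) * a ^ (-s) * ((a - b) * a ^ (γ - 1)) ^ (-2 : ℝ) := by ring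
      _ ≤ _ := h1
      _ = (2 ^ |s| + 4) * (a ^ (-(1 + δ)) * (a - b) ^ (-2 : ℝ) + b ^ (-(1 + δ)) * a ^ (-(1 + δ))) := by
          ring
      _ ≤ (2 ^ |s| + 4) * (b ^ (-(1 + δ)) * (a - b) ^ (-2 : ℝ) + b ^ (-(1 + δ)) * a ^ (-(1 + δ))) := by
          gcongr
      _ = _ := by ring

/-- Uniform bound for the sums that dominate the perturbation. -/
theorem exists_uniform_sum {f g : ℝ} (hf : 1 < f) (hg : 1 < g) :
    ∃ T : ℝ, 0 ≤ T ∧ ∀ n : ℕ,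
      Summable (fun m : ℕ => |(m + 1 : ℝ) - (n + 1)| ^ (-f) + (m + 1 : ℝ) ^ (-g)) ∧
      ∑' m : ℕ, (|(m + 1 : ℝ) - (n + 1)| ^ (-f) + (m + 1 : ℝ) ^ (-g)) ≤ T := by
  -- Shifting the summation into `ℤ` makes the bound independent of `n`. The term `m = n` is `0 ^
  -- (-f) = 0` by convention.
  have h1 := Real.summable_abs_int_rpow hf
  have h2 : Summable fun m : ℕ => (m + 1 : ℝ) ^ (-g) := by
    have := (summable_nat_add_iff 1).2 (Real.summable_nat_rpow.2 (show -g < -1 by linarith))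
    simpa using this
  have hinj : ∀ n : ℕ, Function.Injective fun m : ℕ => (m : ℤ) - n := fun n x y hxy => by
    simpa using hxy
  have e : ∀ n m : ℕ, |(m + 1 : ℝ) - (n + 1)| ^ (-f) = |(((m : ℤ) - n : ℤ) : ℝ)| ^ (-f) := by
    intro n m
    push_cast
    congr 2
    ring
  have h3 : ∀ n : ℕ, Summable fun m : ℕ => |(m + 1 : ℝ) - (n + 1)| ^ (-f) := fun n => by
    simp only [e]
    exact h1.comp_injective (hinj n)
  refine ⟨∑' k : ℤ, |(k : ℝ)| ^ (-f) + ∑' m : ℕ, (m + 1 : ℝ) ^ (-g), ?_, fun n => ⟨(h3 n).add h2, ?_⟩⟩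
  · exact add_nonneg (tsum_nonneg fun k => by positivity) (tsum_nonneg fun k => by positivity)
  · rw [(h3 n).tsum_add h2]
    gcongr
    simp only [e]
    exact tsum_comp_le_tsum_of_inj h1 (fun k => by positivity) (hinj n)

/-! ### Separated eigenvalues -/

theorem exists_pos_le_of_separated {μ : ℕ → ℝ} (hμ : ∀ k, 0 < μ k) {N₀ : ℕ}
    (hmono : ∀ k ≥ N₀, μ k ≤ μ (k + 1)) : ∃ c > 0, ∀ k, c ≤ μ k := by
  obtain ⟨k₀, -, hk₀⟩ := Finset.exists_min_image (Finset.range (N₀ + 1)) μ ⟨0, by simp⟩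
  refine ⟨μ k₀, hμ _, fun k => ?_⟩
  rcases le_or_gt k N₀ with h | h
  · exact hk₀ k (by simpa using Nat.lt_succ_of_le h)
  · refine (hk₀ N₀ (by simp)).trans ?_
    induction k, h.le using Nat.le_induction with
    | base => exact le_rfl
    | succ k hk ih =>
      rcases hk.eq_or_lt with h' | h'
      · subst h'; exact hmono _ le_rfl
      · exact (ih h').trans (hmono k hk)

/-- From `N₀` on, the gaps telescope to differences of `γ`-th powers. The finitely many earlier
eigenvalues, which need not be ordered, are bounded by `A`, and for large `n` they lie below `μ n`
by at least `c₀/2 (n+1)^γ`. -/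
theorem exists_separation {μ : ℕ → ℝ} {γ κ : ℝ} (hγ : 0 < γ) (hκ : 0 < κ) {N₀ : ℕ}
    (hsep : ∀ k ≥ N₀, κ * ((k : ℝ) + 1) ^ (γ - 1) ≤ μ (k + 1) - μ k) :
    ∃ c > 0, ∃ N ≥ N₀, ∀ n ≥ N, c * ((n : ℝ) + 1) ^ γ ≤ μ n ∧ (∀ m ≤ n, μ m ≤ μ n) ∧
      ∀ m, m ≠ n → c * (|(m + 1 : ℝ) - (n + 1)| * max ((n : ℝ) + 1) (m + 1) ^ (γ - 1)) ≤
        |μ n - μ m| := by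
  set c₀ := κ / (γ * 2 ^ |γ - 1|) with hc₀
  have h2 : (0 : ℝ) < 2 ^ |γ - 1| := by positivity
  have hc₀0 : 0 < c₀ := by positivity
  have hstep : ∀ k ≥ N₀, c₀ * ((((k + 1 : ℕ) : ℝ) + 1) ^ γ - ((k : ℝ) + 1) ^ γ) ≤
      μ (k + 1) - μ k := fun k hk => by
    refine le_trans ?_ (hsep k hk)
    have h3 := rpow_sub_rpow_le hγ (k := (k : ℝ) + 1) (by simp)
    push_cast
    calc _ ≤ c₀ * (γ * 2 ^ |γ - 1| * ((k : ℝ) + 1) ^ (γ - 1)) := by gcongr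
      _ = _ := by rw [hc₀]; field_simp
  have hdiff : ∀ m ≥ N₀, ∀ n ≥ m, c₀ * (((n : ℝ) + 1) ^ γ - ((m : ℝ) + 1) ^ γ) ≤ μ n - μ m := by
    intro m hm n hn
    induction n, hn using Nat.le_induction with
    | base => simp
    | succ n hn ih =>
      have := hstep n (hm.trans hn)
      push_cast at this ⊢
      nlinarith
  have hmono : ∀ m ≥ N₀, ∀ n ≥ m, μ m ≤ μ n := fun m hm n hn => by
    have h3 := hdiff m hm n hn
    have h4 : ((m : ℝ) + 1) ^ γ ≤ ((n : ℝ) + 1) ^ γ :=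
      Real.rpow_le_rpow (by positivity) (by gcongr) hγ.le
    nlinarith
  obtain ⟨k₁, -, hk₁⟩ := Finset.exists_max_image (Finset.range (N₀ + 1)) μ ⟨0, by simp⟩
  set A := |μ k₁| with hA
  have hev : ∀ᶠ n : ℕ in atTop, A + c₀ * ((N₀ : ℝ) + 1) ^ γ - μ N₀ ≤
      c₀ / 2 * ((n : ℝ) + 1) ^ γ := by
    have h3 : Tendsto (fun n : ℕ => c₀ / 2 * ((n : ℝ) + 1) ^ γ) atTop atTop :=
      ((tendsto_rpow_atTop hγ).comp
        (tendsto_atTop_add_const_right _ _ tendsto_natCast_atTop_atTop)).const_mul_atTop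
        (by positivity)
    exact h3.eventually_ge_atTop _
  obtain ⟨N, hN⟩ := eventually_atTop.1 hev
  have hlow : ∀ n ≥ max N N₀, A + c₀ / 2 * ((n : ℝ) + 1) ^ γ ≤ μ n := fun n hn => by
    have h3 := hN n (le_of_max_le_left hn)
    have h4 := hdiff N₀ le_rfl n (le_of_max_le_right hn)
    linarith
  have hsmall : ∀ m < N₀, μ m ≤ A := fun m hm =>
    (hk₁ m (by simp; omega)).trans (le_abs_self _)
  have hmin : 0 < min 1 γ := lt_min one_pos hγ
  have hfar : ∀ m ≥ N₀, ∀ n ≥ m, c₀ / 2 * min 1 γ *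
      (((n : ℝ) + 1 - (m + 1)) * ((n : ℝ) + 1) ^ (γ - 1)) ≤ μ n - μ m := fun m hm n hn => by
    have h3 := hdiff m hm n hn
    have h4 := mul_rpow_le_rpow_sub_rpow hγ (a := (m : ℝ) + 1) (b := (n : ℝ) + 1)
      (by positivity) (by gcongr)
    have h5 : 0 ≤ ((n : ℝ) + 1 - (m + 1)) * ((n : ℝ) + 1) ^ (γ - 1) := by
      have : (m : ℝ) ≤ n := by exact_mod_cast hn
      apply mul_nonneg
      · linarith
      · positivity
    nlinarith [mul_nonneg hmin.le h5]
  refine ⟨c₀ / 2 * min 1 γ, by positivity, max N N₀, le_max_right _ _, fun n hn => ⟨?_, ?_, ?_⟩⟩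
  · have h3 := hlow n hn
    have h4 : 0 ≤ A := abs_nonneg _
    have h5 : 0 < ((n : ℝ) + 1) ^ γ := by positivity
    have h6 : min 1 γ ≤ 1 := min_le_left _ _
    nlinarith [mul_pos hc₀0 h5]
  · intro m hm
    rcases lt_or_ge m N₀ with h | h
    · have h3 := hlow n hn
      have h5 : 0 < ((n : ℝ) + 1) ^ γ := by positivity
      nlinarith [hsmall m h, mul_pos hc₀0 h5]
    · exact hmono m h n hm
  · intro m hmn
    rcases lt_or_gt_of_ne hmn with hm | hm
    · have hmR : (m : ℝ) < n := by exact_mod_cast hm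
      rw [abs_of_nonpos (by linarith), max_eq_left (by linarith), neg_sub]
      refine le_trans ?_ (le_abs_self _)
      rcases lt_or_ge m N₀ with h | h
      · have h3 := hlow n hn
        have h4 := hsmall m h
        have e2 : ((n : ℝ) + 1) ^ γ = ((n : ℝ) + 1) * ((n : ℝ) + 1) ^ (γ - 1) := by
          rw [← Real.rpow_one_add' (by positivity) (by linarith)]
          simp
        have h5 : 0 < ((n : ℝ) + 1) ^ (γ - 1) := by positivity
        have h6 : min 1 γ ≤ 1 := min_le_left _ _
        calc c₀ / 2 * min 1 γ * (((n : ℝ) + 1 - (m + 1)) * ((n : ℝ) + 1) ^ (γ - 1))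
            ≤ c₀ / 2 * 1 * (((n : ℝ) + 1) * ((n : ℝ) + 1) ^ (γ - 1)) := by
              have : (0 : ℝ) ≤ (n : ℝ) + 1 - (m + 1) := by linarith
              gcongr
              have : (0 : ℝ) ≤ m := by positivity
              linarith
          _ ≤ _ := by
              rw [mul_one, ← e2]
              linarith
      · exact hfar m h n hm.le
    · have hmR : (n : ℝ) < m := by exact_mod_cast hm
      rw [abs_of_nonneg (by linarith), max_eq_right (by linarith)]
      rw [abs_sub_comm]
      exact (hfar n (le_of_max_le_right hn) m hm.le).trans (le_abs_self _)

/-! ### Weighted sums over separated eigenvalues -/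

/-- The distances of the eigenvalues from the `n`-th one, and a gap size for the `n`-th one. -/
def weight (μ : ℕ → ℝ) (κ γ : ℝ) (n m : ℕ) : ℝ :=
  if m = n then κ * ((n : ℝ) + 1) ^ (γ - 1) else |μ n - μ m|

/-- Positive eigenvalues that are separated from the index `N` on. -/
structure IsSeparated (μ : ℕ → ℝ) (κ γ c : ℝ) (N : ℕ) : Prop where
  gamma_pos : 0 < γ
  kappa_pos : 0 < κ
  c_pos : 0 < c
  pos : ∀ k, 0 < μ k
  bdd : ∃ c > 0, ∀ k, c ≤ μ k
  step : ∀ k ≥ N, κ * ((k : ℝ) + 1) ^ (γ - 1) ≤ μ (k + 1) - μ k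
  lower : ∀ n ≥ N, c * ((n : ℝ) + 1) ^ γ ≤ μ n
  mono : ∀ n ≥ N, ∀ m ≤ n, μ m ≤ μ n
  sep : ∀ n ≥ N, ∀ m, m ≠ n →
    c * (|(m + 1 : ℝ) - (n + 1)| * max ((n : ℝ) + 1) (m + 1) ^ (γ - 1)) ≤ |μ n - μ m|

theorem one_le_abs_sub {m n : ℕ} (h : m ≠ n) : (1 : ℝ) ≤ |(m + 1 : ℝ) - (n + 1)| := by
  have h1 : (1 : ℤ) ≤ |(m : ℤ) - n| := Int.one_le_abs (sub_ne_zero.2 (by exact_mod_cast h))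
  have h2 : (1 : ℝ) ≤ |(m : ℝ) - n| := by exact_mod_cast h1
  rwa [add_sub_add_right_eq_sub]

/-- The sums controlling the distance of the perturbed from the unperturbed eigenvectors. -/
def errorSum (μ : ℕ → ℝ) (κ γ s : ℝ) (n : ℕ) : ℝ :=
  ((n : ℝ) + 1) ^ (-s) / μ n * ∑' m : ℕ, μ m * ((m : ℝ) + 1) ^ (-s) / weight μ κ γ n m ^ 2

theorem weight_self (μ : ℕ → ℝ) (κ γ : ℝ) (n : ℕ) : weight μ κ γ n n = κ * ((n : ℝ) + 1) ^ (γ - 1) := if_pos rfl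

theorem rpow_succ_le (γ : ℝ) {n : ℕ} (hn : 1 ≤ n) :
    ((n : ℝ) + 1) ^ (γ - 1) ≤ 2 ^ |γ - 1| * (n : ℝ) ^ (γ - 1) := by
  have hn1 : (1 : ℝ) ≤ n := by exact_mod_cast hn
  have h1 := rpow_le_two_rpow_abs_mul (a := (n : ℝ)) (X := (n : ℝ) + 1) (-(γ - 1))
    (by linarith) (by linarith) (by linarith)
  rw [abs_neg, Real.rpow_neg (by linarith), Real.rpow_neg (by linarith)] at h1
  have h2 : 0 < (n : ℝ) ^ (γ - 1) := by positivity
  have h3 : 0 < ((n : ℝ) + 1) ^ (γ - 1) := by positivity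
  rw [← div_eq_mul_inv, inv_eq_one_div, div_le_div_iff₀ h2 h3] at h1
  linarith

theorem tendsto_rpow_neg {δ : ℝ} (hδ : 0 < δ) :
    Tendsto (fun n : ℕ => ((n : ℝ) + 1) ^ (-δ)) atTop (𝓝 0) :=
  (tendsto_rpow_neg_atTop hδ).comp
    (tendsto_atTop_add_const_right _ _ tendsto_natCast_atTop_atTop)

theorem summable_rpow_neg {f : ℝ} (hf : 1 < f) : Summable fun n : ℕ => ((n : ℝ) + 1) ^ (-f) := by
  have := (summable_nat_add_iff 1).2 (Real.summable_nat_rpow.2 (show -f < -1 by linarith))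
  simpa using this

namespace IsSeparated

variable {μ : ℕ → ℝ} {κ γ c : ℝ} {N : ℕ} (h : IsSeparated μ κ γ c N)
include h

theorem weight_self_pos (n : ℕ) : 0 < weight μ κ γ n n := by
  have := h.kappa_pos
  rw [weight_self]
  positivity

theorem sep_weight {n : ℕ} (hn : N ≤ n) {m : ℕ} (hm : m ≠ n) :
    c * (|(m + 1 : ℝ) - (n + 1)| * max ((n : ℝ) + 1) (m + 1) ^ (γ - 1)) ≤ weight μ κ γ n m := by
  rw [weight, if_neg hm]
  exact h.sep n hn m hm

theorem weight_pos {n : ℕ} (hn : N ≤ n) (m : ℕ) : 0 < weight μ κ γ n m := by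
  by_cases hm : m = n
  · rw [hm]; exact h.weight_self_pos n
  · refine lt_of_lt_of_le ?_ (h.sep_weight hn hm)
    have := h.c_pos
    have := one_le_abs_sub hm
    positivity

theorem gap_below {n : ℕ} (hn : N + 1 ≤ n) {m : ℕ} (hm : m < n) :
    κ * (n : ℝ) ^ (γ - 1) ≤ μ n - μ m := by
  obtain ⟨k, rfl⟩ : ∃ k, n = k + 1 := ⟨n - 1, by omega⟩
  have h1 := h.step k (by omega)
  have h2 := h.mono k (by omega) m (by omega)
  push_cast
  linarith

theorem gap_above {n : ℕ} (hn : N ≤ n) {m : ℕ} (hm : n < m) :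
    κ * ((n : ℝ) + 1) ^ (γ - 1) ≤ μ m - μ n := by
  have h1 := h.step n hn
  have h2 := h.mono m (by omega) (n + 1) (by omega)
  linarith

/-- Up to a constant the `n`-th weight is the smallest. The constant is due to the gap below `μ n`,
which is only `κ n^(γ-1)` instead of `κ (n+1)^(γ-1)`. -/
theorem weight_self_le {n : ℕ} (hn : N + 1 ≤ n) (m : ℕ) :
    weight μ κ γ n n ≤ 2 ^ |γ - 1| * weight μ κ γ n m := by
  have hC : (1 : ℝ) ≤ 2 ^ |γ - 1| := Real.one_le_rpow one_le_two (abs_nonneg _)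
  have hκ := h.kappa_pos
  by_cases hm : m = n
  · rw [hm]
    exact le_mul_of_one_le_left (h.weight_self_pos n).le hC
  · have hw := h.weight_pos (by omega : N ≤ n) m
    rw [weight_self]
    rw [weight, if_neg hm] at hw ⊢
    rcases lt_or_gt_of_ne hm with hlt | hlt
    · have h1 := h.gap_below hn hlt
      have h2 := rpow_succ_le γ (by omega : 1 ≤ n)
      have h3 := le_abs_self (μ n - μ m)
      calc κ * ((n : ℝ) + 1) ^ (γ - 1) ≤ κ * (2 ^ |γ - 1| * (n : ℝ) ^ (γ - 1)) := by gcongr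
        _ = 2 ^ |γ - 1| * (κ * (n : ℝ) ^ (γ - 1)) := by ring
        _ ≤ _ := by gcongr; linarith
    · have h1 := h.gap_above (by omega : N ≤ n) hlt
      have h3 := neg_le_abs (μ n - μ m)
      calc κ * ((n : ℝ) + 1) ^ (γ - 1) ≤ |μ n - μ m| := by linarith
        _ ≤ _ := le_mul_of_one_le_left hw.le hC

theorem mu_le_add_weight (n m : ℕ) : μ m ≤ μ n + weight μ κ γ n m := by
  by_cases hm : m = n
  · rw [hm]
    linarith [h.weight_self_pos n]
  · rw [weight, if_neg hm]
    linarith [neg_le_abs (μ n - μ m)]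

/-- Used only to make the rescaling bounded for a fixed `n`, so the constant may depend on `n`. -/
theorem mu_le_mul_weight {n : ℕ} (hn : N + 1 ≤ n) : ∃ C, ∀ m, μ m ≤ C * weight μ κ γ n m := by
  refine ⟨μ n * 2 ^ |γ - 1| / weight μ κ γ n n + 1, fun m => ?_⟩
  have h1 := h.mu_le_add_weight n m
  have h2 := h.weight_self_le hn m
  have h3 := h.weight_self_pos n
  have h4 : μ n ≤ μ n * 2 ^ |γ - 1| / weight μ κ γ n n * weight μ κ γ n m := by
    rw [div_mul_eq_mul_div, le_div_iff₀ h3, mul_assoc]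
    exact mul_le_mul_of_nonneg_left h2 (h.pos n).le
  linarith

theorem weight_le_mul_mu (n : ℕ) : ∃ C, ∀ m, weight μ κ γ n m ≤ C * μ m := by
  obtain ⟨c', hc', hb⟩ := h.bdd
  refine ⟨max (weight μ κ γ n n / μ n) (μ n / c' + 1), fun m => ?_⟩
  have hm0 := h.pos m
  by_cases hm : m = n
  · rw [hm]
    calc weight μ κ γ n n = weight μ κ γ n n / μ n * μ n := by
          field_simp [(h.pos n).ne']
      _ ≤ _ := mul_le_mul_of_nonneg_right (le_max_left _ _) (h.pos n).le
  · rw [weight, if_neg hm]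
    have h1 : |μ n - μ m| ≤ μ n + μ m :=
      abs_le.2 ⟨by linarith [h.pos n], by linarith⟩
    have h2 : μ n ≤ μ n / c' * μ m := by
      rw [div_mul_eq_mul_div, le_div_iff₀ hc']
      exact mul_le_mul_of_nonneg_left (hb m) (h.pos n).le
    calc _ ≤ (μ n / c' + 1) * μ m := by linarith
      _ ≤ _ := mul_le_mul_of_nonneg_right (le_max_right _ _) hm0.le

/-- To each side the rectangle reaches at most half of the gap to the next eigenvalue, so at least
half of the distance to every other one remains. -/
theorem weight_le_two_mul_dist {n : ℕ} (hn : N + 1 ≤ n) {z : ℂ}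
    (hz : z ∈ Set.Icc (lowerCorner μ κ γ n).re (upperCorner μ κ γ n).re ×ℂ
      Set.Icc (lowerCorner μ κ γ n).im (upperCorner μ κ γ n).im) {m : ℕ} (hm : m ≠ n) :
    weight μ κ γ n m ≤ 2 * ‖z - μ m‖ := by
  have h1 : μ n - κ / 2 * (n : ℝ) ^ (γ - 1) ≤ z.re := hz.1.1
  have h2 : z.re ≤ μ n + κ / 2 * ((n : ℝ) + 1) ^ (γ - 1) := hz.1.2
  have h3 := Complex.abs_re_le_norm (z - μ m)
  rw [Complex.sub_re, Complex.ofReal_re] at h3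
  rw [weight, if_neg hm]
  have hκ := h.kappa_pos
  rcases lt_or_gt_of_ne hm with hlt | hlt
  · have h4 := h.gap_below hn hlt
    have h5 := le_abs_self (z.re - μ m)
    have h6 : 0 ≤ κ * (n : ℝ) ^ (γ - 1) := by positivity
    rw [abs_of_nonneg (by linarith)]
    linarith
  · have h4 := h.gap_above (by omega : N ≤ n) hlt
    have h5 := neg_le_abs (z.re - μ m)
    have h6 : 0 ≤ κ * ((n : ℝ) + 1) ^ (γ - 1) := by positivity
    rw [abs_of_nonpos (by linarith)]
    linarith

theorem closedBall_subset_rectangle {n : ℕ} (hn : 1 ≤ n) :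
    Metric.closedBall (μ n : ℂ) (1 / (4 * 2 ^ |γ - 1|) * weight μ κ γ n n) ⊆
      rectangle μ κ γ n := by
  intro z hz
  rw [mem_closedBall_iff_norm] at hz
  have hC : (1 : ℝ) ≤ 2 ^ |γ - 1| := Real.one_le_rpow one_le_two (abs_nonneg _)
  have hκ := h.kappa_pos
  have h1 := (abs_le.1 ((Complex.abs_re_le_norm (z - μ n)).trans hz))
  have h2 := (abs_le.1 ((Complex.abs_im_le_norm (z - μ n)).trans hz))
  simp only [Complex.sub_re, Complex.ofReal_re, Complex.sub_im, Complex.ofReal_im, sub_zero] at h1 h2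
  rw [weight_self] at h1 h2
  have h3 := rpow_succ_le γ hn
  set b := ((n : ℝ) + 1) ^ (γ - 1) with hb
  have hb0 : 0 < b := by positivity
  set C : ℝ := 2 ^ |γ - 1| with hCd
  have h4 : 1 / (4 * C) * (κ * b) ≤ κ / 4 * (n : ℝ) ^ (γ - 1) := by
    rw [one_div_mul_eq_div, div_le_iff₀ (by positivity)]
    calc κ * b ≤ κ * (C * (n : ℝ) ^ (γ - 1)) := by gcongr
      _ = _ := by ring
  have h5 : 1 / (4 * C) * (κ * b) ≤ κ / 4 * b := by
    rw [one_div_mul_eq_div, div_le_iff₀ (by positivity)]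
    calc κ * b = κ * (1 * b) := by ring
      _ ≤ κ * (C * b) := by gcongr
      _ = _ := by ring
  have h6 : 0 < κ * b := by positivity
  have h7 : 0 < κ * (n : ℝ) ^ (γ - 1) := by
    have : (0 : ℝ) < n := by exact_mod_cast hn
    positivity
  refine ⟨?_, ?_, ?_, ?_⟩ <;> simp only [lowerCorner, upperCorner, ← hb] <;> linarith

theorem sum_le_first {s : ℝ} (hs : 1 < s + γ) : ∃ C ≥ (0 : ℝ), ∃ δ > (0 : ℝ), ∀ n ≥ N,
    Summable (fun m : ℕ => ((m : ℝ) + 1) ^ (-s) / weight μ κ γ n m) ∧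
    ∑' m : ℕ, ((m : ℝ) + 1) ^ (-s) / weight μ κ γ n m ≤ C * ((n : ℝ) + 1) ^ (-δ) := by
  -- Lowering `s` to at most `1` only enlarges the terms and gives the form required by
  -- `rpow_neg_le_first`; `s' + γ > 1` survives because `γ > 0`.
  set s' := min s 1 with hs'
  have hs'1 : s' ≤ 1 := min_le_right _ _
  have hs's : s' ≤ s := min_le_left _ _
  have hs'γ : 1 < s' + γ := by
    have := h.gamma_pos
    rcases min_choice s 1 with h1 | h1 <;> rw [hs', h1] <;> linarith
  set δ := (s' + γ - 1) / 2 with hδ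
  have hδ0 : 0 < δ := by rw [hδ]; linarith
  obtain ⟨T, hT0, hT⟩ := exists_uniform_sum (f := 1 + δ) (g := 1 + δ) (by linarith) (by linarith)
  have hc := h.c_pos
  have hκ := h.kappa_pos
  set A : ℝ := (2 ^ |s'| + 2) / c with hA
  have hA0 : 0 < A := by positivity
  refine ⟨A * T + 1 / κ, by positivity, δ, hδ0, fun n hn => ?_⟩
  obtain ⟨hTs, hTn⟩ := hT n
  set F : ℕ → ℝ := fun m => |(m + 1 : ℝ) - (n + 1)| ^ (-(1 + δ)) + (m + 1 : ℝ) ^ (-(1 + δ)) with hF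
  set D : ℕ → ℝ := fun m => if m = n then ((n : ℝ) + 1) ^ (-δ) / κ else 0 with hD
  have hDs : HasSum D (((n : ℝ) + 1) ^ (-δ) / κ) := hasSum_ite_eq n _
  have hF0 : ∀ m, 0 ≤ F m := fun m => by positivity
  have hle : ∀ m : ℕ, ((m : ℝ) + 1) ^ (-s) / weight μ κ γ n m ≤
      A * ((n : ℝ) + 1) ^ (-δ) * F m + D m := fun m => by
    by_cases hm : m = n
    · subst hm
      have h1 : ((m : ℝ) + 1) ^ (-s) / weight μ κ γ m m ≤ D m := by
        simp only [hD, if_true]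
        rw [weight_self, div_le_div_iff₀ (by positivity) hκ]
        have h2 : ((m : ℝ) + 1) ^ (-s) ≤ ((m : ℝ) + 1) ^ (-δ) * ((m : ℝ) + 1) ^ (γ - 1) := by
          rw [← Real.rpow_add (by positivity)]
          exact Real.rpow_le_rpow_of_exponent_le (by simp) (by linarith)
        nlinarith
      have h3 := hF0 m
      have : 0 ≤ A * ((m : ℝ) + 1) ^ (-δ) * F m := by positivity
      linarith
    · have hw := h.weight_pos hn m
      have h1 := rpow_neg_le_first hs'1 hδ0 (s := s') (γ := γ) (by rw [hδ]; ring)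
        (a := (m : ℝ) + 1) (b := (n : ℝ) + 1) (by simp) (by simp) (one_le_abs_sub hm)
      have h2 : ((m : ℝ) + 1) ^ (-s) ≤ ((m : ℝ) + 1) ^ (-s') :=
        Real.rpow_le_rpow_of_exponent_le (by simp) (by linarith)
      have h3 := h.sep_weight hn hm
      have h4 := hF0 m
      simp only [hD, if_neg hm, add_zero]
      rw [div_le_iff₀ hw]
      refine h2.trans (h1.trans ?_)
      calc _ = A * ((n : ℝ) + 1) ^ (-δ) * F m *
            (c * (|(m + 1 : ℝ) - (n + 1)| * max ((n : ℝ) + 1) (m + 1) ^ (γ - 1))) := by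
            rw [hA, hF]
            field_simp
        _ ≤ _ := by gcongr
  have hsum := (hTs.mul_left (A * ((n : ℝ) + 1) ^ (-δ))).add hDs.summable
  have hs1 : Summable (fun m : ℕ => ((m : ℝ) + 1) ^ (-s) / weight μ κ γ n m) :=
    Summable.of_nonneg_of_le (fun m => div_nonneg (by positivity) (h.weight_pos hn m).le) hle hsum
  refine ⟨hs1, (hs1.tsum_le_tsum hle hsum).trans ?_⟩
  rw [Summable.tsum_add (hTs.mul_left _) hDs.summable, tsum_mul_left, hDs.tsum_eq]
  have : 0 ≤ ((n : ℝ) + 1) ^ (-δ) := by positivity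
  calc _ ≤ A * ((n : ℝ) + 1) ^ (-δ) * T + ((n : ℝ) + 1) ^ (-δ) / κ := by gcongr
    _ = _ := by ring

theorem sum_le_second {s : ℝ} (hs : 3 / 2 < s + γ) : ∃ C ≥ (0 : ℝ), ∃ δ > (0 : ℝ), ∀ n ≥ N,
    ((n : ℝ) + 1) ^ (-s) * ∑' m : ℕ, ((m : ℝ) + 1) ^ (-s) / weight μ κ γ n m ^ 2 ≤
      C * ((n : ℝ) + 1) ^ (-(1 + δ)) := by
  set δ := s + γ - 3 / 2 with hδ
  have hδ0 : 0 < δ := by rw [hδ]; linarith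
  obtain ⟨T, hT0, hT⟩ := exists_uniform_sum (f := 2) (g := 1 + δ) (by norm_num) (by linarith)
  have hc := h.c_pos
  have hκ := h.kappa_pos
  set A : ℝ := (2 ^ |s| + 4) / c ^ 2 with hA
  have hA0 : 0 < A := by positivity
  refine ⟨A * T + 1 / κ ^ 2, by positivity, δ, hδ0, fun n hn => ?_⟩
  obtain ⟨hTs, hTn⟩ := hT n
  set F : ℕ → ℝ := fun m => |(m + 1 : ℝ) - (n + 1)| ^ (-2 : ℝ) + (m + 1 : ℝ) ^ (-(1 + δ)) with hF
  -- The term `m = n` has the artificial weight `κ (n+1)^(γ-1)` and is bounded separately, outside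
  -- the sum over separated indices.
  set D : ℕ → ℝ := fun m => if m = n then ((n : ℝ) + 1) ^ (-(1 + δ)) / κ ^ 2 else 0 with hD
  have hDs : HasSum D (((n : ℝ) + 1) ^ (-(1 + δ)) / κ ^ 2) := hasSum_ite_eq n _
  have hF0 : ∀ m, 0 ≤ F m := fun m => by positivity
  have hle : ∀ m : ℕ, ((n : ℝ) + 1) ^ (-s) * (((m : ℝ) + 1) ^ (-s) / weight μ κ γ n m ^ 2) ≤
      A * ((n : ℝ) + 1) ^ (-(1 + δ)) * F m + D m := fun m => by
    by_cases hm : m = n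
    · subst hm
      have h1 : ((m : ℝ) + 1) ^ (-s) * (((m : ℝ) + 1) ^ (-s) / weight μ κ γ m m ^ 2) ≤ D m := by
        simp only [hD, if_true]
        have e : ((m : ℝ) + 1) ^ (-s) * ((m : ℝ) + 1) ^ (-s) =
            ((m : ℝ) + 1) ^ (-(1 + 2 * δ)) * (((m : ℝ) + 1) ^ (γ - 1)) ^ 2 := by
          rw [← Real.rpow_add (by positivity), sq, ← Real.rpow_add (by positivity),
            ← Real.rpow_add (by positivity)]
          congr 1
          rw [hδ]
          ring
        have h2 : ((m : ℝ) + 1) ^ (-(1 + 2 * δ)) ≤ ((m : ℝ) + 1) ^ (-(1 + δ)) :=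
          Real.rpow_le_rpow_of_exponent_le (by simp) (by linarith)
        rw [weight_self, ← mul_div_assoc, e, mul_pow]
        calc _ = ((m : ℝ) + 1) ^ (-(1 + 2 * δ)) / κ ^ 2 := by field_simp
          _ ≤ _ := by gcongr
      have h3 := hF0 m
      have : 0 ≤ A * ((m : ℝ) + 1) ^ (-(1 + δ)) * F m := by positivity
      linarith
    · have hw := h.weight_pos hn m
      have h1 := rpow_neg_mul_le h.gamma_pos hδ0 (s := s) (γ := γ) (by rw [hδ]; ring)
        (a := (m : ℝ) + 1) (b := (n : ℝ) + 1) (by simp) (by simp) (one_le_abs_sub hm)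
      have h3 := h.sep_weight hn hm
      set Y := |(m + 1 : ℝ) - (n + 1)| * max ((n : ℝ) + 1) (m + 1) ^ (γ - 1) with hY
      have hY0 : 0 < Y := by
        have := one_le_abs_sub hm
        positivity
      simp only [hD, if_neg hm, add_zero]
      rw [Real.rpow_neg hY0.le, Real.rpow_two] at h1
      have h4 : (weight μ κ γ n m ^ 2)⁻¹ ≤ (Y ^ 2)⁻¹ / c ^ 2 := by
        rw [div_eq_mul_inv, ← mul_inv, ← mul_pow, mul_comm Y c]
        gcongr
      calc _ = ((m : ℝ) + 1) ^ (-s) * ((n : ℝ) + 1) ^ (-s) * (weight μ κ γ n m ^ 2)⁻¹ := by ring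
        _ ≤ ((m : ℝ) + 1) ^ (-s) * ((n : ℝ) + 1) ^ (-s) * ((Y ^ 2)⁻¹ / c ^ 2) := by gcongr
        _ = (((m : ℝ) + 1) ^ (-s) * ((n : ℝ) + 1) ^ (-s) * (Y ^ 2)⁻¹) / c ^ 2 := by ring
        _ ≤ _ / c ^ 2 := div_le_div_of_nonneg_right h1 (by positivity)
        _ = _ := by rw [hA, hF]; ring
  have hsum := (hTs.mul_left (A * ((n : ℝ) + 1) ^ (-(1 + δ)))).add hDs.summable
  have hs1 : Summable fun m : ℕ =>
      ((n : ℝ) + 1) ^ (-s) * (((m : ℝ) + 1) ^ (-s) / weight μ κ γ n m ^ 2) :=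
    Summable.of_nonneg_of_le (fun m => by positivity) hle hsum
  rw [← tsum_mul_left]
  refine (hs1.tsum_le_tsum hle hsum).trans ?_
  rw [Summable.tsum_add (hTs.mul_left _) hDs.summable, tsum_mul_left, hDs.tsum_eq]
  have : 0 ≤ ((n : ℝ) + 1) ^ (-(1 + δ)) := by positivity
  calc _ ≤ A * ((n : ℝ) + 1) ^ (-(1 + δ)) * T + ((n : ℝ) + 1) ^ (-(1 + δ)) / κ ^ 2 := by gcongr
    _ = _ := by ring

theorem summable_sq {s : ℝ} {n : ℕ} (hn : N + 1 ≤ n)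
    (hs : Summable fun m : ℕ => ((m : ℝ) + 1) ^ (-s) / weight μ κ γ n m) :
    Summable fun m : ℕ => ((m : ℝ) + 1) ^ (-s) / weight μ κ γ n m ^ 2 := by
  refine Summable.of_nonneg_of_le (fun m => by positivity) (fun m => ?_)
    (hs.mul_left (2 ^ |γ - 1| / weight μ κ γ n n))
  have hw := h.weight_pos (by omega : N ≤ n) m
  have hw0 := h.weight_self_pos n
  have h1 := h.weight_self_le hn m
  rw [div_mul_div_comm, div_le_div_iff₀ (by positivity) (by positivity)]
  have : 0 ≤ ((m : ℝ) + 1) ^ (-s) * weight μ κ γ n m := by positivity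
  nlinarith

theorem summable_errorSum {s : ℝ} {n : ℕ} (hn : N + 1 ≤ n)
    (hs : Summable fun m : ℕ => ((m : ℝ) + 1) ^ (-s) / weight μ κ γ n m) :
    Summable fun m : ℕ => μ m * ((m : ℝ) + 1) ^ (-s) / weight μ κ γ n m ^ 2 := by
  obtain ⟨C, hC⟩ := h.mu_le_mul_weight hn
  refine Summable.of_nonneg_of_le (fun m => by have := h.pos m; positivity) (fun m => ?_)
    (hs.mul_left C)
  have hw := h.weight_pos (by omega : N ≤ n) m
  rw [div_le_iff₀ (by positivity)]
  have : 0 ≤ ((m : ℝ) + 1) ^ (-s) := by positivity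
  calc μ m * ((m : ℝ) + 1) ^ (-s) ≤ C * weight μ κ γ n m * ((m : ℝ) + 1) ^ (-s) := by
        gcongr
        exact hC m
    _ = _ := by field_simp

theorem errorSum_nonneg (s : ℝ) (n : ℕ) : 0 ≤ errorSum μ κ γ s n :=
  mul_nonneg (div_nonneg (by positivity) (h.pos n).le) (tsum_nonneg fun m => by
    have := h.pos m
    positivity)

theorem errorSum_le {s : ℝ} {n : ℕ} (hn : N + 1 ≤ n)
    (hs : Summable fun m : ℕ => ((m : ℝ) + 1) ^ (-s) / weight μ κ γ n m) :
    errorSum μ κ γ s n ≤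
      ((n : ℝ) + 1) ^ (-s) * ∑' m : ℕ, ((m : ℝ) + 1) ^ (-s) / weight μ κ γ n m ^ 2 +
      ((n : ℝ) + 1) ^ (-s) / μ n * ∑' m : ℕ, ((m : ℝ) + 1) ^ (-s) / weight μ κ γ n m := by
  have hμn := h.pos n
  have h1 := h.summable_sq hn hs
  have hsum := (h1.mul_left (μ n)).add hs
  -- `μ m ≤ μ n + w m` splits the sum into one with `1 / w m ^ 2` and one with `1 / w m`.
  have h2 : ∑' m : ℕ, μ m * ((m : ℝ) + 1) ^ (-s) / weight μ κ γ n m ^ 2 ≤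
      μ n * ∑' m : ℕ, ((m : ℝ) + 1) ^ (-s) / weight μ κ γ n m ^ 2 +
        ∑' m : ℕ, ((m : ℝ) + 1) ^ (-s) / weight μ κ γ n m := by
    rw [← tsum_mul_left, ← Summable.tsum_add (h1.mul_left _) hs]
    refine (h.summable_errorSum hn hs).tsum_le_tsum (fun m => ?_) hsum
    have hw := h.weight_pos (by omega : N ≤ n) m
    have h3 := h.mu_le_add_weight n m
    calc μ m * ((m : ℝ) + 1) ^ (-s) / weight μ κ γ n m ^ 2 ≤
        (μ n + weight μ κ γ n m) * ((m : ℝ) + 1) ^ (-s) / weight μ κ γ n m ^ 2 := by gcongr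
      _ = _ := by field_simp
  rw [errorSum]
  calc _ ≤ ((n : ℝ) + 1) ^ (-s) / μ n *
        (μ n * ∑' m : ℕ, ((m : ℝ) + 1) ^ (-s) / weight μ κ γ n m ^ 2 +
        ∑' m : ℕ, ((m : ℝ) + 1) ^ (-s) / weight μ κ γ n m) := by gcongr
    _ = _ := by field_simp

/-- Both parts of `errorSum_le` are bounded by a multiple of `σ²`. One factor `1 / w m` is traded
for `1 / w n`, as is `1 / μ n`, and `(n+1)^(-s) / w n` is a single term of `σ`, which decays by
`sum_le_first`. -/
theorem tendsto_errorSum {s : ℝ} (hs : 1 < s + γ) : Tendsto (errorSum μ κ γ s) atTop (𝓝 0) := by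
  obtain ⟨C, hC0, δ, hδ, hCn⟩ := h.sum_le_first hs
  have hc := h.c_pos
  have hκ := h.kappa_pos
  set A : ℝ := 2 ^ |γ - 1| + κ / c with hA
  have hA0 : 0 < A := by positivity
  have hlim : Tendsto (fun n : ℕ => A * (C * ((n : ℝ) + 1) ^ (-δ)) ^ 2) atTop (𝓝 0) := by
    have := (((tendsto_rpow_neg hδ).const_mul C).pow 2).const_mul A
    simpa using this
  refine squeeze_zero' (Eventually.of_forall fun n => h.errorSum_nonneg s n) ?_ hlim
  filter_upwards [eventually_ge_atTop (N + 1)] with n hn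
  obtain ⟨hsm, hle⟩ := hCn n (by omega)
  set σ := ∑' m : ℕ, ((m : ℝ) + 1) ^ (-s) / weight μ κ γ n m with hσ
  have hw0 := h.weight_self_pos n
  have hterm : ∀ m : ℕ, 0 ≤ ((m : ℝ) + 1) ^ (-s) / weight μ κ γ n m := fun m =>
    div_nonneg (by positivity) (h.weight_pos (by omega) m).le
  have hσ0 : 0 ≤ σ := tsum_nonneg hterm
  have h1 : ((n : ℝ) + 1) ^ (-s) / weight μ κ γ n n ≤ σ := hsm.le_tsum n fun m _ => hterm m
  have h2 : ∑' m : ℕ, ((m : ℝ) + 1) ^ (-s) / weight μ κ γ n m ^ 2 ≤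
      2 ^ |γ - 1| / weight μ κ γ n n * σ := by
    rw [hσ, ← tsum_mul_left]
    refine (h.summable_sq hn hsm).tsum_le_tsum (fun m => ?_) (hsm.mul_left _)
    have hw := h.weight_pos (by omega : N ≤ n) m
    have h1 := h.weight_self_le hn m
    rw [div_mul_div_comm, div_le_div_iff₀ (by positivity) (by positivity)]
    have : 0 ≤ ((m : ℝ) + 1) ^ (-s) * weight μ κ γ n m := by positivity
    nlinarith
  have h3 : ((n : ℝ) + 1) ^ (-s) / μ n ≤ κ / c * σ := by
    have h4 := h.lower n (by omega)
    have hb : (1 : ℝ) ≤ (n : ℝ) + 1 := by simp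
    have h5 : ((n : ℝ) + 1) ^ (γ - 1) ≤ ((n : ℝ) + 1) ^ γ :=
      Real.rpow_le_rpow_of_exponent_le hb (by linarith)
    have h6 : weight μ κ γ n n ≤ κ / c * μ n := by
      rw [weight_self]
      calc κ * ((n : ℝ) + 1) ^ (γ - 1) ≤ κ * ((n : ℝ) + 1) ^ γ := by gcongr
        _ = κ / c * (c * ((n : ℝ) + 1) ^ γ) := by field_simp
        _ ≤ _ := by gcongr
    have hμn := h.pos n
    calc ((n : ℝ) + 1) ^ (-s) / μ n ≤ κ / c * (((n : ℝ) + 1) ^ (-s) / weight μ κ γ n n) := by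
          rw [← mul_div_assoc, div_le_div_iff₀ hμn hw0]
          have : 0 ≤ ((n : ℝ) + 1) ^ (-s) := by positivity
          nlinarith
      _ ≤ _ := by gcongr
  calc errorSum μ κ γ s n ≤ _ := h.errorSum_le hn hsm
    _ ≤ ((n : ℝ) + 1) ^ (-s) * (2 ^ |γ - 1| / weight μ κ γ n n * σ) + κ / c * σ * σ := by gcongr
    _ = 2 ^ |γ - 1| * (((n : ℝ) + 1) ^ (-s) / weight μ κ γ n n) * σ + κ / c * σ * σ := by ring
    _ ≤ 2 ^ |γ - 1| * σ * σ + κ / c * σ * σ := by gcongr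
    _ = A * σ ^ 2 := by rw [hA]; ring
    _ ≤ _ := by gcongr

/-- The first part of `errorSum_le` decays like `(n+1)^(-(1+δ'))`; the second like `(n+1)^(-(s+γ))`,
because `μ n ≥ c (n+1)^γ`. Both exponents are below `-1`. -/
theorem summable_errorSum_of_lt {s : ℝ} (hs : 3 / 2 < s + γ) : Summable (errorSum μ κ γ s) := by
  obtain ⟨C, hC0, δ, hδ, hCn⟩ := h.sum_le_first (s := s) (by linarith)
  obtain ⟨C', hC0', δ', hδ', hCn'⟩ := h.sum_le_second hs
  have hc := h.c_pos
  rw [← summable_nat_add_iff (N + 1)]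
  refine Summable.of_nonneg_of_le (fun n => h.errorSum_nonneg s _) (fun k => ?_)
    ((summable_nat_add_iff (N + 1)).2 (((summable_rpow_neg (f := 1 + δ') (by linarith)).mul_left
      C').add ((summable_rpow_neg (f := s + γ) (by linarith)).mul_left (C / c))))
  set n := k + (N + 1) with hn
  have hnN : N + 1 ≤ n := by omega
  obtain ⟨hsm, hle⟩ := hCn n (by omega)
  refine (h.errorSum_le hnN hsm).trans (add_le_add (hCn' n (by omega)) ?_)
  have h1 : ∑' m : ℕ, ((m : ℝ) + 1) ^ (-s) / weight μ κ γ n m ≤ C := by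
    refine hle.trans (mul_le_of_le_one_right hC0 ?_)
    exact Real.rpow_le_one_of_one_le_of_nonpos (by simp) (by linarith)
  have h2 := h.lower n (by omega)
  have hμn := h.pos n
  have hb : (0 : ℝ) < (n : ℝ) + 1 := by positivity
  have h3 : ((n : ℝ) + 1) ^ (-s) / μ n ≤ ((n : ℝ) + 1) ^ (-(s + γ)) / c := by
    have e : ((n : ℝ) + 1) ^ (-s) = ((n : ℝ) + 1) ^ (-(s + γ)) * ((n : ℝ) + 1) ^ γ := by
      rw [← Real.rpow_add hb]
      congr 1
      ring
    rw [div_le_div_iff₀ hμn hc, e, mul_assoc]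
    gcongr
    linarith
  have h4 : 0 ≤ ∑' m : ℕ, ((m : ℝ) + 1) ^ (-s) / weight μ κ γ n m := tsum_nonneg fun m =>
    div_nonneg (by positivity) (h.weight_pos (by omega) m).le
  calc _ ≤ ((n : ℝ) + 1) ^ (-(s + γ)) / c * C := mul_le_mul h3 h1 h4 (by positivity)
    _ = _ := by ring

end IsSeparated

/-! ### Asymptotics of the perturbed eigenpairs -/

section Asymptotics

variable {H : Type*} [NormedAddCommGroup H] [InnerProductSpace ℂ H] {V : Submodule ℂ H}

/-- Transfers the estimates for the constructed pairs to any pairs with the same defining property.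
-/
theorem IsPerturbedEigenpair.unique {T : H →ₗ.[ℂ] H} {μ : ℕ → ℝ} {κ γ : ℝ} {n : ℕ} {x u u' : H}
    {l l' : ℂ} (h : IsPerturbedEigenpair T μ κ γ n x l u)
    (h' : IsPerturbedEigenpair T μ κ γ n x l' u') : l = l' ∧ u = u' := by
  refine ⟨?_, h.eq_riesz.trans h'.eq_riesz.symm⟩
  by_contra hne
  exact h.eigenpair.not_mem_resolventSet (h'.isolated l (subset_closure h.mem_rectangle) hne)

theorem norm_smul_inv_sub_le {E : Type*} [NormedAddCommGroup E] [NormedSpace ℂ E] {v e : E}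
    {r : ℝ} (hr : 0 < r) (he : ‖e‖ = 1) :
    ‖((‖v‖⁻¹ : ℝ) : ℂ) • v - e‖ ≤ 2 * ‖((r⁻¹ : ℝ) : ℂ) • v - e‖ := by
  -- For `v = 0` the inverse norm is read as `0`, and the claim is `1 ≤ 2`.
  rcases eq_or_ne v 0 with rfl | hv
  · simp [he]
  · have hv0 : 0 < ‖v‖ := norm_pos_iff.2 hv
    have h1 : ‖((‖v‖⁻¹ : ℝ) : ℂ) • v - ((r⁻¹ : ℝ) : ℂ) • v‖ = |1 - ‖((r⁻¹ : ℝ) : ℂ) • v‖| := by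
      rw [← sub_smul, norm_smul, norm_smul, ← Complex.ofReal_sub, Complex.norm_real,
        Complex.norm_real, Real.norm_of_nonneg (inv_pos.2 hr).le, Real.norm_eq_abs]
      nth_rewrite 2 [← abs_of_pos hv0]
      rw [← abs_mul, sub_mul, inv_mul_cancel₀ hv0.ne']
    have h2 : |1 - ‖((r⁻¹ : ℝ) : ℂ) • v‖| ≤ ‖((r⁻¹ : ℝ) : ℂ) • v - e‖ := by
      rw [← he, norm_sub_rev]
      exact abs_norm_sub_norm_le _ _
    have h3 := norm_sub_le_norm_sub_add_norm_sub (((‖v‖⁻¹ : ℝ) : ℂ) • v) (((r⁻¹ : ℝ) : ℂ) • v) e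
    linarith

theorem IsSeparated.norm_sub_le_of_mem_rectangle {μ : ℕ → ℝ} {κ γ c : ℝ} {N : ℕ}
    (h : IsSeparated μ κ γ c N) {n : ℕ} (hn : 1 ≤ n) {z : ℂ} (hz : z ∈ rectangle μ κ γ n) :
    ‖z - μ n‖ ≤ κ * 2 ^ |γ - 1| * ((n : ℝ) + 1) ^ (γ - 1) := by
  obtain ⟨h1, h2, h3, h4⟩ := hz
  simp only [lowerCorner, upperCorner] at h1 h2 h3 h4
  have hκ := h.kappa_pos
  have hn1 : (1 : ℝ) ≤ n := by exact_mod_cast hn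
  have h5 := rpow_le_two_rpow_abs_mul (a := (n : ℝ)) (X := (n : ℝ) + 1) (γ - 1)
    (by linarith) (by linarith) (by linarith)
  have h6 : (1 : ℝ) ≤ 2 ^ |γ - 1| := Real.one_le_rpow one_le_two (abs_nonneg _)
  set b := ((n : ℝ) + 1) ^ (γ - 1) with hb
  have hb0 : 0 < b := by positivity
  set C : ℝ := 2 ^ |γ - 1| with hC
  have h7 : κ / 2 * b ≤ κ / 2 * (C * b) := by
    gcongr
    exact le_mul_of_one_le_left hb0.le h6
  have h8 : κ / 2 * (n : ℝ) ^ (γ - 1) ≤ κ / 2 * (C * b) := by gcongr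
  refine (Complex.norm_le_abs_re_add_abs_im _).trans ?_
  have h9 : |(z - μ n).re| ≤ κ / 2 * (C * b) := by
    rw [Complex.sub_re, Complex.ofReal_re, abs_le]
    constructor <;> linarith
  have h10 : |(z - μ n).im| ≤ κ / 2 * (C * b) := by
    rw [Complex.sub_im, Complex.ofReal_im, sub_zero, abs_le]
    constructor <;> linarith
  calc _ ≤ κ / 2 * (C * b) + κ / 2 * (C * b) := add_le_add h9 h10
    _ = _ := by ring

/-- The rectangle has size of order `(n+1)^(γ-1)` while `μ n` is at least of order `(n+1)^γ`, so the
relative error is `O(1/n)`. -/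
theorem IsSeparated.tendsto_sqrt_norm_div {μ : ℕ → ℝ} {κ γ c : ℝ} {N : ℕ}
    (h : IsSeparated μ κ γ c N) {l : ℕ → ℂ} {N' : ℕ}
    (hl : ∀ n ≥ N', l n ∈ rectangle μ κ γ n) :
    Tendsto (fun n => √‖l n‖ / √(μ n)) atTop (𝓝 1) := by
  have hc := h.c_pos
  have hκ := h.kappa_pos
  have h1 : Tendsto (fun n => ‖l n‖ / μ n - 1) atTop (𝓝 0) := by
    have hlim : Tendsto (fun n : ℕ => κ * 2 ^ |γ - 1| / c * ((n : ℝ) + 1) ^ (-(1 : ℝ))) atTop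
        (𝓝 0) := by
      simpa using (tendsto_rpow_neg one_pos).const_mul (κ * 2 ^ |γ - 1| / c)
    refine squeeze_zero_norm' ?_ hlim
    filter_upwards [eventually_ge_atTop (N + N' + 1)] with n hn
    have h2 := h.norm_sub_le_of_mem_rectangle (by omega) (hl n (by omega))
    have h3 := h.lower n (by omega)
    have hμ := h.pos n
    have hb : (0 : ℝ) < (n : ℝ) + 1 := by positivity
    have h4 := abs_norm_sub_norm_le (l n) (μ n)
    rw [Complex.norm_real, Real.norm_of_nonneg hμ.le] at h4
    have e : ‖l n‖ / μ n - 1 = (‖l n‖ - μ n) / μ n := by field_simp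
    have e2 : ((n : ℝ) + 1) ^ (γ - 1) = ((n : ℝ) + 1) ^ γ * ((n : ℝ) + 1) ^ (-(1 : ℝ)) := by
      rw [← Real.rpow_add hb]
      congr 1
    rw [e, norm_div, Real.norm_eq_abs, Real.norm_of_nonneg hμ.le, div_le_iff₀ hμ]
    calc _ ≤ κ * 2 ^ |γ - 1| * ((n : ℝ) + 1) ^ (γ - 1) := h4.trans h2
      _ = κ * 2 ^ |γ - 1| / c * ((n : ℝ) + 1) ^ (-(1 : ℝ)) * (c * ((n : ℝ) + 1) ^ γ) := by
          rw [e2]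
          field_simp
      _ ≤ _ := by gcongr
  have h5 : Tendsto (fun n => ‖l n‖ / μ n) atTop (𝓝 1) := by
    simpa using h1.add_const 1
  have h6 := (Real.continuous_sqrt.tendsto 1).comp h5
  rw [Real.sqrt_one] at h6
  refine h6.congr fun n => ?_
  exact Real.sqrt_div (norm_nonneg _) _

/-- For large `n` the perturbed eigenpairs exist; the distance of the eigenvectors from the
unperturbed ones is controlled by `errorSum`. -/
theorem eventually_exists_perturbedEigenpair [CompleteSpace H] {a b : V →ₗ[ℂ] V →ₗ⋆[ℂ] ℂ}
    {μ : ℕ → ℝ} {ψ : ℕ → V} {U : SeqSpace ≃ₗ[ℂ] V} {B : SeqSpace →L[ℂ] SeqSpace}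
    (h : IsCoordinates a b μ ψ U B) (hV : Dense (V : Set H)) {κ γ c : ℝ} {N : ℕ}
    (hsep : IsSeparated μ κ γ c N) {α M : ℝ} (hα : 1 < 2 * α + γ) (hM : 0 < M)
    (hloc : ∀ m n, ‖b (ψ m) (ψ n)‖ ≤ M / (((m : ℝ) + 1) ^ α * ((n : ℝ) + 1) ^ α)) :
    ∀ᶠ n in atTop, ∃ (l : ℂ) (ζ : SeqSpace),
      IsPerturbedEigenpair (formOperator (a + b)) μ κ γ n (ψ n) l (U ζ : H) ∧
      ‖(((√(μ n))⁻¹ : ℝ) : ℂ) • ζ - stdVec n‖ ^ 2 ≤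
        1600 * M ^ 2 * errorSum μ κ γ (2 * α) n := by
  obtain ⟨C, hC0, δ, hδ, hC⟩ := hsep.sum_le_first (s := 2 * α) hα
  set G : ℝ := 2 ^ |γ - 1| with hG
  have hG0 : 0 < G := by positivity
  have hlim : Tendsto (fun n : ℕ => M * (C * ((n : ℝ) + 1) ^ (-δ))) atTop (𝓝 0) := by
    simpa using ((tendsto_rpow_neg hδ).const_mul C).const_mul M
  -- The first threshold gives `128 G τ² ≤ 1`; the second gives `6 p_n² ≤ 1 / (4 G)`, so that the
  -- ball for the fixed point fits into the rectangle.
  have ev1 := hlim.eventually_le_const (show (0 : ℝ) < 1 / (128 * G) by positivity)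
  have ev2 := hlim.eventually_le_const (show (0 : ℝ) < 1 / (24 * G) by positivity)
  filter_upwards [ev1, ev2, eventually_ge_atTop (N + 1)] with n hn1 hn2 hn
  obtain ⟨hsum, hle⟩ := hC n (by omega)
  set w := weight μ κ γ n with hw
  have hw0 : ∀ m, 0 < w m := fun m => hsep.weight_pos (by omega) m
  set σ := ∑' m : ℕ, ((m : ℝ) + 1) ^ (-(2 * α)) / w m with hσ
  have hσ0 : 0 ≤ σ := tsum_nonneg fun m => div_nonneg (by positivity) (hw0 m).le
  set p : ℕ → ℝ := fun m => √M * ((m : ℝ) + 1) ^ (-α) / √(w m) with hp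
  have hp2 : ∀ m, p m ^ 2 = M * (((m : ℝ) + 1) ^ (-(2 * α)) / w m) := fun m => by
    simp only [hp]
    rw [div_pow, mul_pow, Real.sq_sqrt hM.le, Real.sq_sqrt (hw0 m).le, ← Real.rpow_natCast,
      ← Real.rpow_mul (by positivity), mul_div_assoc]
    congr 4
    push_cast
    ring
  have hτ : HasSum (fun m => p m ^ 2) (√(M * σ) ^ 2) := by
    rw [Real.sq_sqrt (by positivity)]
    simp only [hp2]
    exact hsum.hasSum.mul_left M
  have hτle : M * σ ≤ M * (C * ((n : ℝ) + 1) ^ (-δ)) := by gcongr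
  have hμw := hsep.mu_le_mul_weight hn
  have hwμ := hsep.weight_le_mul_mu n
  have hpn : p n ^ 2 ≤ M * σ := by
    have := le_hasSum hτ n fun m _ => sq_nonneg (p m)
    rwa [Real.sq_sqrt (by positivity)] at this
  have hK : IsSmall n μ w (diag (fun m => (√(μ m / w m) : ℂ)) ∘L B ∘L
      diag (fun m => (√(μ m / w m) : ℂ))) p (√(M * σ)) G
      (Set.Icc (lowerCorner μ κ γ n).re (upperCorner μ κ γ n).re ×ℂ
        Set.Icc (lowerCorner μ κ γ n).im (upperCorner μ κ γ n).im) :=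
    { w_pos := hw0
      w_le := fun m => hsep.weight_self_le hn m
      mu_le := by
        obtain ⟨C', hC'⟩ := hμw
        exact ⟨C', fun m => by rw [abs_of_pos (hsep.pos m)]; exact hC' m⟩
      p_nonneg := fun m => by positivity
      tau_nonneg := Real.sqrt_nonneg _
      hasSum := hτ
      entries := fun m k => by
        rw [h.norm_K_entries hw0 hμw]
        have h1 := hloc k m
        have hm := hw0 m
        have hk := hw0 k
        have hm' := Real.sqrt_pos.2 hm
        have hk' := Real.sqrt_pos.2 hk
        calc _ ≤ M / (((k : ℝ) + 1) ^ α * ((m : ℝ) + 1) ^ α) / (√(w m) * √(w k)) := by gcongr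
          _ = √M * √M * ((m : ℝ) + 1) ^ (-α) * ((k : ℝ) + 1) ^ (-α) / (√(w m) * √(w k)) := by
              rw [Real.mul_self_sqrt hM.le, Real.rpow_neg (by positivity),
                Real.rpow_neg (by positivity)]
              field_simp
          _ = _ := by
              simp only [hp]
              field_simp
      small := by
        rw [Real.sq_sqrt (by positivity)]
        have := hτle.trans hn1
        rw [le_div_iff₀ (by positivity)] at this
        linarith
      dist := fun z hz m hm => hsep.weight_le_two_mul_dist hn hz hm }
  have hS : HasSum (fun m => μ m * p m ^ 2 / w m)
      (M * ∑' m : ℕ, μ m * ((m : ℝ) + 1) ^ (-(2 * α)) / w m ^ 2) := by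
    refine ((hsep.summable_errorSum hn hsum).hasSum.mul_left M).congr_fun fun m => ?_
    rw [hp2, ← hw]
    have := (hw0 m).ne'
    field_simp
  have hq : 6 * p n ^ 2 ≤ 1 / (4 * G) := by
    have h1 := (hpn.trans hτle).trans hn2
    rw [le_div_iff₀ (by positivity)] at h1 ⊢
    linarith
  obtain ⟨l, ζ, hpert, hζ⟩ := exists_perturbedEigenpair h hV hμw hwμ hK (by positivity) hq
    (hsep.closedBall_subset_rectangle (by omega)) hS
  refine ⟨l, ζ, hpert, ?_⟩
  rw [Complex.ofReal_inv]
  refine (pow_le_pow_left₀ (norm_nonneg _) hζ 2).trans_eq ?_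
  have hwn := hw0 n
  have hμn := hsep.pos n
  have hS0 := hS.nonneg fun m =>
    div_nonneg (mul_nonneg (hsep.pos m).le (sq_nonneg _)) (hw0 m).le
  rw [mul_pow, Real.sq_sqrt (mul_nonneg (by positivity) hS0), hp2, errorSum, ← hw]
  field_simp
  ring

end Asymptotics

end FormPerturbation

end

/-! ### The main theorem. -/

theorem mainTheorem10 {H : Type*} [NormedAddCommGroup H] [InnerProductSpace ℂ H]
    [CompleteSpace H]
    -- the closed, densely defined, Hermitian, positive definite form `a` with domain `V`
    (V : Submodule ℂ H) (hV : Dense (V : Set H))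
    (a : V →ₗ[ℂ] V →ₗ⋆[ℂ] ℂ)
    (ha_herm : ∀ u v, a u v = starRingEnd ℂ (a v u))
    (ha_pos : ∀ u, u ≠ 0 → 0 < (a u u).re)
    (ha_closed : FormPerturbation.IsClosedForm a)
    -- the bounded sesquilinear form `b` on `V`
    (b : V →ₗ[ℂ] V →ₗ⋆[ℂ] ℂ)
    (hb : ∃ C : ℝ, ∀ u v, ‖b u v‖ ≤
      C * FormPerturbation.energyNorm a u * FormPerturbation.energyNorm a v)
    -- the eigenpairs of the operator of `a`; the eigenvectors form an orthonormal basis of `H`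
    (μ : ℕ → ℝ) (ψ : ℕ → V)
    (hψ_orth : Orthonormal ℂ (fun k => (ψ k : H)))
    (hψ_total : (Submodule.span ℂ (Set.range fun k => (ψ k : H))).topologicalClosure = ⊤)
    (hψ_eig : ∀ k, FormPerturbation.IsEigenpair (FormPerturbation.formOperator a)
      (μ k : ℂ) (ψ k : H))
    -- eigenvalue separation
    (γ κ : ℝ) (hγ : 0 < γ) (hκ : 0 < κ) (N₀ : ℕ)
    (hsep : ∀ k ≥ N₀, κ * ((k : ℝ) + 1) ^ (γ - 1) ≤ μ (k + 1) - μ k)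
    -- local form-subordination
    (α M : ℝ) (hα : 1 < 2 * α + γ) (hM : 0 < M)
    (hloc : ∀ m n, ‖b (ψ m) (ψ n)‖ ≤ M / (((m : ℝ) + 1) ^ α * ((n : ℝ) + 1) ^ α)) :
    (∃ N : ℕ, ∀ n ≥ N, ∃ (z : ℂ) (u : V),
      FormPerturbation.IsPerturbedEigenpair (FormPerturbation.formOperator (a + b))
        μ κ γ n (ψ n) z u) ∧
    ∀ (lam : ℕ → ℂ) (φ : ℕ → V),
      (∃ N : ℕ, ∀ n ≥ N,
        FormPerturbation.IsPerturbedEigenpair (FormPerturbation.formOperator (a + b))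
          μ κ γ n (ψ n) (lam n) (φ n)) →
      Tendsto (fun j => √‖lam j‖ / √(μ j)) atTop (𝓝 1) ∧
      Tendsto (fun j => √‖lam j‖ / FormPerturbation.energyNorm a (φ j)) atTop (𝓝 1) ∧
      ((α ≤ 1 → 3 / 2 < 2 * α + γ) → (1 < α → 1 < 2 * α + γ) →
        Summable fun j => FormPerturbation.energyNorm a
          (((FormPerturbation.energyNorm a (φ j))⁻¹ : ℂ) • φ j -
            ((√(μ j))⁻¹ : ℂ) • ψ j) ^ 2) := by
  have heig : ∀ k v, a (ψ k) v = μ k * inner ℂ (v : H) (ψ k : H) := fun k v =>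
    FormPerturbation.form_eigenvector_apply hV (hψ_eig k) v
  -- Positivity of the eigenvalues comes from `μ k = a(ψ k, ψ k)`.
  have hμ : ∀ k, 0 < μ k := fun k => by
    have hne : ψ k ≠ 0 := fun h0 => (hψ_eig k).1 (by rw [h0]; rfl)
    have h1 := ha_pos (ψ k) hne
    rw [heig, inner_self_eq_norm_sq_to_K, hψ_orth.1 k] at h1
    simpa using h1
  obtain ⟨c₀, hc₀, hμc⟩ := FormPerturbation.exists_pos_le_of_separated hμ (N₀ := N₀) fun k hk => by
    have h1 := hsep k hk
    have h2 : 0 < κ * ((k : ℝ) + 1) ^ (γ - 1) := by positivity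
    linarith
  obtain ⟨c, hc, N, hN, hNs⟩ := FormPerturbation.exists_separation hγ hκ hsep
  have hS : FormPerturbation.IsSeparated μ κ γ c N :=
    ⟨hγ, hκ, hc, hμ, ⟨c₀, hc₀, hμc⟩, fun k hk => hsep k (hN.trans hk), fun n hn => (hNs n hn).1,
      fun n hn => (hNs n hn).2.1, fun n hn => (hNs n hn).2.2⟩
  obtain ⟨U, hUa, hUi, hUe⟩ := FormPerturbation.exists_coordinates hV a ha_herm ha_pos ha_closed μ ψ
    hψ_orth hψ_total hψ_eig hc₀ hμc
  obtain ⟨B, hB⟩ := FormPerturbation.exists_form_operator a b U hUa hb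
  have hcoord : FormPerturbation.IsCoordinates a b μ ψ U B :=
    ⟨⟨c₀, hc₀, hμc⟩, hUa, hB, hUi, hUe⟩
  obtain ⟨N₁, hN₁⟩ := eventually_atTop.1
    (FormPerturbation.eventually_exists_perturbedEigenpair hcoord hV hS hα hM hloc)
  refine ⟨⟨N₁, fun n hn => ?_⟩, fun lam φ ⟨N₂, hN₂⟩ => ?_⟩
  · obtain ⟨l, ζ, h, -⟩ := hN₁ n hn
    exact ⟨l, U ζ, h⟩
  have hsμ : ∀ n, 0 < √(μ n) := fun n => Real.sqrt_pos.2 (hμ n)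
  have hbound : ∀ n ≥ N₁ + N₂,
      ‖(((√(μ n))⁻¹ : ℝ) : ℂ) • U.symm (φ n) - FormPerturbation.stdVec n‖ ^ 2 ≤
        1600 * M ^ 2 * FormPerturbation.errorSum μ κ γ (2 * α) n := fun n hn => by
    obtain ⟨l, ζ, h, hζ⟩ := hN₁ n (by omega)
    have h1 := ((hN₂ n (by omega)).unique h).2
    have h2 : U.symm (φ n) = ζ := by
      rw [Subtype.ext h1, LinearEquiv.symm_apply_apply]
    rwa [h2]
  have henergy : ∀ n, FormPerturbation.energyNorm a (φ n) = ‖U.symm (φ n)‖ := fun n => by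
    rw [← hcoord.energyNorm_eq, LinearEquiv.apply_symm_apply]
  have hlam := hS.tendsto_sqrt_norm_div (l := lam) (N' := N₂) fun n hn => (hN₂ n hn).mem_rectangle
  refine ⟨hlam, ?_, fun h1 h2 => ?_⟩
  · have hz : Tendsto (fun n => ‖(((√(μ n))⁻¹ : ℝ) : ℂ) • U.symm (φ n) -
        FormPerturbation.stdVec n‖ ^ 2) atTop (𝓝 0) := by
      have := (hS.tendsto_errorSum hα).const_mul (1600 * M ^ 2)
      rw [mul_zero] at this
      refine squeeze_zero' (Eventually.of_forall fun n => by positivity) ?_ this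
      filter_upwards [eventually_ge_atTop (N₁ + N₂)] with n hn using hbound n hn
    have hz' : Tendsto (fun n => ‖(((√(μ n))⁻¹ : ℝ) : ℂ) • U.symm (φ n) -
        FormPerturbation.stdVec n‖) atTop (𝓝 0) := by
      have := (Real.continuous_sqrt.tendsto 0).comp hz
      rw [Real.sqrt_zero] at this
      exact this.congr fun n => Real.sqrt_sq (norm_nonneg _)
    have hnorm : Tendsto (fun n => ‖U.symm (φ n)‖ / √(μ n)) atTop (𝓝 1) := by
      rw [tendsto_iff_norm_sub_tendsto_zero]
      refine squeeze_zero (fun n => norm_nonneg _) (fun n => ?_) hz'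
      have h3 := abs_norm_sub_norm_le ((((√(μ n))⁻¹ : ℝ) : ℂ) • U.symm (φ n))
        (FormPerturbation.stdVec n)
      rw [FormPerturbation.norm_stdVec, norm_smul, Complex.norm_real,
        Real.norm_of_nonneg (inv_pos.2 (hsμ n)).le, inv_mul_eq_div] at h3
      exact h3
    have := hlam.div hnorm one_ne_zero
    rw [div_one] at this
    refine this.congr fun n => ?_
    rw [henergy]
    have := (hsμ n).ne'
    rw [Pi.div_apply, div_div_div_cancel_right₀ this]
  -- For `α > 1` the bound `2α + γ > 2` is automatic, so both cases reduce to the same inequality.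
  · have hs : 3 / 2 < 2 * α + γ := by
      rcases le_or_gt α 1 with h | h
      · exact h1 h
      · linarith
    refine Summable.of_norm_bounded_eventually_nat
      (((hS.summable_errorSum_of_lt hs).mul_left (1600 * M ^ 2)).mul_left 4) ?_
    filter_upwards [eventually_ge_atTop (N₁ + N₂)] with n hn
    have h3 : ((FormPerturbation.energyNorm a (φ n))⁻¹ : ℂ) • φ n - ((√(μ n))⁻¹ : ℂ) • ψ n =
        U (((‖U.symm (φ n)‖⁻¹ : ℝ) : ℂ) • U.symm (φ n) - FormPerturbation.stdVec n) := by
      rw [map_sub, map_smul, LinearEquiv.apply_symm_apply, hUe, henergy, Complex.ofReal_inv]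
    rw [h3, hcoord.energyNorm_eq, norm_pow, norm_norm]
    -- Normalizing by `‖φ_n‖_V` instead of `√(μ n)` costs at most a factor `2`.
    have h4 := FormPerturbation.norm_smul_inv_sub_le (v := U.symm (φ n)) (hsμ n)
      (FormPerturbation.norm_stdVec n)
    calc _ ≤ (2 * ‖(((√(μ n))⁻¹ : ℝ) : ℂ) • U.symm (φ n) - FormPerturbation.stdVec n‖) ^ 2 :=
          pow_le_pow_left₀ (norm_nonneg _) h4 2
      _ = 4 * ‖(((√(μ n))⁻¹ : ℝ) : ℂ) • U.symm (φ n) - FormPerturbation.stdVec n‖ ^ 2 := by ring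
      _ ≤ _ := by
          have := hbound n hn
          gcongr
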